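/- Fix an integer $k\ge 1$, let $q=e^{\pi i/(k+2)}$, write $[n]=\frac{q^n-q^{-n}}{q-q^{-1}}$ and $\delta=-[2]=-q-q^{-1}$. Let $\mathcal D$ be the strict monoidal category with objects $0,1,2,\dots$ whose morphisms $m\to n$ are the planar (crossingless) diagrams in a rectangle with $m$ points at the bottom and $n$ points at the top, closed loops being allowed, up to isotopy; composition is vertical stacking and the tensor product is horizontal juxtaposition. (Equivalently, $\mathcal D$ is the free strict monoidal category on one object $1$ and morphisms $\cup:0\to 2$, $\cap:2\to 0$ subject to the two zigzag identities.) Let $TL$ be the additive and idempotent completion of the quotient of the $\mathbb C$-linearization of $\mathcal D$ by the relation that every loop equals $\delta$. The Jones–Wenzl projections $f_i:i\to i$, $0\le i\le k+1$, are given by $f_0=1_0$, $f_1=1_1$ and $$f_i=f_{i-1}\otimes 1_1+\tfrac{[i-1]}{[i]}\,(f_{i-1}\otimes 1_1)\circ(1_{i-2}\otimes(\cup\circ\cap))\circ(f_{i-1}\otimes 1_1)\qquad(i\ge 2);$$ they are idempotents and define objects $F_i=(i,f_i)$ of $TL$, with $F_0=\mathbb 1$. Let $\widetilde{TL}$ be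 the quotient of $TL$ by the two-sided tensor ideal of morphisms generated by (the identity of) $F_{k+1}$. For $i+j\le k$ let $\pi_{i,j}=f_{i+j}\circ(f_i\otimes f_j):F_i\otimes F_j\to F_{i+j}$. Put $\Sigma=\bigoplus_{i=0}^k F_i$ in $\widetilde{TL}$, let $u:\mathbb 1=F_0\to\Sigma$ be the inclusion, and let $m:\Sigma\otimes\Sigma\to\Sigma$ be the morphism whose component on $F_i\otimes F_j$ is $\pi_{i,j}$ followed by the inclusion $F_{i+j}\to\Sigma$ if $i+j\le k$, and zero otherwise. Let $n:\Sigma\to F_k$ be the projection. Then $(\Sigma,u,m)$ is an algebra object of the monoidal category $\widetilde{TL}$, $\Sigma$ has a left dual, that is, an object $\Sigma^\vee$ with an evaluation $\Sigma^\vee\otimes\Sigma\to\mathbb 1$ and a coevaluation $c_\Sigma:\mathbb 1\to\Sigma\otimes\Sigma^\vee$ satisfying the triangle identities, and $(F_k,n)$ is a Frobenius structure on $\Sigma$: for every choice of the left dual the morphism $$\varphi:\ \Sigma\xrightarrow{\,1_\Sigma\otimes c_\Sigma\,}\Sigma\otimes\Sigma\otimes\Sigma^\vee\xrightarrow{\,(n\circ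 m)\otimes 1_{\Sigma^\vee}\,}F_k\otimes\Sigma^\vee$$ is an isomorphism. -/

import Mathlib

open CategoryTheory MonoidalCategory Limits

namespace TLJ

noncomputable section

/-- Formal planar diagrams with `m` points at the bottom and `n` points at the top, built from
vertical strands, the cup and the cap by stacking (`comp f g` has `g` on top of `f`) and by
horizontal juxtaposition. -/
inductive Word : ℕ → ℕ → Type
  | ident {m n : ℕ} (h : m = n) : Word m n
  | cup : Word 0 2
  | cap : Word 2 0
  | comp {l m n : ℕ} (f : Word l m) (g : Word m n) : Word l n
  | tensor {a b c d m n : ℕ} (f : Word a b) (g : Word c d)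
      (hm : m = a + c) (hn : n = b + d) : Word m n

namespace Word

/-- Isotopy of planar diagrams, as the congruence on formal diagrams generated by the axioms of a
strict monoidal category and by the two zigzag (straightening) relations. No relation removes a
closed loop. -/
inductive Rel : ∀ {m n : ℕ}, Word m n → Word m n → Prop
  | refl {m n : ℕ} (f : Word m n) : Rel f f
  | symm {m n : ℕ} {f g : Word m n} : Rel f g → Rel g f
  | trans {m n : ℕ} {f g h : Word m n} : Rel f g → Rel g h → Rel f h
  | comp_congr {l m n : ℕ} {f f' : Word l m} {g g' : Word m n} :
      Rel f f' → Rel g g' → Rel (comp f g) (comp f' g')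
  | tensor_congr {a b c d m n : ℕ} {f f' : Word a b} {g g' : Word c d}
      (hm : m = a + c) (hn : n = b + d) :
      Rel f f' → Rel g g' → Rel (tensor f g hm hn) (tensor f' g' hm hn)
  | id_comp {m n : ℕ} (f : Word m n) : Rel (comp (ident rfl) f) f
  | comp_id {m n : ℕ} (f : Word m n) : Rel (comp f (ident rfl)) f
  | assoc {a b c d : ℕ} (f : Word a b) (g : Word b c) (h : Word c d) :
      Rel (comp (comp f g) h) (comp f (comp g h))
  | tensor_id {a b m : ℕ} (hm : m = a + b) :
      Rel (tensor (ident rfl) (ident rfl) hm hm) (ident rfl)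
  | tensor_comp {a₁ a₂ a₃ b₁ b₂ b₃ m n : ℕ}
      (f₁ : Word a₁ a₂) (f₂ : Word a₂ a₃) (g₁ : Word b₁ b₂) (g₂ : Word b₂ b₃)
      (hm : m = a₁ + b₁) (hn : n = a₃ + b₃) :
      Rel (tensor (comp f₁ f₂) (comp g₁ g₂) hm hn)
        (comp (tensor f₁ g₁ hm rfl) (tensor f₂ g₂ rfl hn))
  | tensor_assoc {a₁ a₂ a₃ b₁ b₂ b₃ m n : ℕ}
      (f₁ : Word a₁ b₁) (f₂ : Word a₂ b₂) (f₃ : Word a₃ b₃)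
      (hm : m = a₁ + a₂ + a₃) (hn : n = b₁ + b₂ + b₃)
      (hm' : m = a₁ + (a₂ + a₃)) (hn' : n = b₁ + (b₂ + b₃)) :
      Rel (tensor (tensor f₁ f₂ rfl rfl) f₃ hm hn) (tensor f₁ (tensor f₂ f₃ rfl rfl) hm' hn')
  | unit_tensor {m n : ℕ} (f : Word m n) (hm : m = 0 + m) (hn : n = 0 + n) :
      Rel (tensor (ident (rfl : 0 = 0)) f hm hn) f
  | tensor_unit {m n : ℕ} (f : Word m n) (hm : m = m + 0) (hn : n = n + 0) :
      Rel (tensor f (ident (rfl : 0 = 0)) hm hn) f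
  | zigzag_left :
      Rel (comp (tensor cup (ident (rfl : 1 = 1)) (rfl : 1 = 0 + 1) (rfl : 3 = 2 + 1))
        (tensor (ident (rfl : 1 = 1)) cap (rfl : 3 = 1 + 2) (rfl : 1 = 1 + 0))) (ident rfl)
  | zigzag_right :
      Rel (comp (tensor (ident (rfl : 1 = 1)) cup (rfl : 1 = 1 + 0) (rfl : 3 = 1 + 2))
        (tensor cap (ident (rfl : 1 = 1)) (rfl : 3 = 2 + 1) (rfl : 1 = 0 + 1))) (ident rfl)

/-- Isotopy as an equivalence relation. -/
def setoid (m n : ℕ) : Setoid (Word m n) where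
  r := Rel
  iseqv := ⟨Rel.refl, Rel.symm, Rel.trans⟩

end Word

/-- The category of planar diagrams up to isotopy; its objects are the natural numbers. It is the
free (strict) pivotal monoidal category on one self-dual generator. -/
@[ext]
structure Diag where
  n : ℕ

namespace Diag

/-- Planar diagrams up to isotopy. -/
@[ext]
structure Hom (X Y : Diag) where
  q : _root_.Quotient (Word.setoid X.n Y.n)

/-- The class of a formal diagram. -/
def mk' {X Y : Diag} (w : Word X.n Y.n) : Hom X Y := ⟨_root_.Quotient.mk _ w⟩

theorem sound {X Y : Diag} {v w : Word X.n Y.n} (h : Word.Rel v w) : mk' (X := X) (Y := Y) v = mk' w :=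
  congrArg Hom.mk (Quotient.sound h)

theorem ind {X Y : Diag} {P : Hom X Y → Prop} (h : ∀ w, P (mk' w)) (f : Hom X Y) : P f := by
  obtain ⟨q⟩ := f
  induction q using Quotient.inductionOn with | _ w => exact h w

/-- Vertical stacking. -/
def comp' {X Y Z : Diag} (f : Hom X Y) (g : Hom Y Z) : Hom X Z :=
  ⟨Quotient.map₂ Word.comp (fun _ _ h _ _ h' => Word.Rel.comp_congr h h') f.q g.q⟩

instance : Category Diag where
  Hom := Hom
  id X := mk' (.ident rfl)
  comp := comp'
  id_comp f := by
    induction f using ind with | _ f => exact sound (.id_comp f)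
  comp_id f := by
    induction f using ind with | _ f => exact sound (.comp_id f)
  assoc f g h := by
    induction f using ind with | _ f =>
    induction g using ind with | _ g =>
    induction h using ind with | _ h => exact sound (.assoc f g h)

/-- Horizontal juxtaposition. -/
def tensorHom' {X₁ Y₁ X₂ Y₂ : Diag} (f : X₁ ⟶ Y₁) (g : X₂ ⟶ Y₂) :
    (⟨X₁.n + X₂.n⟩ : Diag) ⟶ ⟨Y₁.n + Y₂.n⟩ :=
  ⟨Quotient.map₂ (fun f g => Word.tensor f g rfl rfl)
    (fun _ _ h _ _ h' => Word.Rel.tensor_congr rfl rfl h h') (Hom.q f) (Hom.q g)⟩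

/-- The identity diagram between equal objects. -/
def castIso {X Y : Diag} (h : X.n = Y.n) : X ≅ Y where
  hom := mk' (.ident h)
  inv := mk' (.ident h.symm)
  hom_inv_id := by
    obtain ⟨m⟩ := X; obtain ⟨n⟩ := Y; obtain rfl : m = n := h; exact sound (.id_comp _)
  inv_hom_id := by
    obtain ⟨m⟩ := X; obtain ⟨n⟩ := Y; obtain rfl : m = n := h; exact sound (.id_comp _)

instance : MonoidalCategoryStruct Diag where
  tensorObj X Y := ⟨X.n + Y.n⟩
  tensorHom := tensorHom'
  whiskerLeft X _ _ f := tensorHom' (𝟙 X) f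
  whiskerRight f Y := tensorHom' f (𝟙 Y)
  tensorUnit := ⟨0⟩
  associator _ _ _ := castIso (Nat.add_assoc _ _ _)
  leftUnitor _ := castIso (Nat.zero_add _)
  rightUnitor _ := castIso (Nat.add_zero _)

end Diag

namespace Word.Rel

theorem tensor_comp_ident {a b c d m n n' : ℕ} (f : Word a b) (g : Word c d)
    (hm : m = a + c) (hn : n = b + d) (h : n = n') :
    Rel (comp (tensor f g hm hn) (ident h)) (tensor f g hm (h.symm.trans hn)) := by
  subst h; exact .comp_id _

theorem ident_comp_tensor {a b c d m m' n : ℕ} (f : Word a b) (g : Word c d)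
    (hm : m = a + c) (hn : n = b + d) (h : m' = m) :
    Rel (comp (ident h) (tensor f g hm hn)) (tensor f g (h.trans hm) hn) := by
  subst h; exact .id_comp _

theorem tensor_ident {a b c d m n : ℕ} (h : a = b) (h' : c = d) (hm : m = a + c) (hn : n = b + d) :
    Rel (tensor (ident h) (ident h') hm hn) (ident (by omega)) := by
  subst h; subst h'; subst hm; subst hn; exact .tensor_id rfl

theorem ident_comp_ident {a b c : ℕ} (h : a = b) (h' : b = c) :
    Rel (comp (ident h) (ident h')) (ident (h.trans h')) := by
  subst h; exact .id_comp _

end Word.Rel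

namespace Diag
open Word.Rel

instance : MonoidalCategory Diag := MonoidalCategory.ofTensorHom
  (id_tensorHom_id := fun _ _ => sound (.tensor_id rfl))
  (id_tensorHom := fun _ _ _ _ => rfl)
  (tensorHom_id := fun _ _ => rfl)
  (tensorHom_comp_tensorHom := fun f₁ f₂ g₁ g₂ => by
    induction f₁ using ind with | _ f₁ =>
    induction f₂ using ind with | _ f₂ =>
    induction g₁ using ind with | _ g₁ =>
    induction g₂ using ind with | _ g₂ =>
    exact sound (Word.Rel.tensor_comp f₁ g₁ f₂ g₂ rfl rfl).symm)
  (associator_naturality := fun f₁ f₂ f₃ => by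
    induction f₁ using ind with | _ f₁ =>
    induction f₂ using ind with | _ f₂ =>
    induction f₃ using ind with | _ f₃ =>
    exact sound ((tensor_comp_ident _ _ _ _ _).trans
      ((Word.Rel.tensor_assoc _ _ _ _ _ (Nat.add_assoc _ _ _) rfl).trans
        (ident_comp_tensor _ _ _ _ _).symm)))
  (leftUnitor_naturality := fun {X Y} f => by
    induction f using ind with | _ f =>
    exact sound ((tensor_comp_ident _ _ _ _ _).trans ((ident_comp_tensor _ _ _ _ _).symm.trans
      (.comp_congr (.refl (.ident (Nat.zero_add X.n)))
        (.unit_tensor f (Nat.zero_add _).symm (Nat.zero_add _).symm)))))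
  (rightUnitor_naturality := fun {X Y} f => by
    induction f using ind with | _ f =>
    exact sound ((tensor_comp_ident _ _ _ _ _).trans ((ident_comp_tensor _ _ _ _ _).symm.trans
      (.comp_congr (.refl (.ident (Nat.add_zero X.n)))
        (.tensor_unit f (Nat.add_zero _).symm (Nat.add_zero _).symm)))))
  (pentagon := fun _ _ _ _ => sound
    ((Word.Rel.comp_congr (tensor_ident _ _ _ _)
      ((Word.Rel.comp_congr (.refl _) (tensor_ident _ _ _ _)).trans (ident_comp_ident _ _))).trans
      ((ident_comp_ident _ _).trans (ident_comp_ident _ _).symm)))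
  (triangle := fun _ _ => sound
    ((Word.Rel.comp_congr (.refl _) (tensor_ident _ _ _ _)).trans ((ident_comp_ident _ _).trans
      (tensor_ident _ _ _ _).symm)))

/-- The generating object. -/
def pt : Diag := ⟨1⟩

/-- The cup, a diagram `0 ⟶ 2`. -/
def cup : 𝟙_ Diag ⟶ pt ⊗ pt := mk' .cup

/-- The cap, a diagram `2 ⟶ 0`. -/
def cap : pt ⊗ pt ⟶ 𝟙_ Diag := mk' .cap

end Diag
namespace FreeMonoidal

universe v u
variable {R : Type*} [CommRing R] {C : Type u} [Category.{v} C]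

/-- The object of `C` underlying an object of its linearization. -/
def un (X : Free R C) : C := X

/-- A morphism of `C`, as a basis vector of the corresponding space of morphisms. -/
def sg {X Y : Free R C} (g : un X ⟶ un Y) : X ⟶ Y := (Free.embedding R C).map g

theorem sg_id (X : Free R C) : sg (𝟙 (un X)) = 𝟙 X := rfl

theorem sg_comp {X Y Z : Free R C} (f : un X ⟶ un Y) (g : un Y ⟶ un Z) :
    sg (f ≫ g) = sg f ≫ sg g := (Free.embedding R C).map_comp f g

theorem hom_ind {X Y : Free R C} {P : (X ⟶ Y) → Prop} (f : X ⟶ Y) (zero : P 0)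
    (add : ∀ f g, P f → P g → P (f + g))
    (smul : ∀ (r : R) (g : un X ⟶ un Y), P (r • sg g)) : P f := by
  refine Finsupp.induction_linear (motive := P) f zero add fun g r => ?_
  have e : r • sg g = (Finsupp.single g r : (un X ⟶ un Y) →₀ R) := by
    exact (Finsupp.smul_single r g 1).trans (congrArg (Finsupp.single g) (mul_one r))
  exact e ▸ smul r g

/-- Isomorphisms of `C`, in its linearization. -/
def sgIso {X Y : Free R C} (e : un X ≅ un Y) : X ≅ Y where
  hom := sg e.hom
  inv := sg e.inv
  hom_inv_id := by rw [← sg_comp, e.hom_inv_id, sg_id]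
  inv_hom_id := by rw [← sg_comp, e.inv_hom_id, sg_id]

variable [MonoidalCategory C]

instance : MonoidalCategoryStruct (Free R C) where
  tensorObj X Y := Free.of R (un X ⊗ un Y)
  whiskerLeft X Y Z f := Finsupp.mapDomain (fun g : un Y ⟶ un Z => un X ◁ g) f
  whiskerRight {Y Z} f X := Finsupp.mapDomain (fun g : un Y ⟶ un Z => g ▷ un X) f
  tensorUnit := Free.of R (𝟙_ C)
  associator X Y Z := sgIso (X := Free.of R ((un X ⊗ un Y) ⊗ un Z))
    (Y := Free.of R (un X ⊗ un Y ⊗ un Z)) (α_ (un X) (un Y) (un Z))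
  leftUnitor X := sgIso (X := Free.of R (𝟙_ C ⊗ un X)) (λ_ (un X))
  rightUnitor X := sgIso (X := Free.of R (un X ⊗ 𝟙_ C)) (ρ_ (un X))

/-- Whiskering a morphism of `C`, between objects of its linearization. -/
def tL (X : Free R C) {Y Z : Free R C} (f : un Y ⟶ un Z) : un (X ⊗ Y) ⟶ un (X ⊗ Z) := un X ◁ f

/-- Whiskering a morphism of `C`, between objects of its linearization. -/
def tR {Y Z : Free R C} (f : un Y ⟶ un Z) (X : Free R C) : un (Y ⊗ X) ⟶ un (Z ⊗ X) := f ▷ un X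

/-- The associator of `C`, between objects of its linearization. -/
def aU (X Y Z : Free R C) : un ((X ⊗ Y) ⊗ Z) ⟶ un (X ⊗ Y ⊗ Z) := (α_ (un X) (un Y) (un Z)).hom

/-- The left unitor of `C`, between objects of its linearization. -/
def lU (X : Free R C) : un (𝟙_ (Free R C) ⊗ X) ⟶ un X := (λ_ (un X)).hom

/-- The right unitor of `C`, between objects of its linearization. -/
def rU (X : Free R C) : un (X ⊗ 𝟙_ (Free R C)) ⟶ un X := (ρ_ (un X)).hom

theorem assoc_sg (X Y Z : Free R C) : (α_ X Y Z).hom = sg (aU X Y Z) := rfl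
theorem lunit_sg (X : Free R C) : (λ_ X).hom = sg (lU X) := rfl
theorem runit_sg (X : Free R C) : (ρ_ X).hom = sg (rU X) := rfl

section
variable {X Y Z : Free R C}

theorem wl_zero : X ◁ (0 : Y ⟶ Z) = 0 :=
  Finsupp.mapDomain_zero (f := fun g : un Y ⟶ un Z => un X ◁ g)
theorem wr_zero : (0 : Y ⟶ Z) ▷ X = 0 :=
  Finsupp.mapDomain_zero (f := fun g : un Y ⟶ un Z => g ▷ un X)
theorem wl_add (f g : Y ⟶ Z) : X ◁ (f + g) = X ◁ f + X ◁ g := Finsupp.mapDomain_add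
theorem wr_add (f g : Y ⟶ Z) : (f + g) ▷ X = f ▷ X + g ▷ X := Finsupp.mapDomain_add
theorem wl_smul (r : R) (f : Y ⟶ Z) : X ◁ (r • f) = r • X ◁ f := Finsupp.mapDomain_smul _ _
theorem wr_smul (r : R) (f : Y ⟶ Z) : (r • f) ▷ X = r • f ▷ X := Finsupp.mapDomain_smul _ _
theorem wl_sg (f : un Y ⟶ un Z) : X ◁ sg f = sg (tL X f) := Finsupp.mapDomain_single
theorem wr_sg (f : un Y ⟶ un Z) : sg f ▷ X = sg (tR f X) := Finsupp.mapDomain_single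
end

theorem wl_comp (X : Free R C) {Y Z W : Free R C} (f : Y ⟶ Z) (g : Z ⟶ W) :
    X ◁ (f ≫ g) = X ◁ f ≫ X ◁ g := by
  induction f using hom_ind with
  | zero => simp [wl_zero]
  | add f f' h h' => simp [wl_add, h, h']
  | smul r f =>
    induction g using hom_ind with
    | zero => simp only [wl_zero, Limits.comp_zero, Limits.zero_comp]
    | add g g' h h' =>
      simp only [wl_add, h, h', Preadditive.comp_add, Preadditive.add_comp]
    | smul s g =>
      have h : X ◁ (sg f ≫ sg g) = X ◁ sg f ≫ X ◁ sg g := by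
        simp only [wl_sg, ← sg_comp]
        exact congrArg sg (whiskerLeft_comp (un X) f g)
      simp only [wl_smul, Linear.comp_smul, Linear.smul_comp, h]

theorem wr_comp (X : Free R C) {Y Z W : Free R C} (f : Y ⟶ Z) (g : Z ⟶ W) :
    (f ≫ g) ▷ X = f ▷ X ≫ g ▷ X := by
  induction f using hom_ind with
  | zero => simp [wr_zero]
  | add f f' h h' => simp [wr_add, h, h']
  | smul r f =>
    induction g using hom_ind with
    | zero => simp only [wr_zero, Limits.comp_zero, Limits.zero_comp]
    | add g g' h h' =>
      simp only [wr_add, h, h', Preadditive.comp_add, Preadditive.add_comp]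
    | smul s g =>
      have h : (sg f ≫ sg g) ▷ X = sg f ▷ X ≫ sg g ▷ X := by
        simp only [wr_sg, ← sg_comp]
        exact congrArg sg (comp_whiskerRight f g (un X))
      simp only [wr_smul, Linear.comp_smul, Linear.smul_comp, h]

theorem exch {X Y Z W : Free R C} (f : W ⟶ X) (g : Y ⟶ Z) :
    W ◁ g ≫ f ▷ Z = f ▷ Y ≫ X ◁ g := by
  induction f using hom_ind with
  | zero => simp [wl_zero, wr_zero]
  | add f f' h h' => simp [wl_add, wr_add, h, h']
  | smul r f =>
    induction g using hom_ind with
    | zero => simp only [wl_zero, wr_zero, Limits.comp_zero, Limits.zero_comp]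
    | add g g' h h' =>
      simp only [wl_add, wr_add, h, h', Preadditive.comp_add, Preadditive.add_comp]
    | smul s g =>
      have h : W ◁ sg g ≫ sg f ▷ Z = sg f ▷ Y ≫ X ◁ sg g := by
        simp only [wl_sg, wr_sg, ← sg_comp]
        exact congrArg sg (whisker_exchange f g)
      simp only [wl_smul, wr_smul, Linear.comp_smul, Linear.smul_comp, h]
      rw [smul_comm]

theorem assocL {X Y Z Z' : Free R C} (f : Z ⟶ Z') :
    (X ⊗ Y) ◁ f ≫ (α_ X Y Z').hom = (α_ X Y Z).hom ≫ X ◁ Y ◁ f := by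
  induction f using hom_ind with
  | zero => simp [wl_zero]
  | add f f' h h' => simp [wl_add, h, h']
  | smul r f =>
    have h : (X ⊗ Y) ◁ sg f ≫ (α_ X Y Z').hom = (α_ X Y Z).hom ≫ X ◁ Y ◁ sg f := by
      simp only [wl_sg, assoc_sg, lunit_sg, runit_sg, ← sg_comp]
      exact congrArg sg (by simp : (un X ⊗ un Y) ◁ f ≫ (α_ (un X) (un Y) (un Z')).hom =
        (α_ (un X) (un Y) (un Z)).hom ≫ un X ◁ un Y ◁ f)
    simp only [wl_smul, Linear.comp_smul, Linear.smul_comp, h]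

theorem assocM {X Y Y' Z : Free R C} (f : Y ⟶ Y') :
    (X ◁ f) ▷ Z ≫ (α_ X Y' Z).hom = (α_ X Y Z).hom ≫ X ◁ f ▷ Z := by
  induction f using hom_ind with
  | zero => simp [wl_zero, wr_zero]
  | add f f' h h' => simp [wl_add, wr_add, h, h']
  | smul r f =>
    have h : (X ◁ sg f) ▷ Z ≫ (α_ X Y' Z).hom = (α_ X Y Z).hom ≫ X ◁ sg f ▷ Z := by
      simp only [wl_sg, wr_sg, assoc_sg, lunit_sg, runit_sg, ← sg_comp]
      exact congrArg sg (by simp : (un X ◁ f) ▷ un Z ≫ (α_ (un X) (un Y') (un Z)).hom =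
        (α_ (un X) (un Y) (un Z)).hom ≫ un X ◁ f ▷ un Z)
    simp only [wl_smul, wr_smul, Linear.comp_smul, Linear.smul_comp, h]

theorem assocR {X X' Y Z : Free R C} (f : X ⟶ X') :
    (f ▷ Y) ▷ Z ≫ (α_ X' Y Z).hom = (α_ X Y Z).hom ≫ f ▷ (Y ⊗ Z) := by
  induction f using hom_ind with
  | zero => simp [wr_zero]
  | add f f' h h' => simp [wr_add, h, h']
  | smul r f =>
    have h : (sg f ▷ Y) ▷ Z ≫ (α_ X' Y Z).hom = (α_ X Y Z).hom ≫ sg f ▷ (Y ⊗ Z) := by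
      simp only [wr_sg, assoc_sg, lunit_sg, runit_sg, ← sg_comp]
      exact congrArg sg (by simp : (f ▷ un Y) ▷ un Z ≫ (α_ (un X') (un Y) (un Z)).hom =
        (α_ (un X) (un Y) (un Z)).hom ≫ f ▷ (un Y ⊗ un Z))
    simp only [wr_smul, Linear.comp_smul, Linear.smul_comp, h]

theorem lunit {X Y : Free R C} (f : X ⟶ Y) :
    𝟙_ (Free R C) ◁ f ≫ (λ_ Y).hom = (λ_ X).hom ≫ f := by
  induction f using hom_ind with
  | zero => simp [wl_zero]
  | add f f' h h' => simp [wl_add, h, h']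
  | smul r f =>
    have h : 𝟙_ (Free R C) ◁ sg f ≫ (λ_ Y).hom = (λ_ X).hom ≫ sg f := by
      simp only [wl_sg, assoc_sg, lunit_sg, runit_sg, ← sg_comp]
      exact congrArg sg (leftUnitor_naturality f)
    simp only [wl_smul, Linear.comp_smul, Linear.smul_comp, h]

theorem runit {X Y : Free R C} (f : X ⟶ Y) :
    f ▷ 𝟙_ (Free R C) ≫ (ρ_ Y).hom = (ρ_ X).hom ≫ f := by
  induction f using hom_ind with
  | zero => simp [wr_zero]
  | add f f' h h' => simp [wr_add, h, h']
  | smul r f =>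
    have h : sg f ▷ 𝟙_ (Free R C) ≫ (ρ_ Y).hom = (ρ_ X).hom ≫ sg f := by
      simp only [wr_sg, assoc_sg, lunit_sg, runit_sg, ← sg_comp]
      exact congrArg sg (rightUnitor_naturality f)
    simp only [wr_smul, Linear.comp_smul, Linear.smul_comp, h]

theorem pent (W X Y Z : Free R C) :
    (α_ W X Y).hom ▷ Z ≫ (α_ W (X ⊗ Y) Z).hom ≫ W ◁ (α_ X Y Z).hom =
      (α_ (W ⊗ X) Y Z).hom ≫ (α_ W X (Y ⊗ Z)).hom := by
  simp only [wl_sg, wr_sg, assoc_sg, ← sg_comp]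
  exact congrArg sg (MonoidalCategory.pentagon (un W) (un X) (un Y) (un Z))

theorem tri (X Y : Free R C) :
    (α_ X (𝟙_ (Free R C)) Y).hom ≫ X ◁ (λ_ Y).hom = (ρ_ X).hom ▷ Y := by
  simp only [wl_sg, wr_sg, assoc_sg, lunit_sg, runit_sg, ← sg_comp]
  exact congrArg sg (MonoidalCategory.triangle (un X) (un Y))

theorem wl_id (X Y : Free R C) : X ◁ 𝟙 Y = 𝟙 (X ⊗ Y) := by
  rw [← sg_id, ← sg_id, wl_sg]
  exact congrArg sg (whiskerLeft_id (un X) (un Y))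

theorem wr_id (X Y : Free R C) : 𝟙 X ▷ Y = 𝟙 (X ⊗ Y) := by
  rw [← sg_id, ← sg_id, wr_sg]
  exact congrArg sg (id_whiskerRight (un X) (un Y))

end FreeMonoidal

/-- A monoidal category from whiskerings. -/
abbrev monoidalOfWhisker {C : Type*} [Category C] [MonoidalCategoryStruct C]
    (tensorHom_def : ∀ {X₁ Y₁ X₂ Y₂ : C} (f : X₁ ⟶ Y₁) (g : X₂ ⟶ Y₂),
      f ⊗ₘ g = f ▷ X₂ ≫ Y₁ ◁ g)
    (wl_id : ∀ X Y : C, X ◁ 𝟙 Y = 𝟙 (X ⊗ Y))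
    (wr_id : ∀ X Y : C, 𝟙 X ▷ Y = 𝟙 (X ⊗ Y))
    (wl_comp : ∀ (X : C) {Y Z W : C} (f : Y ⟶ Z) (g : Z ⟶ W), X ◁ (f ≫ g) = X ◁ f ≫ X ◁ g)
    (wr_comp : ∀ (X : C) {Y Z W : C} (f : Y ⟶ Z) (g : Z ⟶ W), (f ≫ g) ▷ X = f ▷ X ≫ g ▷ X)
    (exch : ∀ {X Y Z W : C} (f : W ⟶ X) (g : Y ⟶ Z), W ◁ g ≫ f ▷ Z = f ▷ Y ≫ X ◁ g)
    (assocL : ∀ {X Y Z Z' : C} (f : Z ⟶ Z'),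
      (X ⊗ Y) ◁ f ≫ (α_ X Y Z').hom = (α_ X Y Z).hom ≫ X ◁ Y ◁ f)
    (assocM : ∀ {X Y Y' Z : C} (f : Y ⟶ Y'),
      (X ◁ f) ▷ Z ≫ (α_ X Y' Z).hom = (α_ X Y Z).hom ≫ X ◁ f ▷ Z)
    (assocR : ∀ {X X' Y Z : C} (f : X ⟶ X'),
      (f ▷ Y) ▷ Z ≫ (α_ X' Y Z).hom = (α_ X Y Z).hom ≫ f ▷ (Y ⊗ Z))
    (lunit : ∀ {X Y : C} (f : X ⟶ Y), 𝟙_ C ◁ f ≫ (λ_ Y).hom = (λ_ X).hom ≫ f)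
    (runit : ∀ {X Y : C} (f : X ⟶ Y), f ▷ 𝟙_ C ≫ (ρ_ Y).hom = (ρ_ X).hom ≫ f)
    (pent : ∀ W X Y Z : C, (α_ W X Y).hom ▷ Z ≫ (α_ W (X ⊗ Y) Z).hom ≫ W ◁ (α_ X Y Z).hom =
      (α_ (W ⊗ X) Y Z).hom ≫ (α_ W X (Y ⊗ Z)).hom)
    (tri : ∀ X Y : C, (α_ X (𝟙_ C) Y).hom ≫ X ◁ (λ_ Y).hom = (ρ_ X).hom ▷ Y) :
    MonoidalCategory C where
  tensorHom_def := tensorHom_def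
  id_tensorHom_id X Y := by rw [tensorHom_def, wl_id, wr_id, Category.comp_id]
  tensorHom_comp_tensorHom f₁ f₂ g₁ g₂ := by
    simp only [tensorHom_def, wl_comp, wr_comp, Category.assoc]
    rw [← Category.assoc (_ ◁ f₂), exch, Category.assoc]
  whiskerLeft_id := wl_id
  id_whiskerRight := wr_id
  associator_naturality f₁ f₂ f₃ := by
    simp only [tensorHom_def, wl_comp, wr_comp, Category.assoc]
    rw [assocL, ← Category.assoc (_ ▷ _) (α_ _ _ _).hom, assocM, Category.assoc,
      ← Category.assoc (_ ▷ _) (α_ _ _ _).hom, assocR, Category.assoc]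
  leftUnitor_naturality := lunit
  rightUnitor_naturality := runit
  pentagon := pent
  triangle := tri

namespace FreeMonoidal
universe v u
variable {R : Type*} [CommRing R] {C : Type u} [Category.{v} C] [MonoidalCategory C]

instance : MonoidalCategory (Free R C) :=
  monoidalOfWhisker (fun _ _ => rfl) wl_id wr_id wl_comp wr_comp exch assocL assocM assocR
    lunit runit pent tri

instance : MonoidalPreadditive (Free R C) where
  whiskerLeft_zero := wl_zero
  zero_whiskerRight := wr_zero
  whiskerLeft_add := wl_add
  add_whiskerRight := wr_add

instance : MonoidalLinear R (Free R C) where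
  whiskerLeft_smul _ _ _ r f := wl_smul r f
  smul_whiskerRight r _ _ f _ := wr_smul r f

end FreeMonoidal
section TensorIdeal

variable {C : Type*} [Category C] [Preadditive C] [MonoidalCategory C]

/-- The two-sided tensor ideal of morphisms generated by a family `S` of morphisms. -/
inductive TensorIdeal (S : ∀ ⦃X Y : C⦄, (X ⟶ Y) → Prop) : ∀ {X Y : C}, (X ⟶ Y) → Prop
  | of {X Y : C} (f : X ⟶ Y) : S f → TensorIdeal S f
  | zero (X Y : C) : TensorIdeal S (0 : X ⟶ Y)
  | add {X Y : C} (f g : X ⟶ Y) : TensorIdeal S f → TensorIdeal S g → TensorIdeal S (f + g)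
  | precomp {X Y Z : C} (f : X ⟶ Y) (g : Y ⟶ Z) : TensorIdeal S g → TensorIdeal S (f ≫ g)
  | postcomp {X Y Z : C} (f : X ⟶ Y) (g : Y ⟶ Z) : TensorIdeal S f → TensorIdeal S (f ≫ g)
  | whiskerLeft (X : C) {Y Z : C} (f : Y ⟶ Z) : TensorIdeal S f → TensorIdeal S (X ◁ f)
  | whiskerRight {Y Z : C} (f : Y ⟶ Z) (X : C) : TensorIdeal S f → TensorIdeal S (f ▷ X)

/-- Congruence of morphisms modulo a tensor ideal. -/
def idealRel (S : ∀ ⦃X Y : C⦄, (X ⟶ Y) → Prop) : HomRel C := fun _ _ f g => TensorIdeal S (f - g)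

variable (S : ∀ ⦃X Y : C⦄, (X ⟶ Y) → Prop)

theorem TensorIdeal.neg {X Y : C} {f : X ⟶ Y} (h : TensorIdeal S f) : TensorIdeal S (-f) := by
  simpa using TensorIdeal.precomp (-𝟙 X) f h

instance : Congruence (idealRel S) where
  comp_left f g g' h := by
    change TensorIdeal S _
    rw [← Preadditive.comp_sub]; exact .precomp _ _ h
  comp_right g h := by
    change TensorIdeal S _
    rw [← Preadditive.sub_comp]; exact .postcomp _ _ h
  equivalence :=
    { refl := fun f => by change TensorIdeal S _; rw [sub_self]; exact .zero _ _
      symm := fun h => by change TensorIdeal S _; rw [← neg_sub]; exact .neg S h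
      trans := fun h h' => by
        change TensorIdeal S _
        rw [← sub_add_sub_cancel]; exact .add _ _ h h' }

/-- The quotient of a preadditive monoidal category by the tensor ideal generated by `S`. -/
abbrev IdealQuotient := CategoryTheory.Quotient (idealRel S)

theorem idealRel_add ⦃X Y : C⦄ (f₁ f₂ g₁ g₂ : X ⟶ Y) (h : idealRel S f₁ f₂)
    (h' : idealRel S g₁ g₂) : idealRel S (f₁ + g₁) (f₂ + g₂) := by
  change TensorIdeal S _
  rw [add_sub_add_comm]; exact .add _ _ h h'

theorem idealRel_smul {R : Type*} [CommRing R] [Linear R C] (a : R) ⦃X Y : C⦄ (f₁ f₂ : X ⟶ Y)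
    (h : idealRel S f₁ f₂) : idealRel S (a • f₁) (a • f₂) := by
  change TensorIdeal S _
  have := TensorIdeal.precomp (a • 𝟙 X) _ h
  rwa [Linear.smul_comp, Category.id_comp, smul_sub] at this

instance : Preadditive (IdealQuotient S) :=
  CategoryTheory.Quotient.preadditive (idealRel S) (idealRel_add S)

/-- The projection to the quotient by a tensor ideal. -/
abbrev toIdealQuotient : C ⥤ IdealQuotient S := CategoryTheory.Quotient.functor (idealRel S)

instance : (toIdealQuotient S).Additive :=
  CategoryTheory.Quotient.functor_additive (idealRel S) (idealRel_add S)

instance {R : Type*} [CommRing R] [Linear R C] : Linear R (IdealQuotient S) :=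
  CategoryTheory.Quotient.linear R (idealRel S) (idealRel_smul S)

instance [HasFiniteBiproducts C] : HasFiniteBiproducts (IdealQuotient S) where
  out n :=
    { has_biproduct := fun F =>
        .mk ⟨(toIdealQuotient S).mapBicone (biproduct.bicone fun i => (F i).as),
          isBilimitOfPreserves (toIdealQuotient S) (biproduct.isBilimit fun i => (F i).as)⟩ }

variable [MonoidalPreadditive C]

instance : MonoidalCategoryStruct (IdealQuotient S) where
  tensorObj X Y := ⟨X.as ⊗ Y.as⟩
  whiskerLeft X Y Z f := (CategoryTheory.Quotient.lift (idealRel S)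
    (tensorLeft X.as ⋙ toIdealQuotient S) (fun Y Z f g h => CategoryTheory.Quotient.sound _ (by
      change TensorIdeal S (X.as ◁ f - X.as ◁ g)
      have e : X.as ◁ f - X.as ◁ g = X.as ◁ (f - g) := ((tensorLeft X.as).map_sub (f := f) (g := g)).symm
      rw [e]; exact .whiskerLeft _ _ h))).map f
  whiskerRight {Y Z} f X := (CategoryTheory.Quotient.lift (idealRel S)
    (tensorRight X.as ⋙ toIdealQuotient S) (fun Y Z f g h => CategoryTheory.Quotient.sound _ (by
      change TensorIdeal S (f ▷ X.as - g ▷ X.as)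
      have e : f ▷ X.as - g ▷ X.as = (f - g) ▷ X.as := ((tensorRight X.as).map_sub (f := f) (g := g)).symm
      rw [e]; exact .whiskerRight _ _ h))).map f
  tensorUnit := ⟨𝟙_ C⟩
  associator X Y Z := (toIdealQuotient S).mapIso (α_ X.as Y.as Z.as)
  leftUnitor X := (toIdealQuotient S).mapIso (λ_ X.as)
  rightUnitor X := (toIdealQuotient S).mapIso (ρ_ X.as)

instance : MonoidalCategory (IdealQuotient S) :=
  monoidalOfWhisker (fun _ _ => rfl)
    (fun X Y => congrArg (toIdealQuotient S).map (whiskerLeft_id X.as Y.as))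
    (fun X Y => congrArg (toIdealQuotient S).map (id_whiskerRight X.as Y.as))
    (fun X _ _ _ => by
      rintro ⟨f⟩ ⟨g⟩; exact congrArg (toIdealQuotient S).map (whiskerLeft_comp X.as f g))
    (fun X _ _ _ => by
      rintro ⟨f⟩ ⟨g⟩; exact congrArg (toIdealQuotient S).map (comp_whiskerRight f g X.as))
    (by rintro _ _ _ _ ⟨f⟩ ⟨g⟩; exact congrArg (toIdealQuotient S).map (whisker_exchange f g))
    (by
      rintro X Y Z Z' ⟨f⟩
      exact congrArg (toIdealQuotient S).map (by simp : (X.as ⊗ Y.as) ◁ f ≫ (α_ _ _ Z'.as).hom =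
        (α_ X.as Y.as Z.as).hom ≫ X.as ◁ Y.as ◁ f))
    (by
      rintro X Y Y' Z ⟨f⟩
      exact congrArg (toIdealQuotient S).map (by simp : (X.as ◁ f) ▷ Z.as ≫ (α_ _ Y'.as _).hom =
        (α_ X.as Y.as Z.as).hom ≫ X.as ◁ f ▷ Z.as))
    (by
      rintro X X' Y Z ⟨f⟩
      exact congrArg (toIdealQuotient S).map (by simp : (f ▷ Y.as) ▷ Z.as ≫ (α_ X'.as _ _).hom =
        (α_ X.as Y.as Z.as).hom ≫ f ▷ (Y.as ⊗ Z.as)))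
    (by rintro X Y ⟨f⟩; exact congrArg (toIdealQuotient S).map (leftUnitor_naturality f))
    (by rintro X Y ⟨f⟩; exact congrArg (toIdealQuotient S).map (rightUnitor_naturality f))
    (fun W X Y Z => congrArg (toIdealQuotient S).map (pentagon W.as X.as Y.as Z.as))
    (fun X Y => congrArg (toIdealQuotient S).map (triangle X.as Y.as))

instance : MonoidalPreadditive (IdealQuotient S) where
  whiskerLeft_zero {X Y Z} := congrArg (toIdealQuotient S).map
    (MonoidalPreadditive.whiskerLeft_zero : X.as ◁ (0 : Y.as ⟶ Z.as) = 0)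
  zero_whiskerRight {X Y Z} := congrArg (toIdealQuotient S).map
    (MonoidalPreadditive.zero_whiskerRight : (0 : Y.as ⟶ Z.as) ▷ X.as = 0)
  whiskerLeft_add := by
    rintro X Y Z ⟨f⟩ ⟨g⟩
    exact congrArg (toIdealQuotient S).map (MonoidalPreadditive.whiskerLeft_add (X := X.as) f g)
  add_whiskerRight := by
    rintro X Y Z ⟨f⟩ ⟨g⟩
    exact congrArg (toIdealQuotient S).map (MonoidalPreadditive.add_whiskerRight (X := X.as) f g)

instance {R : Type*} [CommRing R] [Linear R C] [MonoidalLinear R C] :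
    MonoidalLinear R (IdealQuotient S) where
  whiskerLeft_smul := by
    rintro X Y Z r ⟨f⟩
    exact congrArg (toIdealQuotient S).map (MonoidalLinear.whiskerLeft_smul X.as r f)
  smul_whiskerRight := by
    rintro r Y Z ⟨f⟩ X
    exact congrArg (toIdealQuotient S).map (MonoidalLinear.smul_whiskerRight r f X.as)

end TensorIdeal

section Karoubi
open CategoryTheory.Idempotents

variable {C : Type*} [Category C]

/-- An isomorphism compatible with idempotents induces an isomorphism of their images. -/
def karoubiIso {P Q : Karoubi C} (e : P.X ≅ Q.X) (h : P.p ≫ e.hom = e.hom ≫ Q.p) : P ≅ Q where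
  hom := ⟨P.p ≫ e.hom, by rw [Category.assoc, ← h, P.idem_assoc, P.idem_assoc]⟩
  inv := ⟨Q.p ≫ e.inv, by
    have h' : Q.p ≫ e.inv = e.inv ≫ P.p := by
      rw [Iso.comp_inv_eq, Category.assoc, h, Iso.inv_hom_id_assoc]
    rw [Category.assoc, ← h', Q.idem_assoc, Q.idem_assoc]⟩
  hom_inv_id := by
    apply Karoubi.hom_ext
    simp only [Karoubi.comp_f, Karoubi.id_f]
    rw [h, Category.assoc, Q.idem_assoc, ← Category.assoc, ← h, Category.assoc, Iso.hom_inv_id,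
      Category.comp_id]
  inv_hom_id := by
    apply Karoubi.hom_ext
    simp only [Karoubi.comp_f, Karoubi.id_f]
    rw [h, Category.assoc, Iso.inv_hom_id_assoc, Q.idem]

variable [MonoidalCategory C]

instance : MonoidalCategoryStruct (Karoubi C) where
  tensorObj P Q := ⟨P.X ⊗ Q.X, P.p ⊗ₘ Q.p, by simp⟩
  tensorHom f g := ⟨f.f ⊗ₘ g.f, by simp⟩
  whiskerLeft P _ _ f := ⟨P.p ⊗ₘ f.f, by simp⟩
  whiskerRight f P := ⟨f.f ⊗ₘ P.p, by simp⟩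
  tensorUnit := ⟨𝟙_ C, 𝟙 _, by simp⟩
  associator P Q T := karoubiIso (α_ P.X Q.X T.X) (associator_naturality P.p Q.p T.p)
  leftUnitor P := karoubiIso (λ_ P.X) (by simp)
  rightUnitor P := karoubiIso (ρ_ P.X) (by simp)

namespace KaroubiMonoidal

theorem tensorHom_f {P Q P' Q' : Karoubi C} (f : P ⟶ P') (g : Q ⟶ Q') :
    (f ⊗ₘ g).f = f.f ⊗ₘ g.f := rfl

theorem whiskerLeft_f (P : Karoubi C) {Q Q' : Karoubi C} (g : Q ⟶ Q') :
    (P ◁ g).f = P.p ⊗ₘ g.f := rfl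

theorem whiskerRight_f {P P' : Karoubi C} (f : P ⟶ P') (Q : Karoubi C) :
    (f ▷ Q).f = f.f ⊗ₘ Q.p := rfl

theorem tensorObj_p (P Q : Karoubi C) : (P ⊗ Q).p = P.p ⊗ₘ Q.p := rfl

theorem associator_hom_f (P Q T : Karoubi C) :
    (α_ P Q T).hom.f = ((P.p ⊗ₘ Q.p) ⊗ₘ T.p) ≫ (α_ P.X Q.X T.X).hom := rfl

theorem leftUnitor_hom_f (P : Karoubi C) :
    (λ_ P).hom.f = (𝟙 (𝟙_ C) ⊗ₘ P.p) ≫ (λ_ P.X).hom := rfl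

theorem rightUnitor_hom_f (P : Karoubi C) :
    (ρ_ P).hom.f = (P.p ⊗ₘ 𝟙 (𝟙_ C)) ≫ (ρ_ P.X).hom := rfl

end KaroubiMonoidal

open KaroubiMonoidal

instance : MonoidalCategory (Karoubi C) := MonoidalCategory.ofTensorHom
  (id_tensorHom_id := fun _ _ => rfl)
  (id_tensorHom := fun _ _ _ _ => rfl)
  (tensorHom_id := fun _ _ => rfl)
  (tensorHom_comp_tensorHom := fun _ _ _ _ => Karoubi.hom_ext _ _ (tensorHom_comp_tensorHom _ _ _ _))
  (associator_naturality := fun f₁ f₂ f₃ => by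
    apply Karoubi.hom_ext
    simp only [Karoubi.comp_f, tensorHom_f, associator_hom_f, Category.assoc,
      ← associator_naturality]
    simp only [tensorHom_comp_tensorHom_assoc, tensorHom_comp_tensorHom, Karoubi.comp_p,
      Karoubi.p_comp])
  (leftUnitor_naturality := fun f => by
    apply Karoubi.hom_ext
    rw [Karoubi.comp_f, Karoubi.comp_f, tensorHom_f, leftUnitor_hom_f, leftUnitor_hom_f]
    change (𝟙 (𝟙_ C) ⊗ₘ f.f) ≫ _ = _
    simp)
  (rightUnitor_naturality := fun f => by
    apply Karoubi.hom_ext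
    rw [Karoubi.comp_f, Karoubi.comp_f, tensorHom_f, rightUnitor_hom_f, rightUnitor_hom_f]
    change (f.f ⊗ₘ 𝟙 (𝟙_ C)) ≫ _ = _
    simp)
  (pentagon := fun W X Y Z => by
    apply Karoubi.hom_ext
    simp only [Karoubi.comp_f, tensorHom_f, associator_hom_f, tensorObj_p, Karoubi.id_f]
    have h1 : (((W.p ⊗ₘ X.p) ⊗ₘ Y.p) ≫ (α_ W.X X.X Y.X).hom) ⊗ₘ Z.p =
        (((W.p ⊗ₘ X.p) ⊗ₘ Y.p) ⊗ₘ Z.p) ≫ (α_ W.X X.X Y.X).hom ▷ Z.X := by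
      rw [← tensorHom_id, tensorHom_comp_tensorHom, Category.comp_id]
    have h2 : W.p ⊗ₘ (((X.p ⊗ₘ Y.p) ⊗ₘ Z.p) ≫ (α_ X.X Y.X Z.X).hom) =
        (W.p ⊗ₘ ((X.p ⊗ₘ Y.p) ⊗ₘ Z.p)) ≫ W.X ◁ (α_ X.X Y.X Z.X).hom := by
      rw [← id_tensorHom, tensorHom_comp_tensorHom, Category.comp_id]
    have h3 : (α_ W.X X.X Y.X).hom ▷ Z.X ≫ ((W.p ⊗ₘ (X.p ⊗ₘ Y.p)) ⊗ₘ Z.p) =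
        (((W.p ⊗ₘ X.p) ⊗ₘ Y.p) ⊗ₘ Z.p) ≫ (α_ W.X X.X Y.X).hom ▷ Z.X := by
      rw [← tensorHom_id, tensorHom_comp_tensorHom, tensorHom_comp_tensorHom,
        associator_naturality, Category.comp_id, Category.id_comp]
    rw [h1, h2]
    simp only [Category.assoc]
    rw [← associator_naturality_assoc, reassoc_of% h3, reassoc_of% h3, ← associator_naturality_assoc,
      MonoidalCategory.pentagon]
    simp only [tensorHom_comp_tensorHom_assoc, tensorHom_comp_tensorHom, Karoubi.idem]
    rfl)
  (triangle := fun X Y => by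
    apply Karoubi.hom_ext
    simp only [Karoubi.comp_f, tensorHom_f, associator_hom_f, Karoubi.id_f,
      leftUnitor_hom_f, rightUnitor_hom_f]
    change (((X.p ⊗ₘ 𝟙 (𝟙_ C)) ⊗ₘ Y.p) ≫ (α_ X.X (𝟙_ C) Y.X).hom) ≫ _ = _
    have h1 : ((X.p ⊗ₘ 𝟙 (𝟙_ C)) ≫ (ρ_ X.X).hom) ⊗ₘ Y.p =
        ((X.p ⊗ₘ 𝟙 (𝟙_ C)) ⊗ₘ Y.p) ≫ (ρ_ X.X).hom ▷ Y.X := by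
      rw [← tensorHom_id (ρ_ X.X).hom, tensorHom_comp_tensorHom, Category.comp_id]
    have h2 : X.p ⊗ₘ ((𝟙 (𝟙_ C) ⊗ₘ Y.p) ≫ (λ_ Y.X).hom) =
        (X.p ⊗ₘ (𝟙 (𝟙_ C) ⊗ₘ Y.p)) ≫ X.X ◁ (λ_ Y.X).hom := by
      rw [← id_tensorHom X.X (λ_ Y.X).hom, tensorHom_comp_tensorHom, Category.comp_id]
    rw [h1, h2, Category.assoc]
    rw [← associator_naturality_assoc, MonoidalCategory.triangle]
    simp only [tensorHom_comp_tensorHom_assoc, tensorHom_comp_tensorHom, Karoubi.idem,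
      Category.comp_id])

instance [Preadditive C] [MonoidalPreadditive C] : MonoidalPreadditive (Karoubi C) where
  whiskerLeft_zero := Karoubi.hom_ext _ _ (MonoidalPreadditive.tensor_zero _)
  zero_whiskerRight := Karoubi.hom_ext _ _ (MonoidalPreadditive.zero_tensor _)
  whiskerLeft_add _ _ := Karoubi.hom_ext _ _ (MonoidalPreadditive.tensor_add _ _ _)
  add_whiskerRight _ _ := Karoubi.hom_ext _ _ (MonoidalPreadditive.add_tensor _ _ _)

end Karoubi

section MatMonoidal

universe v u
variable {C : Type u} [Category.{v} C] [Preadditive C]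

namespace MatMonoidal

/-- The matrix `f` has entries `φ i` in the places `(i, e i)` and zeros elsewhere. -/
structure IsMonomial {M N : Mat_ C} (f : M ⟶ N) (e : M.ι → N.ι)
    (φ : ∀ i, M.X i ⟶ N.X (e i)) : Prop where
  diag : ∀ i, f i (e i) = φ i
  off : ∀ i j, e i ≠ j → f i j = 0

theorem IsMonomial.comp_apply {M N K : Mat_ C} {f : M ⟶ N} {e : M.ι → N.ι}
    {φ : ∀ i, M.X i ⟶ N.X (e i)} (hf : IsMonomial f e φ)
    (g : N ⟶ K) (i : M.ι) (k : K.ι) : (f ≫ g) i k = φ i ≫ g (e i) k := by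
  rw [Mat_.comp_apply, Finset.sum_eq_single (e i), hf.diag]
  · intro j _ hj
    rw [hf.off _ _ hj.symm, zero_comp]
  · simp

theorem IsMonomial.apply_comp {M N K : Mat_ C} {f : M ⟶ N} {e : M.ι → N.ι}
    {φ : ∀ i, M.X i ⟶ N.X (e i)} (hf : IsMonomial f e φ) (he : e.Injective)
    (g : K ⟶ M) (k : K.ι) (i : M.ι) : (g ≫ f) k (e i) = g k i ≫ φ i := by
  rw [Mat_.comp_apply, Finset.sum_eq_single i, hf.diag]
  · intro j _ hj
    rw [hf.off _ _ (fun h => hj (he h)), comp_zero]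
  · simp

theorem IsMonomial.id (M : Mat_ C) : IsMonomial (𝟙 M) (fun i => i) (fun i => 𝟙 (M.X i)) :=
  ⟨fun i => Mat_.id_apply_self M i, fun i j h => Mat_.id_apply_of_ne M i j h⟩

theorem IsMonomial.comp {M N K : Mat_ C} {f : M ⟶ N} {e : M.ι → N.ι}
    {φ : ∀ i, M.X i ⟶ N.X (e i)} (hf : IsMonomial f e φ) {g : N ⟶ K} {e' : N.ι → K.ι}
    {ψ : ∀ i, N.X i ⟶ K.X (e' i)} (hg : IsMonomial g e' ψ) :
    IsMonomial (f ≫ g) (fun i => e' (e i)) (fun i => φ i ≫ ψ (e i)) where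
  diag i := by rw [hf.comp_apply, hg.diag]
  off i k h := by rw [hf.comp_apply, hg.off _ _ h, comp_zero]

theorem IsMonomial.ext {M N : Mat_ C} {f g : M ⟶ N} {e : M.ι → N.ι}
    {φ ψ : ∀ i, M.X i ⟶ N.X (e i)} (hf : IsMonomial f e φ) (hg : IsMonomial g e ψ)
    (h : ∀ i, φ i = ψ i) : f = g := by
  apply Mat_.hom_ext
  intro i j
  by_cases hij : e i = j
  · subst hij; rw [hf.diag, hg.diag, h]
  · rw [hf.off _ _ hij, hg.off _ _ hij]

open scoped Classical in
/-- The matrix with entries `φ i` in the places `(i, e i)` and zeros elsewhere. -/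
def monoHom {M N : Mat_ C} (e : M.ι → N.ι) (φ : ∀ i, M.X i ⟶ N.X (e i)) : M ⟶ N :=
  fun i j => if h : e i = j then φ i ≫ eqToHom (congrArg N.X h) else 0

theorem monoHom_isMonomial {M N : Mat_ C} (e : M.ι → N.ι) (φ : ∀ i, M.X i ⟶ N.X (e i)) :
    IsMonomial (monoHom e φ) e φ :=
  ⟨fun i => by simp [monoHom], fun i j h => dif_neg h⟩

open scoped Classical in
/-- The matrix with entries `φ i` in the places `(e i, i)` and zeros elsewhere. -/
def monoInv {M N : Mat_ C} (e : M.ι → N.ι) (φ : ∀ i, N.X (e i) ⟶ M.X i) : N ⟶ M :=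
  fun j i => if h : j = e i then eqToHom (congrArg N.X h) ≫ φ i else 0

theorem monoInv_self {M N : Mat_ C} (e : M.ι → N.ι) (φ : ∀ i, N.X (e i) ⟶ M.X i) (i : M.ι) :
    monoInv e φ (e i) i = φ i := by
  simp [monoInv]

theorem monoInv_ne {M N : Mat_ C} (e : M.ι → N.ι) (φ : ∀ i, N.X (e i) ⟶ M.X i) {i : M.ι} {j : N.ι}
    (h : j ≠ e i) : monoInv e φ j i = 0 := dif_neg h

/-- The isomorphism given by a bijection of indices and isomorphisms of entries. -/
def monoIso {M N : Mat_ C} (e : M.ι ≃ N.ι) (φ : ∀ i, M.X i ≅ N.X (e i)) : M ≅ N where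
  hom := monoHom e (fun i => (φ i).hom)
  inv := monoInv e (fun i => (φ i).inv)
  hom_inv_id := by
    apply Mat_.hom_ext
    intro i k
    rw [(monoHom_isMonomial _ _).comp_apply]
    by_cases h : i = k
    · subst h; rw [monoInv_self, Iso.hom_inv_id, Mat_.id_apply_self]
    · rw [Mat_.id_apply_of_ne _ _ _ h, monoInv_ne _ _ (fun h' => h (e.injective h')), comp_zero]
  inv_hom_id := by
    apply Mat_.hom_ext
    intro j k
    obtain ⟨i, rfl⟩ := e.surjective k
    rw [(monoHom_isMonomial _ _).apply_comp e.injective]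
    by_cases h : j = e i
    · subst h; rw [monoInv_self, Iso.inv_hom_id, Mat_.id_apply_self]
    · rw [Mat_.id_apply_of_ne _ _ _ h, monoInv_ne _ _ h, zero_comp]

variable [MonoidalCategory C]

/-- The tensor product (Kronecker product) of matrices of morphisms. -/
def tensorMat {M M' N N' : Mat_ C} (f : M ⟶ M') (g : N ⟶ N') :
    (⟨M.ι × N.ι, fun p => M.X p.1 ⊗ N.X p.2⟩ : Mat_ C) ⟶
      ⟨M'.ι × N'.ι, fun p => M'.X p.1 ⊗ N'.X p.2⟩ :=
  fun p p' => f p.1 p'.1 ⊗ₘ g p.2 p'.2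

end MatMonoidal

open MatMonoidal

variable [MonoidalCategory C]

instance : MonoidalCategoryStruct (Mat_ C) where
  tensorObj M N := ⟨M.ι × N.ι, fun p => M.X p.1 ⊗ N.X p.2⟩
  tensorHom := tensorMat
  whiskerLeft M _ _ g := tensorMat (𝟙 M) g
  whiskerRight f N := tensorMat f (𝟙 N)
  tensorUnit := ⟨PUnit, fun _ => 𝟙_ C⟩
  associator M N K := monoIso (Equiv.prodAssoc M.ι N.ι K.ι)
    (fun p => α_ (M.X p.1.1) (N.X p.1.2) (K.X p.2))
  leftUnitor M := monoIso (Equiv.punitProd M.ι) (fun p => λ_ (M.X p.2))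
  rightUnitor M := monoIso (Equiv.prodPUnit M.ι) (fun p => ρ_ (M.X p.1))

namespace MatMonoidal

theorem tensorHom_apply {M M' N N' : Mat_ C} (f : M ⟶ M') (g : N ⟶ N') (i : (M ⊗ N).ι)
    (j : (M' ⊗ N').ι) : (f ⊗ₘ g) i j = f i.1 j.1 ⊗ₘ g i.2 j.2 := rfl

theorem assoc_mono (M N K : Mat_ C) : IsMonomial (α_ M N K).hom (fun p => (p.1.1, (p.1.2, p.2)))
    (fun p => (α_ (M.X p.1.1) (N.X p.1.2) (K.X p.2)).hom) := monoHom_isMonomial _ _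

theorem left_mono (M : Mat_ C) : IsMonomial (λ_ M).hom (fun p : PUnit × M.ι => p.2)
    (fun p : PUnit × M.ι => (λ_ (M.X p.2)).hom) := monoHom_isMonomial _ _

theorem right_mono (M : Mat_ C) : IsMonomial (ρ_ M).hom (fun p : M.ι × PUnit => p.1)
    (fun p : M.ι × PUnit => (ρ_ (M.X p.1)).hom) := monoHom_isMonomial _ _

variable [MonoidalPreadditive C]

theorem IsMonomial.tensor {M M' N N' : Mat_ C} {f : M ⟶ M'} {e : M.ι → M'.ι}
    {φ : ∀ i, M.X i ⟶ M'.X (e i)} (hf : IsMonomial f e φ) {g : N ⟶ N'} {e' : N.ι → N'.ι}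
    {ψ : ∀ i, N.X i ⟶ N'.X (e' i)} (hg : IsMonomial g e' ψ) :
    IsMonomial (f ⊗ₘ g) (fun p => (e p.1, e' p.2)) (fun p => φ p.1 ⊗ₘ ψ p.2) where
  diag p := by rw [tensorHom_apply, hf.diag, hg.diag]
  off p q h := by
    rw [tensorHom_apply]
    by_cases h₁ : e p.1 = q.1
    · rw [hg.off _ _ fun h₂ => h (Prod.ext h₁ h₂)]
      exact MonoidalPreadditive.tensor_zero _
    · rw [hf.off _ _ h₁]
      exact MonoidalPreadditive.zero_tensor _

end MatMonoidal

variable [MonoidalPreadditive C]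

instance : MonoidalCategory (Mat_ C) := MonoidalCategory.ofTensorHom
  (id_tensorHom_id := fun M N =>
    ((IsMonomial.id M).tensor (IsMonomial.id N)).ext (IsMonomial.id (M ⊗ N))
      fun _ => id_tensorHom_id _ _)
  (id_tensorHom := fun _ _ _ _ => rfl)
  (tensorHom_id := fun _ _ => rfl)
  (tensorHom_comp_tensorHom := fun f₁ f₂ g₁ g₂ => by
    apply Mat_.hom_ext
    intro p q
    rw [tensorHom_apply, Mat_.comp_apply, Mat_.comp_apply, Mat_.comp_apply]
    refine Eq.trans ?_ (sum_tensor _ _ _).symm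
    simp only [tensor_sum, ← tensorHom_comp_tensorHom]
    exact Fintype.sum_prod_type _)
  (associator_naturality := fun {X₁ X₂ X₃ Y₁ Y₂ Y₃} f₁ f₂ f₃ => by
    apply Mat_.hom_ext
    rintro p ⟨i', j', k'⟩
    refine ((assoc_mono Y₁ Y₂ Y₃).apply_comp (Equiv.prodAssoc Y₁.ι Y₂.ι Y₃.ι).injective
      ((f₁ ⊗ₘ f₂) ⊗ₘ f₃) p ((i', j'), k')).trans (Eq.trans ?_
        ((assoc_mono X₁ X₂ X₃).comp_apply _ _ _).symm)
    exact associator_naturality _ _ _)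
  (leftUnitor_naturality := fun {X Y} f => by
    apply Mat_.hom_ext
    rintro ⟨i, j⟩ j'
    refine ((left_mono Y).apply_comp (Equiv.punitProd Y.ι).injective (𝟙 (𝟙_ (Mat_ C)) ⊗ₘ f)
      (i, j) (i, j')).trans (Eq.trans ?_ ((left_mono X).comp_apply _ _ _).symm)
    have h := (IsMonomial.id (𝟙_ (Mat_ C))).diag i
    refine (congrArg (· ≫ _) ((congrArg (· ⊗ₘ f j j') h).trans (id_tensorHom _ _))).trans
      (leftUnitor_naturality _))
  (rightUnitor_naturality := fun {X Y} f => by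
    apply Mat_.hom_ext
    rintro ⟨j, i⟩ j'
    refine ((right_mono Y).apply_comp (Equiv.prodPUnit Y.ι).injective (f ⊗ₘ 𝟙 (𝟙_ (Mat_ C)))
      (j, i) (j', i)).trans (Eq.trans ?_ ((right_mono X).comp_apply _ _ _).symm)
    have h := (IsMonomial.id (𝟙_ (Mat_ C))).diag i
    refine (congrArg (· ≫ _) ((congrArg (f j j' ⊗ₘ ·) h).trans (tensorHom_id _ _))).trans
      (rightUnitor_naturality _))
  (pentagon := fun W X Y Z => by
    refine (((assoc_mono W X Y).tensor (.id Z)).comp ((assoc_mono W (X ⊗ Y) Z).comp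
      ((IsMonomial.id W).tensor (assoc_mono X Y Z)))).ext
        ((assoc_mono (W ⊗ X) Y Z).comp (assoc_mono W X (Y ⊗ Z))) fun p => ?_
    have := MonoidalCategory.pentagon (W.X p.1.1.1) (X.X p.1.1.2) (Y.X p.1.2) (Z.X p.2)
    rw [← tensorHom_id, ← id_tensorHom] at this
    exact this)
  (triangle := fun X Y => by
    refine ((assoc_mono X (𝟙_ (Mat_ C)) Y).comp ((IsMonomial.id X).tensor (left_mono Y))).ext
      ((right_mono X).tensor (.id Y)) fun p => ?_
    have := MonoidalCategory.triangle (X.X p.1.1) (Y.X p.2)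
    rw [← tensorHom_id, ← id_tensorHom] at this
    exact this)

instance : MonoidalPreadditive (Mat_ C) where
  whiskerLeft_zero := Mat_.hom_ext _ _ fun _ _ => MonoidalPreadditive.tensor_zero _
  zero_whiskerRight := Mat_.hom_ext _ _ fun _ _ => MonoidalPreadditive.zero_tensor _
  whiskerLeft_add _ _ := Mat_.hom_ext _ _ fun _ _ => MonoidalPreadditive.tensor_add _ _ _
  add_whiskerRight _ _ := Mat_.hom_ext _ _ fun _ _ => MonoidalPreadditive.add_tensor _ _ _

end MatMonoidal

section JonesWenzl

/-- The quantum integer `[n]`. -/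
def qInt (q : ℂ) (n : ℕ) : ℂ := (q ^ n - (q ^ n)⁻¹) / (q - q⁻¹)

variable {C : Type*} [Category C] [MonoidalCategory C]

/-- The tensor power `X ⊗ ⋯ ⊗ X` (`n` factors, bracketed to the left). -/
def tpow (X : C) : ℕ → C
  | 0 => 𝟙_ C
  | n + 1 => tpow X n ⊗ X

/-- The canonical (associativity) isomorphism between tensor powers. -/
def tpowAdd (X : C) (i : ℕ) : ∀ j : ℕ, tpow X i ⊗ tpow X j ≅ tpow X (i + j)
  | 0 => ρ_ (tpow X i)
  | j + 1 => (α_ (tpow X i) (tpow X j) X).symm ≪≫ whiskerRightIso (tpowAdd X i j) X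

/-- The endomorphism `cup ∘ cap` of the last two factors of `T ⊗ X ⊗ X`. -/
def capCup {X : C} (cup : 𝟙_ C ⟶ X ⊗ X) (cap : X ⊗ X ⟶ 𝟙_ C) (T : C) :
    (T ⊗ X) ⊗ X ⟶ (T ⊗ X) ⊗ X :=
  (α_ T X X).hom ≫ T ◁ (cap ≫ cup) ≫ (α_ T X X).inv

section
variable {X : C} (cup : 𝟙_ C ⟶ X ⊗ X) (cap : X ⊗ X ⟶ 𝟙_ C)

theorem capCup_comm (T : C) (f : T ⟶ T) :
    f ▷ X ▷ X ≫ capCup cup cap T = capCup cup cap T ≫ f ▷ X ▷ X := by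
  have h := whisker_exchange f (cap ≫ cup)
  have e : f ▷ X ▷ X = (α_ T X X).hom ≫ f ▷ (X ⊗ X) ≫ (α_ T X X).inv := by simp
  rw [e]
  simp only [capCup, Category.assoc, Iso.inv_hom_id_assoc]
  rw [← reassoc_of% h]

theorem capCup_braid
    (zz₁ : X ◁ cup ≫ (α_ X X X).inv ≫ cap ▷ X = (ρ_ X).hom ≫ (λ_ X).inv)
    (zz₂ : cup ▷ X ≫ (α_ X X X).hom ≫ X ◁ cap = (λ_ X).hom ≫ (ρ_ X).inv) (T : C) :
    capCup cup cap (T ⊗ X) ≫ capCup cup cap T ▷ X ≫ capCup cup cap (T ⊗ X) =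
      capCup cup cap (T ⊗ X) := by
  have h₁ : (T ⊗ X) ◁ cup ≫ (α_ (T ⊗ X) X X).inv ≫ (α_ T X X).hom ▷ X ≫ (T ◁ cap) ▷ X =
      (ρ_ (T ⊗ X)).hom ≫ (ρ_ T).inv ▷ X := by
    calc _ = (α_ T X (𝟙_ C)).hom ≫ T ◁ (X ◁ cup ≫ (α_ X X X).inv ≫ cap ▷ X) ≫
          (α_ T (𝟙_ C) X).inv := by monoidal
      _ = _ := by rw [zz₁]; monoidal
  have h₂ : (T ◁ cup) ▷ X ≫ (α_ T X X).inv ▷ X ≫ (α_ (T ⊗ X) X X).hom ≫ (T ⊗ X) ◁ cap =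
      (ρ_ T).hom ▷ X ≫ (ρ_ (T ⊗ X)).inv := by
    calc _ = (α_ T (𝟙_ C) X).hom ≫ T ◁ (cup ▷ X ≫ (α_ X X X).hom ≫ X ◁ cap) ≫
          (α_ T X (𝟙_ C)).inv := by monoidal
      _ = _ := by rw [zz₂]; monoidal
  simp only [capCup, whiskerLeft_comp, comp_whiskerRight, Category.assoc]
  rw [reassoc_of% h₁, reassoc_of% h₂]
  simp
end

variable [Preadditive C] [Linear ℂ C]

/-- One step `f ↦ f ⊗ 1 + c (f ⊗ 1) U (f ⊗ 1)` of the Jones–Wenzl recursion, where `U` is the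
cap-cup morphism on the last two factors. -/
def jwStep {X : C} (cup : 𝟙_ C ⟶ X ⊗ X) (cap : X ⊗ X ⟶ 𝟙_ C) (T : C) (f : T ⊗ X ⟶ T ⊗ X) (c : ℂ) :
    (T ⊗ X) ⊗ X ⟶ (T ⊗ X) ⊗ X :=
  f ▷ X + c • (f ▷ X ≫ capCup cup cap T ≫ f ▷ X)

/-- The Jones–Wenzl projections. -/
def jw (q : ℂ) {X : C} (cup : 𝟙_ C ⟶ X ⊗ X) (cap : X ⊗ X ⟶ 𝟙_ C) :
    ∀ n : ℕ, tpow X n ⟶ tpow X n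
  | 0 => 𝟙 _
  | 1 => 𝟙 _
  | n + 2 => jwStep cup cap (tpow X n) (jw q cup cap (n + 1)) (qInt q (n + 1) / qInt q (n + 2))

theorem qInt_rec {q : ℂ} (hq : q ≠ 0) (n : ℕ) :
    qInt q 2 * qInt q (n + 1) = qInt q n + qInt q (n + 2) := by
  by_cases h : q - q⁻¹ = 0
  · simp [qInt, h]
  · have h2 : qInt q 2 = q + q⁻¹ := by
      rw [qInt, div_eq_iff h]; field_simp; ring
    rw [h2]
    simp only [qInt]
    rw [← add_div, mul_div_assoc']
    congr 1
    field_simp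
    ring


variable [MonoidalPreadditive C] [MonoidalLinear ℂ C]

theorem capCup_sq {X : C} (cup : 𝟙_ C ⟶ X ⊗ X) (cap : X ⊗ X ⟶ 𝟙_ C) {δ : ℂ}
    (loop : cup ≫ cap = δ • 𝟙 (𝟙_ C)) (T : C) :
    capCup cup cap T ≫ capCup cup cap T = δ • capCup cup cap T := by
  have : (cap ≫ cup) ≫ (cap ≫ cup) = δ • (cap ≫ cup) := by
    rw [Category.assoc, reassoc_of% loop]; simp
  simp only [capCup, Category.assoc, Iso.inv_hom_id_assoc]
  rw [← whiskerLeft_comp_assoc, this, MonoidalLinear.whiskerLeft_smul, Linear.smul_comp,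
    Linear.comp_smul]

/-- The properties carried through the Jones–Wenzl recursion to prove idempotence. -/
structure JWGood {X : C} (cup : 𝟙_ C ⟶ X ⊗ X) (cap : X ⊗ X ⟶ 𝟙_ C) (T : C) (f : T ⟶ T)
    (g : T ⊗ X ⟶ T ⊗ X) (d : ℂ) : Prop where
  idem : g ≫ g = g
  absorb : f ▷ X ≫ g = g
  trace : capCup cup cap T ≫ g ▷ X ≫ capCup cup cap T = d • (capCup cup cap T ≫ f ▷ X ▷ X)

theorem JWGood.step {X : C} {cup : 𝟙_ C ⟶ X ⊗ X} {cap : X ⊗ X ⟶ 𝟙_ C} {δ : ℂ}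
    (zz₁ : X ◁ cup ≫ (α_ X X X).inv ≫ cap ▷ X = (ρ_ X).hom ≫ (λ_ X).inv)
    (zz₂ : cup ▷ X ≫ (α_ X X X).hom ≫ X ◁ cap = (λ_ X).hom ≫ (ρ_ X).inv)
    (loop : cup ≫ cap = δ • 𝟙 (𝟙_ C)) {T : C} {f : T ⟶ T} {g : T ⊗ X ⟶ T ⊗ X} {d : ℂ}
    (h : JWGood cup cap T f g d) {c : ℂ} (hc : c * c * d = -c) :
    JWGood cup cap (T ⊗ X) g (jwStep cup cap T g c) (δ + c) := by
  have hp : g ▷ X ≫ g ▷ X = g ▷ X := by rw [← comp_whiskerRight, h.idem]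
  have hr : f ▷ X ▷ X ≫ g ▷ X = g ▷ X := by rw [← comp_whiskerRight, h.absorb]
  have hpU : (g ▷ X ≫ capCup cup cap T ≫ g ▷ X) ≫ (g ▷ X ≫ capCup cup cap T ≫ g ▷ X) =
      d • (g ▷ X ≫ capCup cup cap T ≫ g ▷ X) := by
    have h1 := h.trace
    simp only [Category.assoc]
    rw [reassoc_of% hp, reassoc_of% h1]
    simp only [Linear.smul_comp, Linear.comp_smul, Category.assoc, hr]
  refine ⟨?_, ?_, ?_⟩
  · have h1 : g ▷ X ≫ g ▷ X ≫ capCup cup cap T ≫ g ▷ X = g ▷ X ≫ capCup cup cap T ≫ g ▷ X := by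
      rw [reassoc_of% hp]
    have h2 : (g ▷ X ≫ capCup cup cap T ≫ g ▷ X) ≫ g ▷ X = g ▷ X ≫ capCup cup cap T ≫ g ▷ X := by
      simp only [Category.assoc, hp]
    rw [jwStep, Preadditive.add_comp, Preadditive.comp_add, Preadditive.comp_add,
      Linear.smul_comp, Linear.comp_smul, Linear.smul_comp, Linear.comp_smul, h1, h2, hp, hpU,
      smul_smul, smul_smul, hc, neg_smul]
    abel
  · rw [jwStep, Preadditive.comp_add, Linear.comp_smul, reassoc_of% hp, hp]
  · have hR : g ▷ X ▷ X ≫ g ▷ X ▷ X = g ▷ X ▷ X := by rw [← comp_whiskerRight, hp]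
    have hRU := capCup_comm cup cap (T ⊗ X) g
    have hUU := capCup_sq cup cap loop (T ⊗ X)
    have hUV := capCup_braid cup cap zz₁ zz₂ T
    rw [jwStep, MonoidalPreadditive.add_whiskerRight, MonoidalLinear.smul_whiskerRight,
      comp_whiskerRight, comp_whiskerRight]
    generalize capCup cup cap (T ⊗ X) = U at *
    generalize g ▷ X ▷ X = R at *
    generalize capCup cup cap T ▷ X = V at *
    have h1 : U ≫ R ≫ U = δ • (U ≫ R) := by
      rw [hRU, reassoc_of% hUU, Linear.smul_comp]
    have h2 : U ≫ R ≫ V ≫ R ≫ U = U ≫ R := by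
      rw [hRU, ← reassoc_of% hRU, reassoc_of% hUV, reassoc_of% hRU, hR]
    simp only [Preadditive.add_comp, Preadditive.comp_add, Linear.smul_comp, Linear.comp_smul,
      Category.assoc, h1, h2, add_smul]

theorem jw_coef {q : ℂ} (hq : q ≠ 0) (n : ℕ) :
    qInt q (n + 1) / qInt q (n + 2) * (qInt q (n + 1) / qInt q (n + 2)) *
      (-qInt q 2 + qInt q n / qInt q (n + 1)) = -(qInt q (n + 1) / qInt q (n + 2)) := by
  have := qInt_rec hq n
  by_cases h1 : qInt q (n + 1) = 0
  · simp [h1]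
  by_cases h2 : qInt q (n + 2) = 0
  · simp [h2]
  have h3 : -qInt q 2 + qInt q n / qInt q (n + 1) = -(qInt q (n + 2) / qInt q (n + 1)) := by
    field_simp
    linear_combination -this
  rw [h3]
  field_simp

theorem jw_idem {q : ℂ} (hq : q ≠ 0) {X : C} (cup : 𝟙_ C ⟶ X ⊗ X) (cap : X ⊗ X ⟶ 𝟙_ C)
    (zz₁ : X ◁ cup ≫ (α_ X X X).inv ≫ cap ▷ X = (ρ_ X).hom ≫ (λ_ X).inv)
    (zz₂ : cup ▷ X ≫ (α_ X X X).hom ≫ X ◁ cap = (λ_ X).hom ≫ (ρ_ X).inv)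
    (loop : cup ≫ cap = (-qInt q 2) • 𝟙 (𝟙_ C)) (n : ℕ) :
    jw q cup cap n ≫ jw q cup cap n = jw q cup cap n := by
  have main : ∀ n, JWGood cup cap (tpow X n) (jw q cup cap n) (jw q cup cap (n + 1))
      (-qInt q 2 + qInt q n / qInt q (n + 1)) := by
    intro n
    induction n with
    | zero =>
      have h0 : qInt q 0 = 0 := by simp [qInt]
      rw [h0, zero_div, add_zero]
      have h : JWGood cup cap (𝟙_ C) (𝟙 _) (𝟙 _) (-qInt q 2) :=
        ⟨by simp, by simp, by simpa using capCup_sq cup cap loop (𝟙_ C)⟩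
      exact h
    | succ n ih => exact ih.step zz₁ zz₂ loop (jw_coef hq n)
  cases n with
  | zero => exact Category.comp_id _
  | succ n => exact (main n).idem

end JonesWenzl

section TemperleyLieb
open CategoryTheory.Idempotents

/-- The root of unity `q = exp (π i / (k + 2))`. -/
def qRoot (k : ℕ) : ℂ := Complex.exp (Real.pi * Complex.I / (k + 2))

/-- The value `δ = -[2]` of a loop. -/
def loopValue (k : ℕ) : ℂ := -qInt (qRoot k) 2

/-- The generating object of the linearized diagram category. -/
def linPt : Free ℂ Diag := (Free.embedding ℂ Diag).obj Diag.pt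

/-- The cup in the linearized diagram category. -/
def linCup : 𝟙_ (Free ℂ Diag) ⟶ linPt ⊗ linPt := (Free.embedding ℂ Diag).map Diag.cup

/-- The cap in the linearized diagram category. -/
def linCap : linPt ⊗ linPt ⟶ 𝟙_ (Free ℂ Diag) := (Free.embedding ℂ Diag).map Diag.cap

/-- The relation that a loop is equal to the scalar `δ`. -/
inductive LoopRel (δ : ℂ) : ∀ ⦃X Y : Free ℂ Diag⦄, (X ⟶ Y) → Prop
  | loop : LoopRel δ (linCup ≫ linCap - δ • 𝟙 (𝟙_ (Free ℂ Diag)))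

/-- The linearized diagram category modulo the relation that every loop is equal to `δ`. -/
abbrev TLPre (k : ℕ) := IdealQuotient (LoopRel (loopValue k))

namespace TLPre
variable (k : ℕ)

/-- The generating object. -/
def pt : TLPre k := (toIdealQuotient _).obj linPt

/-- The cup. -/
def cup : 𝟙_ (TLPre k) ⟶ pt k ⊗ pt k := (toIdealQuotient (LoopRel (loopValue k))).map linCup

/-- The cap. -/
def cap : pt k ⊗ pt k ⟶ 𝟙_ (TLPre k) := (toIdealQuotient (LoopRel (loopValue k))).map linCap

theorem diag_zigzag₁ : Diag.pt ◁ Diag.cup ≫ (α_ Diag.pt Diag.pt Diag.pt).inv ≫ Diag.cap ▷ Diag.pt =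
    (ρ_ Diag.pt).hom ≫ (λ_ Diag.pt).inv :=
  Diag.sound ((Word.Rel.comp_congr (.refl _) (.id_comp _)).trans
    (Word.Rel.zigzag_right.trans (Word.Rel.ident_comp_ident (rfl : 1 = 1) (rfl : 1 = 1)).symm))

theorem diag_zigzag₂ : Diag.cup ▷ Diag.pt ≫ (α_ Diag.pt Diag.pt Diag.pt).hom ≫ Diag.pt ◁ Diag.cap =
    (λ_ Diag.pt).hom ≫ (ρ_ Diag.pt).inv :=
  Diag.sound ((Word.Rel.comp_congr (.refl _) (.id_comp _)).trans
    (Word.Rel.zigzag_left.trans (Word.Rel.ident_comp_ident (rfl : 1 = 1) (rfl : 1 = 1)).symm))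

theorem lin_zigzag₁ : linPt ◁ linCup ≫ (α_ linPt linPt linPt).inv ≫ linCap ▷ linPt =
    (ρ_ linPt).hom ≫ (λ_ linPt).inv := by
  have h1 : linPt ◁ linCup = (Free.embedding ℂ Diag).map (Diag.pt ◁ Diag.cup) :=
    Finsupp.mapDomain_single
  have h2 : linCap ▷ linPt = (Free.embedding ℂ Diag).map (Diag.cap ▷ Diag.pt) :=
    Finsupp.mapDomain_single
  have h := congrArg (Free.embedding ℂ Diag).map diag_zigzag₁
  simp only [Functor.map_comp] at h
  rw [h1, h2]
  exact h

theorem lin_zigzag₂ : linCup ▷ linPt ≫ (α_ linPt linPt linPt).hom ≫ linPt ◁ linCap =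
    (λ_ linPt).hom ≫ (ρ_ linPt).inv := by
  have h1 : linPt ◁ linCap = (Free.embedding ℂ Diag).map (Diag.pt ◁ Diag.cap) :=
    Finsupp.mapDomain_single
  have h2 : linCup ▷ linPt = (Free.embedding ℂ Diag).map (Diag.cup ▷ Diag.pt) :=
    Finsupp.mapDomain_single
  have h := congrArg (Free.embedding ℂ Diag).map diag_zigzag₂
  simp only [Functor.map_comp] at h
  rw [h1, h2]
  exact h

theorem zigzag₁ : pt k ◁ cup k ≫ (α_ (pt k) (pt k) (pt k)).inv ≫ cap k ▷ pt k =
    (ρ_ (pt k)).hom ≫ (λ_ (pt k)).inv :=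
  congrArg (toIdealQuotient (LoopRel (loopValue k))).map lin_zigzag₁

theorem zigzag₂ : cup k ▷ pt k ≫ (α_ (pt k) (pt k) (pt k)).hom ≫ pt k ◁ cap k =
    (λ_ (pt k)).hom ≫ (ρ_ (pt k)).inv :=
  congrArg (toIdealQuotient (LoopRel (loopValue k))).map lin_zigzag₂

theorem loop : cup k ≫ cap k = (-qInt (qRoot k) 2) • 𝟙 (𝟙_ (TLPre k)) :=
  CategoryTheory.Quotient.sound (idealRel (LoopRel (loopValue k)))
    (TensorIdeal.of (S := LoopRel (loopValue k)) _ .loop)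

/-- The Jones–Wenzl projection `f_i`, an endomorphism of `i = 1 ⊗ ⋯ ⊗ 1`. -/
def proj (i : ℕ) : tpow (pt k) i ⟶ tpow (pt k) i := jw (qRoot k) (cup k) (cap k) i

theorem proj_idem (i : ℕ) : proj k i ≫ proj k i = proj k i :=
  jw_idem (Complex.exp_ne_zero _) _ _ (zigzag₁ k) (zigzag₂ k) (loop k) i

end TLPre

/-- The Temperley–Lieb category: the additive and idempotent completion of `TLPre k`. -/
abbrev TL (k : ℕ) := Karoubi (Mat_ (TLPre k))

namespace TL
variable (k : ℕ)

/-- The object `F_i = (i, f_i)`. -/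
def F (i : ℕ) : TL k where
  X := (Mat_.embedding (TLPre k)).obj (tpow (TLPre.pt k) i)
  p := (Mat_.embedding (TLPre k)).map (TLPre.proj k i)
  idem := by rw [← Functor.map_comp, TLPre.proj_idem]

/-- The canonical morphism between the tensor product of two one-by-one matrix objects and the
one-by-one matrix object on the tensor product. -/
def embMul (X Y : TLPre k) : (Mat_.embedding (TLPre k)).obj X ⊗ (Mat_.embedding (TLPre k)).obj Y ⟶
    (Mat_.embedding (TLPre k)).obj (X ⊗ Y) :=
  fun _ _ => 𝟙 (X ⊗ Y)

/-- The morphism `(x, p) ⟶ (y, p')` of the idempotent completion given by `p' ∘ g ∘ p`. -/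
def cut {P Q : TL k} (g : P.X ⟶ Q.X) : P ⟶ Q where
  f := P.p ≫ g ≫ Q.p
  comm := by simp

/-- The morphism `π_{i,j} = f_{i+j} ∘ (f_i ⊗ f_j) : F_i ⊗ F_j ⟶ F_{i+j}`. -/
def mulF (i j : ℕ) : F k i ⊗ F k j ⟶ F k (i + j) :=
  cut k (P := F k i ⊗ F k j) (Q := F k (i + j))
    (embMul k (tpow (TLPre.pt k) i) (tpow (TLPre.pt k) j) ≫
      (Mat_.embedding (TLPre k)).map (tpowAdd (TLPre.pt k) i j).hom)

/-- The identification of the unit object with `F_0`. -/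
def unitF : 𝟙_ (TL k) ⟶ F k 0 :=
  cut k (P := 𝟙_ (TL k)) (Q := F k 0) ((Mat_.embedding (TLPre k)).map (𝟙 (𝟙_ (TLPre k))))

/-- The generator `1_{F_{k+1}}` of the ideal `(F_{k+1})`. -/
inductive KillRel : ∀ ⦃X Y : TL k⦄, (X ⟶ Y) → Prop
  | mk : KillRel (𝟙 (F k (k + 1)))

end TL

/-- The reduced Temperley–Lieb category at level `k`: the quotient of the Temperley–Lieb category
by the tensor ideal generated by `F_{k+1}`. -/
abbrev RedTL (k : ℕ) := IdealQuotient (TL.KillRel k)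

namespace RedTL
variable (k : ℕ)

/-- The object `F_i` of the reduced Temperley–Lieb category. -/
def F (i : ℕ) : RedTL k := (toIdealQuotient (TL.KillRel k)).obj (TL.F k i)

/-- The morphism `π_{i,j} : F_i ⊗ F_j ⟶ F_{i+j}`. -/
def mulF (i j : ℕ) : F k i ⊗ F k j ⟶ F k (i + j) :=
  (toIdealQuotient (TL.KillRel k)).map (TL.mulF k i j)

/-- The identification of the unit object with `F_0`. -/
def unitF : 𝟙_ (RedTL k) ⟶ F k 0 := (toIdealQuotient (TL.KillRel k)).map (TL.unitF k)

/-- The object `Σ = F_0 ⊕ ⋯ ⊕ F_k`. -/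
def Sig : RedTL k := ⨁ fun i : Fin (k + 1) => F k i

/-- The inclusion of the summand `F_i` of `Σ`. -/
def incl (i : ℕ) (h : i < k + 1) : F k i ⟶ Sig k :=
  biproduct.ι (fun i : Fin (k + 1) => F k i) ⟨i, h⟩

/-- The projection of `Σ` to the summand `F_i`. -/
def projF (i : ℕ) (h : i < k + 1) : Sig k ⟶ F k i :=
  biproduct.π (fun i : Fin (k + 1) => F k i) ⟨i, h⟩

/-- The unit `u : 𝟙 = F_0 ⟶ Σ`. -/
def sigUnit : 𝟙_ (RedTL k) ⟶ Sig k := unitF k ≫ incl k 0 (Nat.succ_pos k)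

/-- The multiplication `m : Σ ⊗ Σ ⟶ Σ`, the sum of the morphisms `π_{i,j}` with `i + j ≤ k`. -/
def sigMul : Sig k ⊗ Sig k ⟶ Sig k :=
  ∑ i : Fin (k + 1), ∑ j : Fin (k + 1),
    (projF k i i.isLt ⊗ₘ projF k j j.isLt) ≫
      if h : (i : ℕ) + j < k + 1 then mulF k i j ≫ incl k (i + j) h else 0

/-- The projection `n : Σ ⟶ F_k`. -/
def sigProj : Sig k ⟶ F k k := projF k k (Nat.lt_succ_self k)

end RedTL
end TemperleyLieb

section Frobenius

variable {C : Type*} [Category C] [MonoidalCategory C]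

/-- The morphism `φ : A ⟶ W ⊗ A^∨` attached to a morphism `n : A ⟶ W` from an algebra with a dual
object `A^∨ = Aᘁ`, with coevaluation `𝟙 ⟶ A ⊗ A^∨` and evaluation `A^∨ ⊗ A ⟶ 𝟙`. -/
def frobeniusMap (A : C) [MonObj A] [HasRightDual A] {W : C} (n : A ⟶ W) : A ⟶ W ⊗ Aᘁ :=
  (ρ_ A).inv ≫ A ◁ (η_ A Aᘁ) ≫ (α_ A A Aᘁ).inv ≫ (MonObj.mul (X := A) ≫ n) ▷ Aᘁ

/-- `(W, n)` is a Frobenius structure on the algebra `A`. -/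
def IsFrobeniusStructure (A : C) [MonObj A] [HasRightDual A] (W : C) (n : A ⟶ W) : Prop :=
  IsIso (frobeniusMap A n)

end Frobenius

end

end TLJ

/-!
Write `b` for the pairing `n ∘ m : Σ ⊗ Σ ⟶ F_k`. Composing `φ` with a morphism `g : Y ⟶ Σ` gives the
mate of `b ∘ (g ⊗ 1)`, so by Yoneda `φ` is an isomorphism as soon as `g ↦ b ∘ (g ⊗ 1)` is bijective
for every `Y`. The pairing `b` is the sum of the `π_{i,j}` with `i + j = k`, so it is enough to
prove this for each `π_{i,j} : F_i ⊗ F_j ⟶ F_k`.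

Three properties of the projections are used: `f_{i+j}` absorbs `f_i ⊗ f_j` (which also gives
associativity), the composite of `f_{i+2}` with a cup on its last two strands is zero, and the
partial trace of `f_{i+1}` over the last strand is `-[i+2]/[i+1] • f_i`. Since `[i+2] ≠ 0` for
`i < k`, the partial trace shows that `g ↦ f_{i+1} ∘ (g ⊗ 1)` is injective on morphisms into `F_i`;
iterating over the `j` strands gives injectivity for `π_{i,j}`.

Surjectivity is by induction on `j`. Bending the first strand of `F_{j+1}` to the left, the
induction hypothesis turns `w : Y ⊗ F_{j+1} ⟶ F_k` into a morphism `g : Y ⊗ X ⟶ F_{i+1}`. The mate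
of `g` is killed by `f_{i+2}`: for `j = 0` because `f_{k+1} = 0` in the quotient, and otherwise by
injectivity, as `w` factors through `f_{j+1}`, which kills the cup. Expanding `f_{i+2}` by the
recursion shows that `g` is a multiple of `f_{i+1} ∘ (v ⊗ 1)`, where `v : Y ⟶ F_i` is the partial
trace of `g`, and the corresponding multiple of `v` is the required preimage of `w`.
-/

namespace TLJ

noncomputable section

/-! ### Duality -/

section Duality
open Functor.LaxMonoidal Functor.OplaxMonoidal

variable {C D : Type*} [Category C] [MonoidalCategory C] [Category D] [MonoidalCategory D]

/-- The two zigzag identities for a coevaluation and an evaluation: Mathlib's `ExactPairing A B` as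
a property of the two morphisms. -/
structure IsDuality {A B : C} (coev : 𝟙_ C ⟶ A ⊗ B) (ev : B ⊗ A ⟶ 𝟙_ C) : Prop where
  coev_ev : B ◁ coev ≫ (α_ B A B).inv ≫ ev ▷ B = (ρ_ B).hom ≫ (λ_ B).inv
  ev_coev : coev ▷ A ≫ (α_ A B A).hom ≫ A ◁ ev = (λ_ A).hom ≫ (ρ_ A).inv

theorem isDuality_exactPairing (A B : C) [ExactPairing A B] : IsDuality (η_ A B) (ε_ A B) where
  coev_ev := ExactPairing.coevaluation_evaluation A B
  ev_coev := ExactPairing.evaluation_coevaluation A B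

theorem IsDuality.nonempty_hasRightDual {A B : C} {coev : 𝟙_ C ⟶ A ⊗ B} {ev : B ⊗ A ⟶ 𝟙_ C}
    (h : IsDuality coev ev) : Nonempty (HasRightDual A) :=
  ⟨{ rightDual := B
     exact :=
      { coevaluation' := coev
        evaluation' := ev
        coevaluation_evaluation' := h.coev_ev
        evaluation_coevaluation' := h.ev_coev } }⟩

theorem nonempty_hasRightDual_tpow (X : C) [HasRightDual X] :
    ∀ n, Nonempty (HasRightDual (tpow X n))
  | 0 => ⟨inferInstanceAs (HasRightDual (𝟙_ C))⟩
  | n + 1 => by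
    obtain ⟨_⟩ := nonempty_hasRightDual_tpow X n
    exact ⟨hasRightDualTensor (X := tpow X n) (Y := X)⟩

section Map
variable (G : C ⥤ D) [G.Monoidal] {A B : C}

/-- The image of a coevaluation, such as a cup, under a monoidal functor. -/
def mapCoev (coev : 𝟙_ C ⟶ A ⊗ B) : 𝟙_ D ⟶ G.obj A ⊗ G.obj B :=
  ε G ≫ G.map coev ≫ δ G A B

/-- The image of an evaluation, such as a cap, under a monoidal functor. -/
def mapEv (ev : B ⊗ A ⟶ 𝟙_ C) : G.obj B ⊗ G.obj A ⟶ 𝟙_ D :=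
  μ G B A ≫ G.map ev ≫ η G

variable {coev : 𝟙_ C ⟶ A ⊗ B} {ev : B ⊗ A ⟶ 𝟙_ C}

theorem IsDuality.map (h : IsDuality coev ev) : IsDuality (mapCoev G coev) (mapEv G ev) where
  coev_ev := by
    have hG := congrArg (fun t => G.obj B ◁ ε G ≫ μ G B (𝟙_ C) ≫ G.map t ≫ δ G (𝟙_ C) B ≫
      η G ▷ G.obj B) h.coev_ev
    simpa only [mapCoev, mapEv, Functor.map_comp, Functor.Monoidal.map_whiskerLeft,
      Functor.Monoidal.map_whiskerRight, Functor.Monoidal.map_associator_inv,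
      Functor.Monoidal.map_rightUnitor, Functor.Monoidal.map_leftUnitor_inv, Category.assoc,
      Functor.Monoidal.μ_δ_assoc, Functor.Monoidal.whiskerRight_ε_η,
      Functor.Monoidal.whiskerLeft_ε_η_assoc, Category.comp_id,
      MonoidalCategory.whiskerLeft_comp, comp_whiskerRight] using hG
  ev_coev := by
    have hG := congrArg (fun t => ε G ▷ G.obj A ≫ μ G (𝟙_ C) A ≫ G.map t ≫ δ G A (𝟙_ C) ≫
      G.obj A ◁ η G) h.ev_coev
    simpa only [mapCoev, mapEv, Functor.map_comp, Functor.Monoidal.map_whiskerLeft,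
      Functor.Monoidal.map_whiskerRight, Functor.Monoidal.map_associator,
      Functor.Monoidal.map_leftUnitor, Functor.Monoidal.map_rightUnitor_inv, Category.assoc,
      Functor.Monoidal.μ_δ_assoc, Functor.Monoidal.whiskerLeft_ε_η,
      Functor.Monoidal.whiskerRight_ε_η_assoc, Category.comp_id,
      MonoidalCategory.whiskerLeft_comp, comp_whiskerRight] using hG

theorem nonempty_hasRightDual_map (A : C) [HasRightDual A] :
    Nonempty (HasRightDual (G.obj A)) :=
  ((isDuality_exactPairing A Aᘁ).map G).nonempty_hasRightDual

end Map

theorem whiskerLeft_tensorHom_zigzag {A A' B B' P E E' : C} (coev : 𝟙_ C ⟶ A ⊗ B) (x : A ⟶ P)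
    (t : B ⟶ E') (s : E ⟶ B') (y : P ⟶ A') (ev : B' ⊗ A' ⟶ 𝟙_ C) :
    E ◁ (coev ≫ (x ⊗ₘ t)) ≫ (α_ _ _ _).inv ≫ ((s ⊗ₘ y) ≫ ev) ▷ E' =
      s ▷ 𝟙_ C ≫ (B' ◁ (coev ≫ (x ≫ y) ▷ B) ≫ (α_ _ _ _).inv ≫ ev ▷ B) ≫ 𝟙_ C ◁ t := by
  have slide_left := associator_inv_naturality s y (𝟙 E')
  have slide_right := associator_inv_naturality (𝟙 B') (𝟙 A') t
  simp only [Category.assoc, comp_whiskerRight]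
  rw [← whisker_exchange]
  simp only [← MonoidalCategory.tensorHom_id, ← MonoidalCategory.id_tensorHom] at *
  rw [← reassoc_of% slide_left, ← id_tensorHom_id, ← reassoc_of% slide_right]
  simp only [tensorHom_comp_tensorHom_assoc, tensorHom_comp_tensorHom, Category.comp_id,
    Category.id_comp, Category.assoc]

theorem tensorHom_whiskerRight_zigzag {A A' B B' P E Q : C} (coev : 𝟙_ C ⟶ A ⊗ B) (x : A ⟶ P)
    (t : B ⟶ E) (s : E ⟶ B') (y : Q ⟶ A') (ev : B' ⊗ A' ⟶ 𝟙_ C) :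
    (coev ≫ (x ⊗ₘ t)) ▷ Q ≫ (α_ _ _ _).hom ≫ P ◁ ((s ⊗ₘ y) ≫ ev) =
      𝟙_ C ◁ y ≫ (coev ▷ A' ≫ (α_ _ _ _).hom ≫ A ◁ ((t ≫ s) ▷ A' ≫ ev)) ≫ x ▷ 𝟙_ C := by
  have slide_left := associator_naturality x t (𝟙 Q)
  have slide_right := associator_naturality (𝟙 A) (𝟙 B) y
  simp only [Category.assoc, comp_whiskerRight]
  rw [whisker_exchange_assoc]
  simp only [← MonoidalCategory.tensorHom_id, ← MonoidalCategory.id_tensorHom] at *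
  rw [reassoc_of% slide_left, ← id_tensorHom_id A B, reassoc_of% slide_right]
  simp only [tensorHom_comp_tensorHom_assoc, tensorHom_comp_tensorHom, Category.comp_id,
    Category.id_comp]

section Retract
variable {A B P E : C} {coev : 𝟙_ C ⟶ A ⊗ B} {ev : B ⊗ A ⟶ 𝟙_ C}

theorem IsDuality.retract (h : IsDuality coev ev) (p : Retract P A) (e : Retract E B)
    (hcoev : coev ≫ (p.r ≫ p.i) ▷ B = coev ≫ A ◁ (e.r ≫ e.i))
    (hev : (e.r ≫ e.i) ▷ A ≫ ev = B ◁ (p.r ≫ p.i) ≫ ev) :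
    IsDuality (coev ≫ (p.r ⊗ₘ e.r)) ((e.i ⊗ₘ p.i) ≫ ev) where
  coev_ev := by
    have slide : B ◁ (coev ≫ A ◁ (e.r ≫ e.i)) ≫ (α_ B A B).inv ≫ ev ▷ B =
        (B ◁ coev ≫ (α_ B A B).inv ≫ ev ▷ B) ≫ 𝟙_ C ◁ (e.r ≫ e.i) := by
      simp only [Category.assoc]
      rw [← whisker_exchange]
      simp
    rw [whiskerLeft_tensorHom_zigzag, hcoev, slide, h.coev_ev]
    simp
  ev_coev := by
    have slide : coev ▷ A ≫ (α_ A B A).hom ≫ A ◁ (B ◁ (p.r ≫ p.i) ≫ ev) =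
        𝟙_ C ◁ (p.r ≫ p.i) ≫ coev ▷ A ≫ (α_ A B A).hom ≫ A ◁ ev := by
      rw [whisker_exchange_assoc]
      simp
    rw [tensorHom_whiskerRight_zigzag, hev, slide, h.ev_coev]
    simp

theorem nonempty_hasRightDual_of_retract [IsIdempotentComplete C] [HasRightDual A]
    (p : Retract P A) : Nonempty (HasRightDual P) := by
  have mate_idem : (p.r ≫ p.i)ᘁ ≫ (p.r ≫ p.i)ᘁ = (p.r ≫ p.i)ᘁ := by
    rw [← comp_rightAdjointMate, Category.assoc, p.retract_assoc]
  obtain ⟨E, i, r, retract, split⟩ := IsIdempotentComplete.idempotents_split _ _ mate_idem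
  let e : Retract E Aᘁ := ⟨i, r, retract⟩
  have split : e.r ≫ e.i = (p.r ≫ p.i)ᘁ := split
  refine ((isDuality_exactPairing A Aᘁ).retract p e ?_ ?_).nonempty_hasRightDual
  · rw [split, coevaluation_comp_rightAdjointMate]
  · rw [split, rightAdjointMate_comp_evaluation]

end Retract

section Biproduct
variable [Preadditive C] [MonoidalPreadditive C] [HasFiniteBiproducts C] {J : Type} [Fintype J]
  {F G : J → C} {coev : ∀ j, 𝟙_ C ⟶ F j ⊗ G j} {ev : ∀ j, G j ⊗ F j ⟶ 𝟙_ C}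

theorem sum_zigzag_left (h : ∀ j, IsDuality (coev j) (ev j)) (l : J) :
    ∑ j, biproduct.π G l ▷ 𝟙_ C ≫
      (G l ◁ (coev j ≫ (biproduct.ι F j ≫ biproduct.π F l) ▷ G j) ≫
        (α_ (G l) (F l) (G j)).inv ≫ ev l ▷ G j) ≫ 𝟙_ C ◁ biproduct.ι G j =
      (ρ_ _).hom ≫ (biproduct.π G l ≫ biproduct.ι G l) ≫ (λ_ _).inv := by
  classical
  rw [Finset.sum_eq_single l]
  · rw [biproduct.ι_π_self, id_whiskerRight, Category.comp_id, (h l).coev_ev]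
    simp
  · intro j _ hj
    rw [biproduct.ι_π_ne _ hj]
    simp
  · simp

theorem sum_zigzag_right (h : ∀ j, IsDuality (coev j) (ev j)) (l : J) :
    ∑ j, 𝟙_ C ◁ biproduct.π F l ≫
      (coev j ▷ F l ≫ (α_ (F j) (G j) (F l)).hom ≫
        F j ◁ ((biproduct.ι G j ≫ biproduct.π G l) ▷ F l ≫ ev l)) ≫ biproduct.ι F j ▷ 𝟙_ C =
      (λ_ _).hom ≫ (biproduct.π F l ≫ biproduct.ι F l) ≫ (ρ_ _).inv := by
  classical
  rw [Finset.sum_eq_single l]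
  · rw [biproduct.ι_π_self, id_whiskerRight, Category.id_comp, (h l).ev_coev]
    simp
  · intro j _ hj
    rw [biproduct.ι_π_ne _ hj]
    simp
  · simp

theorem IsDuality.biproduct (h : ∀ j, IsDuality (coev j) (ev j)) :
    IsDuality (∑ j, coev j ≫ (biproduct.ι F j ⊗ₘ biproduct.ι G j))
      (∑ j, (biproduct.π G j ⊗ₘ biproduct.π F j) ≫ ev j) where
  coev_ev := by
    simp only [whiskerLeft_sum, sum_whiskerRight, Preadditive.sum_comp, Preadditive.comp_sum,
      whiskerLeft_tensorHom_zigzag, sum_zigzag_left h]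
    rw [← Preadditive.comp_sum, ← Preadditive.sum_comp, biproduct.total, Category.id_comp]
  ev_coev := by
    simp only [whiskerLeft_sum, sum_whiskerRight, Preadditive.sum_comp, Preadditive.comp_sum,
      tensorHom_whiskerRight_zigzag, sum_zigzag_right h]
    rw [← Preadditive.comp_sum, ← Preadditive.sum_comp, biproduct.total, Category.id_comp]

end Biproduct

theorem nonempty_hasRightDual_biproduct [Preadditive C] [MonoidalPreadditive C]
    [HasFiniteBiproducts C] {J : Type} [Finite J] (F : J → C) [∀ j, HasRightDual (F j)] :
    Nonempty (HasRightDual (⨁ F)) := by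
  have := Fintype.ofFinite J
  exact (IsDuality.biproduct fun j =>
    isDuality_exactPairing (F j) (F j)ᘁ).nonempty_hasRightDual

end Duality

/-! ### Perfect pairings and Frobenius structures -/

section Perfect
variable {C : Type*} [Category C] [MonoidalCategory C]

/-- Perfectness of a pairing in its first variable: a morphism `Y ⊗ B ⟶ W` factors uniquely through
`b : A ⊗ B ⟶ W`, so that `A` represents the internal hom from `B` to `W`. -/
def IsLeftPerfect {A B W : C} (b : A ⊗ B ⟶ W) : Prop :=
  ∀ Y : C, Function.Bijective fun g : Y ⟶ A => g ▷ B ≫ b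

theorem isLeftPerfect_of_preadditive [Preadditive C] [MonoidalPreadditive C] {A B W : C}
    {b : A ⊗ B ⟶ W} (eq_zero : ∀ {Y : C} (g : Y ⟶ A), g ▷ B ≫ b = 0 → g = 0)
    (exists_lift : ∀ {Y : C} (w : Y ⊗ B ⟶ W), ∃ g : Y ⟶ A, g ▷ B ≫ b = w) :
    IsLeftPerfect b := fun Y =>
  ⟨(injective_iff_map_eq_zero ((Preadditive.rightComp _ b).comp
    (tensorRight B).mapAddHom : (Y ⟶ A) →+ (Y ⊗ B ⟶ W))).2 eq_zero, exists_lift⟩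

theorem comp_frobeniusMap {A : C} [MonObj A] [HasRightDual A] {W Y : C} (n : A ⟶ W) (g : Y ⟶ A) :
    g ≫ frobeniusMap A n =
      tensorRightHomEquiv Y A Aᘁ W (g ▷ A ≫ MonObj.mul (X := A) ≫ n) := by
  change g ≫ (ρ_ _).inv ≫ _ ◁ _ ≫ (α_ _ _ _).inv ≫ (_ ≫ n) ▷ _ =
    (ρ_ _).inv ≫ _ ◁ _ ≫ (α_ _ _ _).inv ≫ (g ▷ _ ≫ _) ▷ _
  rw [rightUnitor_inv_naturality_assoc, ← whisker_exchange_assoc]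
  simp

theorem isFrobeniusStructure_of_isLeftPerfect {A : C} [MonObj A] [HasRightDual A] {W : C}
    {n : A ⟶ W} (h : IsLeftPerfect (MonObj.mul (X := A) ≫ n)) : IsFrobeniusStructure A W n := by
  refine isIso_of_yoneda_map_bijective _ fun Y => ?_
  simp only [comp_frobeniusMap]
  exact (Equiv.bijective _).comp (h Y)

end Perfect

/-! ### Truncated graded algebras -/

section TruncatedSum
variable {C : Type*} [Category C] [Preadditive C] [HasFiniteBiproducts C]

/-- The direct sum `F 0 ⊕ ⋯ ⊕ F N`. -/
def truncSum (F : ℕ → C) (N : ℕ) : C := ⨁ fun i : Fin (N + 1) => F i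

/-- The inclusion of a summand of `truncSum`. -/
def truncIncl (F : ℕ → C) {N i : ℕ} (h : i < N + 1) : F i ⟶ truncSum F N :=
  biproduct.ι (fun i : Fin (N + 1) => F i) ⟨i, h⟩

/-- The projection of `truncSum` to a summand. -/
def truncProj (F : ℕ → C) {N i : ℕ} (h : i < N + 1) : truncSum F N ⟶ F i :=
  biproduct.π (fun i : Fin (N + 1) => F i) ⟨i, h⟩

variable {F : ℕ → C} {N : ℕ}

theorem truncIncl_truncProj {i : ℕ} (h : i < N + 1) : truncIncl F h ≫ truncProj F h = 𝟙 (F i) :=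
  biproduct.ι_π_self _ _

theorem truncIncl_truncProj_ne {i j : ℕ} (hi : i < N + 1) (hj : j < N + 1) (h : i ≠ j) :
    truncIncl F hi ≫ truncProj F hj = 0 :=
  biproduct.ι_π_ne _ fun e => h (congrArg Fin.val e)

theorem sum_truncProj_truncIncl :
    ∑ i : Fin (N + 1), truncProj F i.isLt ≫ truncIncl F i.isLt = 𝟙 (truncSum F N) :=
  biproduct.total

theorem truncSum_hom_ext {Y : C} {f g : Y ⟶ truncSum F N}
    (h : ∀ (i : ℕ) (hi : i < N + 1), f ≫ truncProj F hi = g ≫ truncProj F hi) : f = g :=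
  biproduct.hom_ext _ _ fun i => h i i.isLt

theorem exists_truncSum_lift {Y : C} (g : ∀ i, i < N + 1 → (Y ⟶ F i)) :
    ∃ f : Y ⟶ truncSum F N, ∀ (i : ℕ) (hi : i < N + 1), f ≫ truncProj F hi = g i hi :=
  ⟨biproduct.lift fun i : Fin (N + 1) => g i i.isLt, fun _ _ => biproduct.lift_π _ _⟩

variable [MonoidalCategory C] [MonoidalPreadditive C]

theorem truncSum_tensor_ext {Y Z : C} {f g : truncSum F N ⊗ Y ⟶ Z}
    (h : ∀ (i : ℕ) (hi : i < N + 1), truncIncl F hi ▷ Y ≫ f = truncIncl F hi ▷ Y ≫ g) : f = g :=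
  rightDistributor_ext_left fun i => h i i.isLt

theorem tensor_truncSum_ext {Y Z : C} {f g : Y ⊗ truncSum F N ⟶ Z}
    (h : ∀ (i : ℕ) (hi : i < N + 1), Y ◁ truncIncl F hi ≫ f = Y ◁ truncIncl F hi ≫ g) : f = g :=
  leftDistributor_ext_left fun i => h i i.isLt

theorem truncSum_tensor_ext₃ {Z : C} {f g : (truncSum F N ⊗ truncSum F N) ⊗ truncSum F N ⟶ Z}
    (h : ∀ (i j l : ℕ) (hi : i < N + 1) (hj : j < N + 1) (hl : l < N + 1),
      ((truncIncl F hi ⊗ₘ truncIncl F hj) ⊗ₘ truncIncl F hl) ≫ f =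
        ((truncIncl F hi ⊗ₘ truncIncl F hj) ⊗ₘ truncIncl F hl) ≫ g) : f = g := by
  rw [← Category.id_comp f, ← Category.id_comp g, ← id_tensorHom_id, ← id_tensorHom_id,
    ← sum_truncProj_truncIncl]
  simp only [sum_tensor, tensor_sum, Preadditive.sum_comp, ← tensorHom_comp_tensorHom,
    Category.assoc, h _ _ _ (Fin.isLt _) (Fin.isLt _) (Fin.isLt _)]

end TruncatedSum

section GradedAlgebra
variable {C : Type*} [Category C] [MonoidalCategory C]

/-- The product `F i ⊗ F j ⟶ F (i + j)` of a graded multiplication `m` with values in `F n`, where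
`n = i + j` need only hold propositionally. -/
def gradedMul {F : ℕ → C} (m : ∀ i j, F i ⊗ F j ⟶ F (i + j)) (i j : ℕ) {n : ℕ} (h : i + j = n) :
    F i ⊗ F j ⟶ F n :=
  m i j ≫ eqToHom (congrArg F h)

/-- A unital graded multiplication on `F 0, F 1, …` that is associative in degrees up to `N`. -/
structure IsGradedAlgebra {F : ℕ → C} (N : ℕ) (u : 𝟙_ C ⟶ F 0)
    (m : ∀ i j, F i ⊗ F j ⟶ F (i + j)) : Prop where
  one_mul : ∀ j, u ▷ F j ≫ gradedMul m 0 j (zero_add j) = (λ_ (F j)).hom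
  mul_one : ∀ i, F i ◁ u ≫ gradedMul m i 0 (add_zero i) = (ρ_ (F i)).hom
  mul_assoc : ∀ (i j l : ℕ) {a b n : ℕ} (ha : i + j = a) (hb : j + l = b) (h : a + l = n)
    (h' : i + b = n), n ≤ N → gradedMul m i j ha ▷ F l ≫ gradedMul m a l h =
      (α_ _ _ _).hom ≫ F i ◁ gradedMul m j l hb ≫ gradedMul m i b h'

variable [Preadditive C] [HasFiniteBiproducts C]

/-- The multiplication on `F 0 ⊕ ⋯ ⊕ F N` with the products of degree greater than `N` set to
zero. -/
def truncMul {F : ℕ → C} (N : ℕ) (m : ∀ i j, F i ⊗ F j ⟶ F (i + j)) :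
    truncSum F N ⊗ truncSum F N ⟶ truncSum F N :=
  ∑ i : Fin (N + 1), ∑ j : Fin (N + 1), (truncProj F i.isLt ⊗ₘ truncProj F j.isLt) ≫
    if h : (i : ℕ) + j < N + 1 then m i j ≫ truncIncl F h else 0

variable [MonoidalPreadditive C] {F : ℕ → C} {N : ℕ} (m : ∀ i j, F i ⊗ F j ⟶ F (i + j))

theorem truncIncl_truncMul {i j : ℕ} (hi : i < N + 1) (hj : j < N + 1) :
    (truncIncl F hi ⊗ₘ truncIncl F hj) ≫ truncMul N m =
      if h : i + j < N + 1 then m i j ≫ truncIncl F h else 0 := by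
  simp only [truncMul, Preadditive.comp_sum, tensorHom_comp_tensorHom_assoc]
  rw [Finset.sum_eq_single ⟨i, hi⟩, Finset.sum_eq_single ⟨j, hj⟩]
  · simp [truncIncl_truncProj]
  · intro b _ hb
    rw [truncIncl_truncProj_ne hj _ fun e => hb (Fin.ext e.symm), MonoidalPreadditive.tensor_zero,
      zero_comp]
  · simp
  · intro b _ hb
    simp [truncIncl_truncProj_ne hi _ fun e => hb (Fin.ext e.symm), MonoidalPreadditive.zero_tensor]
  · simp

section
variable {i j l : ℕ} (hi : i < N + 1) (hj : j < N + 1) (hl : l < N + 1)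

theorem truncIncl_truncMul_of_eq {n : ℕ} (hn : n < N + 1) (h : i + j = n) :
    (truncIncl F hi ⊗ₘ truncIncl F hj) ≫ truncMul N m = gradedMul m i j h ≫ truncIncl F hn := by
  subst h
  rw [truncIncl_truncMul, dif_pos hn]
  simp [gradedMul]

theorem truncIncl_truncMul_of_lt (h : N < i + j) :
    (truncIncl F hi ⊗ₘ truncIncl F hj) ≫ truncMul N m = 0 := by
  rw [truncIncl_truncMul, dif_neg (by lia)]

theorem truncMul_truncMul_left_of_le {a : ℕ} (ha : i + j = a) (ha' : a < N + 1) :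
    ((truncIncl F hi ⊗ₘ truncIncl F hj) ≫ truncMul N m ⊗ₘ truncIncl F hl) ≫ truncMul N m =
      gradedMul m i j ha ▷ F l ≫ (truncIncl F ha' ⊗ₘ truncIncl F hl) ≫ truncMul N m := by
  rw [truncIncl_truncMul_of_eq m hi hj ha' ha, ← MonoidalCategory.tensorHom_id,
    tensorHom_comp_tensorHom_assoc, Category.id_comp]

theorem truncMul_truncMul_right_of_le {b : ℕ} (hb : j + l = b) (hb' : b < N + 1) :
    (truncIncl F hi ⊗ₘ (truncIncl F hj ⊗ₘ truncIncl F hl) ≫ truncMul N m) ≫ truncMul N m =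
      F i ◁ gradedMul m j l hb ≫ (truncIncl F hi ⊗ₘ truncIncl F hb') ≫ truncMul N m := by
  rw [truncIncl_truncMul_of_eq m hj hl hb' hb, ← MonoidalCategory.id_tensorHom,
    tensorHom_comp_tensorHom_assoc, Category.id_comp]

theorem truncMul_truncMul_left_of_lt (h : N < i + j + l) :
    ((truncIncl F hi ⊗ₘ truncIncl F hj) ≫ truncMul N m ⊗ₘ truncIncl F hl) ≫ truncMul N m = 0 := by
  by_cases hij : i + j < N + 1
  · rw [truncMul_truncMul_left_of_le m hi hj hl rfl hij, truncIncl_truncMul_of_lt m _ _ h,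
      comp_zero]
  · rw [truncIncl_truncMul_of_lt m _ _ (by lia), MonoidalPreadditive.zero_tensor, zero_comp]

theorem truncMul_truncMul_right_of_lt (h : N < i + (j + l)) :
    (truncIncl F hi ⊗ₘ (truncIncl F hj ⊗ₘ truncIncl F hl) ≫ truncMul N m) ≫ truncMul N m = 0 := by
  by_cases hjl : j + l < N + 1
  · rw [truncMul_truncMul_right_of_le m hi hj hl rfl hjl, truncIncl_truncMul_of_lt m _ _ h,
      comp_zero]
  · rw [truncIncl_truncMul_of_lt m _ _ (by lia), MonoidalPreadditive.tensor_zero, zero_comp]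

end

namespace IsGradedAlgebra
variable {m} {u : 𝟙_ C ⟶ F 0}

theorem truncMul_one_mul (H : IsGradedAlgebra N u m) :
    (u ≫ truncIncl F (Nat.succ_pos N)) ▷ truncSum F N ≫ truncMul N m = (λ_ _).hom := by
  refine tensor_truncSum_ext fun j hj => ?_
  rw [whisker_exchange_assoc, comp_whiskerRight_assoc, leftUnitor_naturality,
    ← H.one_mul j, Category.assoc,
    ← truncIncl_truncMul_of_eq m (Nat.succ_pos N) hj hj (zero_add _),
    MonoidalCategory.tensorHom_def, Category.assoc]

theorem truncMul_mul_one (H : IsGradedAlgebra N u m) :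
    truncSum F N ◁ (u ≫ truncIncl F (Nat.succ_pos N)) ≫ truncMul N m = (ρ_ _).hom := by
  refine truncSum_tensor_ext fun i hi => ?_
  rw [← whisker_exchange_assoc, MonoidalCategory.whiskerLeft_comp_assoc, rightUnitor_naturality,
    ← H.mul_one i, Category.assoc,
    ← truncIncl_truncMul_of_eq m hi (Nat.succ_pos N) hi (add_zero _),
    MonoidalCategory.tensorHom_def', Category.assoc]

theorem truncMul_assoc (H : IsGradedAlgebra N u m) :
    truncMul N m ▷ _ ≫ truncMul N m = (α_ _ _ _).hom ≫ _ ◁ truncMul N m ≫ truncMul N m := by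
  refine truncSum_tensor_ext₃ fun i j l hi hj hl => ?_
  rw [associator_naturality_assoc, ← MonoidalCategory.tensorHom_id, ← MonoidalCategory.id_tensorHom,
    tensorHom_comp_tensorHom_assoc, tensorHom_comp_tensorHom_assoc, Category.comp_id,
    Category.comp_id]
  by_cases h : i + j + l < N + 1
  · rw [truncMul_truncMul_left_of_le m hi hj hl rfl (by lia),
      truncMul_truncMul_right_of_le m hi hj hl rfl (by lia),
      truncIncl_truncMul_of_eq m _ hl h rfl, truncIncl_truncMul_of_eq m hi _ h (by lia),
      reassoc_of% (H.mul_assoc i j l rfl rfl rfl (by lia) (by lia))]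
  · rw [truncMul_truncMul_left_of_lt m hi hj hl (by lia),
      truncMul_truncMul_right_of_lt m hi hj hl (by lia), comp_zero]

/-- The algebra `F 0 ⊕ ⋯ ⊕ F N` obtained by truncating a graded algebra. -/
abbrev truncMonObj (H : IsGradedAlgebra N u m) : MonObj (truncSum F N) where
  one := u ≫ truncIncl F (Nat.succ_pos N)
  mul := truncMul N m
  one_mul := H.truncMul_one_mul
  mul_one := H.truncMul_mul_one
  mul_assoc := H.truncMul_assoc

end IsGradedAlgebra

theorem truncIncl_truncMul_truncProj {i j : ℕ} (hi : i < N + 1) (hj : j < N + 1) (h : i + j = N) :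
    truncSum F N ◁ truncIncl F hj ≫ truncMul N m ≫ truncProj F (Nat.lt_succ_self N) =
      truncProj F hi ▷ F j ≫ gradedMul m i j h := by
  refine truncSum_tensor_ext fun a ha => ?_
  rw [← tensorHom_def_assoc, ← Category.assoc, ← comp_whiskerRight_assoc]
  obtain rfl | hai := eq_or_ne a i
  · rw [truncIncl_truncProj, truncIncl_truncMul_of_eq m ha hj (Nat.lt_succ_self N) h,
      Category.assoc, truncIncl_truncProj]
    simp
  · rw [truncIncl_truncProj_ne ha hi hai, MonoidalPreadditive.zero_whiskerRight, zero_comp]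
    obtain haj | haj := lt_or_ge N (a + j)
    · rw [truncIncl_truncMul_of_lt m ha hj haj, zero_comp]
    · rw [truncIncl_truncMul_of_eq m ha hj (Nat.lt_succ_of_le haj) rfl, Category.assoc,
        truncIncl_truncProj_ne _ _ (by lia), comp_zero]

theorem truncIncl_comp_truncMul_truncProj {Y : C} (g : Y ⟶ truncSum F N) {i j : ℕ}
    (hi : i < N + 1) (hj : j < N + 1) (h : i + j = N) :
    Y ◁ truncIncl F hj ≫ g ▷ truncSum F N ≫ truncMul N m ≫ truncProj F (Nat.lt_succ_self N) =
      (g ≫ truncProj F hi) ▷ F j ≫ gradedMul m i j h := by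
  rw [whisker_exchange_assoc, truncIncl_truncMul_truncProj m hi hj h, comp_whiskerRight_assoc]

theorem isLeftPerfect_truncMul_truncProj {m : ∀ i j, F i ⊗ F j ⟶ F (i + j)}
    (hm : ∀ i j (h : i + j = N), IsLeftPerfect (gradedMul m i j h)) :
    IsLeftPerfect (truncMul N m ≫ truncProj F (Nat.lt_succ_self N)) := by
  refine fun Y => ⟨fun g g' hgg' => truncSum_hom_ext fun i hi => ?_, fun w => ?_⟩
  · have component := congrArg (Y ◁ truncIncl F (N := N) (i := N - i) (by lia) ≫ ·) hgg'
    simp only [truncIncl_comp_truncMul_truncProj m _ hi _ (Nat.add_sub_cancel' (by lia))]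
      at component
    exact (hm i (N - i) (by lia) Y).1 component
  · have lift (i : ℕ) (hi : i < N + 1) : ∃ g : Y ⟶ F i, ∀ (j : ℕ) (hj : j < N + 1)
        (h : i + j = N), g ▷ F j ≫ gradedMul m i j h = Y ◁ truncIncl F hj ≫ w := by
      obtain ⟨g, hg⟩ := (hm i (N - i) (by lia) Y).2 (Y ◁ truncIncl F (by lia) ≫ w)
      refine ⟨g, fun j hj h => ?_⟩
      obtain rfl : j = N - i := by lia
      exact hg
    choose g hg using lift
    obtain ⟨f, hf⟩ := exists_truncSum_lift g
    refine ⟨f, tensor_truncSum_ext fun j hj => ?_⟩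
    rw [truncIncl_comp_truncMul_truncProj m f (i := N - j) (by lia) hj (by lia), hf]
    exact hg _ _ _ _ _

theorem IsGradedAlgebra.isFrobeniusStructure_truncProj {m : ∀ i j, F i ⊗ F j ⟶ F (i + j)}
    {u : 𝟙_ C ⟶ F 0} (H : IsGradedAlgebra N u m)
    (hm : ∀ i j (h : i + j = N), IsLeftPerfect (gradedMul m i j h))
    [HasRightDual (truncSum F N)] :
    letI := H.truncMonObj
    IsFrobeniusStructure (truncSum F N) (F N) (truncProj F (Nat.lt_succ_self N)) :=
  letI := H.truncMonObj
  isFrobeniusStructure_of_isLeftPerfect (isLeftPerfect_truncMul_truncProj hm)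

end GradedAlgebra

/-! ### Linear and monoidal structure of the completions -/

section LinearCompletions
open CategoryTheory.Idempotents

variable {R : Type*} [CommRing R] {C : Type*} [Category C] [Preadditive C] [Linear R C]

instance matLinear : Linear R (Mat_ C) where
  homModule M N :=
    { smul := fun r f i j => r • f i j
      one_smul := fun f => Mat_.hom_ext _ _ fun i j => one_smul R (f i j)
      mul_smul := fun r s f => Mat_.hom_ext _ _ fun i j => mul_smul r s (f i j)
      smul_zero := fun r => Mat_.hom_ext _ _ fun i j => smul_zero r
      smul_add := fun r f g => Mat_.hom_ext _ _ fun i j => smul_add r (f i j) (g i j)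
      add_smul := fun r s f => Mat_.hom_ext _ _ fun i j => add_smul r s (f i j)
      zero_smul := fun f => Mat_.hom_ext _ _ fun i j => zero_smul R (f i j) }
  smul_comp M N K r f g := Mat_.hom_ext _ _ fun i j => by
    rw [Mat_.comp_apply]
    change ∑ l, (r • f i l) ≫ g l j = r • (f ≫ g) i j
    simp only [Mat_.comp_apply, Finset.smul_sum, Linear.smul_comp]
  comp_smul M N K f r g := Mat_.hom_ext _ _ fun i j => by
    rw [Mat_.comp_apply]
    change ∑ l, f i l ≫ (r • g l j) = r • (f ≫ g) i j
    simp only [Mat_.comp_apply, Finset.smul_sum, Linear.comp_smul]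

instance matEmbedding_linear : (Mat_.embedding C).Linear R where
  map_smul _ _ := rfl

instance karoubiLinear : Linear R (Karoubi C) where
  homModule P Q :=
    { smul := fun r f => ⟨r • f.f, by
        rw [Linear.smul_comp, Linear.comp_smul]; exact congrArg (r • ·) f.comm⟩
      one_smul := fun f => Karoubi.hom_ext _ _ (one_smul R f.f)
      mul_smul := fun r s f => Karoubi.hom_ext _ _ (mul_smul r s f.f)
      smul_zero := fun r => Karoubi.hom_ext _ _ (smul_zero r)
      smul_add := fun r f g => Karoubi.hom_ext _ _ (smul_add r f.f g.f)
      add_smul := fun r s f => Karoubi.hom_ext _ _ (add_smul r s f.f)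
      zero_smul := fun f => Karoubi.hom_ext _ _ (zero_smul R f.f) }
  smul_comp P Q T r f g := Karoubi.hom_ext _ _ (Linear.smul_comp _ _ _ r f.f g.f)
  comp_smul P Q T f r g := Karoubi.hom_ext _ _ (Linear.comp_smul _ _ _ f.f r g.f)

instance toKaroubi_linear : (toKaroubi C).Linear R where
  map_smul _ _ := rfl

instance toIdealQuotient_linear [MonoidalCategory C] (S : ∀ ⦃X Y : C⦄, (X ⟶ Y) → Prop) :
    (toIdealQuotient S).Linear R where
  map_smul _ _ := rfl

variable [MonoidalCategory C] [MonoidalPreadditive C] [MonoidalLinear R C]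

theorem smul_tensorHom {A B A' B' : C} (r : R) (f : A ⟶ B) (g : A' ⟶ B') :
    (r • f) ⊗ₘ g = r • (f ⊗ₘ g) := by
  rw [MonoidalCategory.tensorHom_def, MonoidalCategory.tensorHom_def,
    MonoidalLinear.smul_whiskerRight, Linear.smul_comp]

theorem tensorHom_smul {A B A' B' : C} (r : R) (f : A ⟶ B) (g : A' ⟶ B') :
    f ⊗ₘ (r • g) = r • (f ⊗ₘ g) := by
  rw [MonoidalCategory.tensorHom_def, MonoidalCategory.tensorHom_def,
    MonoidalLinear.whiskerLeft_smul, Linear.comp_smul]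

instance mat_monoidalLinear : MonoidalLinear R (Mat_ C) where
  whiskerLeft_smul _ _ _ r _ := Mat_.hom_ext _ _ fun _ _ => tensorHom_smul r _ _
  smul_whiskerRight r _ _ _ _ := Mat_.hom_ext _ _ fun _ _ => smul_tensorHom r _ _

instance karoubi_monoidalLinear : MonoidalLinear R (Karoubi C) where
  whiskerLeft_smul _ _ _ r f := Karoubi.hom_ext _ _ (tensorHom_smul r _ f.f)
  smul_whiskerRight r _ _ f _ := Karoubi.hom_ext _ _ (smul_tensorHom r f.f _)

end LinearCompletions

section MonoidalFunctors
open CategoryTheory.Idempotents MatMonoidal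

variable {C : Type*} [Category C] [MonoidalCategory C]

instance toKaroubi_monoidal : (toKaroubi C).Monoidal :=
  Functor.CoreMonoidal.toMonoidal
    { εIso := Iso.refl _
      μIso := fun X Y => karoubiIso (P := (toKaroubi C).obj X ⊗ (toKaroubi C).obj Y)
        (Q := (toKaroubi C).obj (X ⊗ Y)) (Iso.refl (X ⊗ Y))
        ((Category.comp_id _).trans ((id_tensorHom_id X Y).trans (Category.comp_id _).symm))
      μIso_hom_natural_left := fun f X' => Karoubi.hom_ext _ _ (by
        change (f ⊗ₘ 𝟙 X') ≫ (𝟙 _ ⊗ₘ 𝟙 _) ≫ 𝟙 _ = ((𝟙 _ ⊗ₘ 𝟙 _) ≫ 𝟙 _) ≫ f ▷ X'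
        simp)
      μIso_hom_natural_right := fun X' f => Karoubi.hom_ext _ _ (by
        change (𝟙 X' ⊗ₘ f) ≫ (𝟙 _ ⊗ₘ 𝟙 _) ≫ 𝟙 _ = ((𝟙 _ ⊗ₘ 𝟙 _) ≫ 𝟙 _) ≫ X' ◁ f
        simp)
      associativity := fun X Y Z => Karoubi.hom_ext _ _ (by
        change (((𝟙 X ⊗ₘ 𝟙 Y) ≫ 𝟙 _) ⊗ₘ 𝟙 Z) ≫ ((𝟙 _ ⊗ₘ 𝟙 _) ≫ 𝟙 _) ≫ (α_ X Y Z).hom =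
          (((𝟙 _ ⊗ₘ 𝟙 _) ⊗ₘ 𝟙 _) ≫ (α_ X Y Z).hom) ≫ (𝟙 _ ⊗ₘ ((𝟙 _ ⊗ₘ 𝟙 _) ≫ 𝟙 _)) ≫
            (𝟙 _ ⊗ₘ 𝟙 _) ≫ 𝟙 _
        simp)
      left_unitality := fun X => Karoubi.hom_ext _ _ (by
        change (𝟙 _ ⊗ₘ 𝟙 _) ≫ (λ_ X).hom = (𝟙 _ ⊗ₘ 𝟙 _) ≫ ((𝟙 _ ⊗ₘ 𝟙 _) ≫ 𝟙 _) ≫ (λ_ X).hom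
        simp)
      right_unitality := fun X => Karoubi.hom_ext _ _ (by
        change (𝟙 _ ⊗ₘ 𝟙 _) ≫ (ρ_ X).hom = (𝟙 _ ⊗ₘ 𝟙 _) ≫ ((𝟙 _ ⊗ₘ 𝟙 _) ≫ 𝟙 _) ≫ (ρ_ X).hom
        simp) }

variable [Preadditive C]

theorem matEmbedding_isMonomial {C : Type*} [Category C] [Preadditive C] {X Y : C} (f : X ⟶ Y) :
    IsMonomial ((Mat_.embedding C).map f) (fun _ => PUnit.unit) (fun _ => f) :=
  ⟨fun _ => rfl, fun _ _ h => (h rfl).elim⟩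

/-- The canonical isomorphism between the tensor product of two one-by-one matrix objects and the
one-by-one matrix object on the tensor product. -/
def matEmbeddingMul (X Y : C) : (Mat_.embedding C).obj X ⊗ (Mat_.embedding C).obj Y ≅
    (Mat_.embedding C).obj (X ⊗ Y) :=
  monoIso (Equiv.prodPUnit PUnit) fun _ => Iso.refl (X ⊗ Y)

theorem matEmbeddingMul_isMonomial (X Y : C) :
    IsMonomial (matEmbeddingMul X Y).hom (fun _ => PUnit.unit) (fun _ => 𝟙 (X ⊗ Y)) :=
  monoHom_isMonomial _ _

variable [MonoidalPreadditive C]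

instance toIdealQuotient_monoidal (S : ∀ ⦃X Y : C⦄, (X ⟶ Y) → Prop) :
    (toIdealQuotient S).Monoidal :=
  let Q := toIdealQuotient S
  Functor.CoreMonoidal.toMonoidal
    { εIso := Iso.refl _
      μIso := fun X Y => Iso.refl _
      μIso_hom_natural_left := fun f X' => (Category.comp_id _).trans (Category.id_comp _).symm
      μIso_hom_natural_right := fun X' f => (Category.comp_id _).trans (Category.id_comp _).symm
      associativity := fun X Y Z => by
        change 𝟙 (Q.obj X ⊗ Q.obj Y) ▷ Q.obj Z ≫ 𝟙 _ ≫ (α_ _ _ _).hom =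
          (α_ _ _ _).hom ≫ Q.obj X ◁ 𝟙 (Q.obj Y ⊗ Q.obj Z) ≫ 𝟙 _
        simp
      left_unitality := fun X => by
        change (λ_ _).hom = 𝟙 (𝟙_ (IdealQuotient S)) ▷ Q.obj X ≫ 𝟙 _ ≫ (λ_ _).hom
        simp
      right_unitality := fun X => by
        change (ρ_ _).hom = Q.obj X ◁ 𝟙 (𝟙_ (IdealQuotient S)) ≫ 𝟙 _ ≫ (ρ_ _).hom
        simp }

instance matEmbedding_monoidal : (Mat_.embedding C).Monoidal :=
  Functor.CoreMonoidal.toMonoidal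
    { εIso := Iso.refl _
      μIso := matEmbeddingMul
      μIso_hom_natural_left := fun {X Y} f X' =>
        (((matEmbedding_isMonomial f).tensor (.id ((Mat_.embedding C).obj X'))).comp
          (matEmbeddingMul_isMonomial Y X')).ext
          ((matEmbeddingMul_isMonomial X X').comp (matEmbedding_isMonomial (f ▷ X')))
          fun _ => (by simp : (f ⊗ₘ 𝟙 X') ≫ 𝟙 _ = 𝟙 _ ≫ f ▷ X')
      μIso_hom_natural_right := fun {X Y} X' f =>
        (((IsMonomial.id ((Mat_.embedding C).obj X')).tensor (matEmbedding_isMonomial f)).comp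
          (matEmbeddingMul_isMonomial X' Y)).ext
          ((matEmbeddingMul_isMonomial X' X).comp (matEmbedding_isMonomial (X' ◁ f)))
          fun _ => (by simp : (𝟙 X' ⊗ₘ f) ≫ 𝟙 _ = 𝟙 _ ≫ X' ◁ f)
      associativity := fun X Y Z =>
        (((matEmbeddingMul_isMonomial X Y).tensor (.id ((Mat_.embedding C).obj Z))).comp
          ((matEmbeddingMul_isMonomial (X ⊗ Y) Z).comp
            (matEmbedding_isMonomial (α_ X Y Z).hom))).ext
          ((assoc_mono ((Mat_.embedding C).obj X) ((Mat_.embedding C).obj Y)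
            ((Mat_.embedding C).obj Z)).comp
            (((IsMonomial.id ((Mat_.embedding C).obj X)).tensor
              (matEmbeddingMul_isMonomial Y Z)).comp (matEmbeddingMul_isMonomial X (Y ⊗ Z))))
          fun _ => (by simp : (𝟙 (X ⊗ Y) ⊗ₘ 𝟙 Z) ≫ 𝟙 _ ≫ (α_ X Y Z).hom =
            (α_ X Y Z).hom ≫ (𝟙 X ⊗ₘ 𝟙 (Y ⊗ Z)) ≫ 𝟙 _)
      left_unitality := fun X =>
        (left_mono ((Mat_.embedding C).obj X)).ext
          (((IsMonomial.id (𝟙_ (Mat_ C))).tensor (.id ((Mat_.embedding C).obj X))).comp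
            ((matEmbeddingMul_isMonomial (𝟙_ C) X).comp (matEmbedding_isMonomial (λ_ X).hom)))
          fun _ => (by simp : (λ_ X).hom = (𝟙 (𝟙_ C) ⊗ₘ 𝟙 X) ≫ 𝟙 _ ≫ (λ_ X).hom)
      right_unitality := fun X =>
        (right_mono ((Mat_.embedding C).obj X)).ext
          (((IsMonomial.id ((Mat_.embedding C).obj X)).tensor (.id (𝟙_ (Mat_ C)))).comp
            ((matEmbeddingMul_isMonomial X (𝟙_ C)).comp (matEmbedding_isMonomial (ρ_ X).hom)))
          fun _ => (by simp : (ρ_ X).hom = (𝟙 X ⊗ₘ 𝟙 (𝟙_ C)) ≫ 𝟙 _ ≫ (ρ_ X).hom) }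

end MonoidalFunctors

/-! ### Strands, cups and caps -/

section TensorPowers
variable {C : Type*} [Category C] [MonoidalCategory C] {X : C}

/-- A multiplication `A ⊗ B ⟶ N` extended by one strand on the right. -/
def extendMul (X : C) {A B N : C} (s : A ⊗ B ⟶ N) : A ⊗ (B ⊗ X) ⟶ N ⊗ X :=
  (α_ A B X).inv ≫ s ▷ X

theorem whiskerRight_extendMul {A A' B N : C} (f : A ⟶ A') (m : A' ⊗ B ⟶ N) :
    f ▷ (B ⊗ X) ≫ extendMul X m = extendMul X (f ▷ B ≫ m) := by
  simp [extendMul]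

theorem whiskerLeft_extendMul {A B B' N : C} (f : B ⟶ B') (m : A ⊗ B' ⟶ N) :
    A ◁ (f ▷ X) ≫ extendMul X m = extendMul X (A ◁ f ≫ m) := by
  simp [extendMul]

theorem extendMul_comp {A B N N' : C} (m : A ⊗ B ⟶ N) (g : N ⟶ N') :
    extendMul X m ≫ g ▷ X = extendMul X (m ≫ g) := by
  simp [extendMul]

theorem extendMul_leftUnitor (A : C) : extendMul X (λ_ A).hom = (λ_ (A ⊗ X)).hom := by
  simp [extendMul]

theorem extendMul_rightUnitor (A : C) :
    (α_ A X (𝟙_ C)).hom ≫ A ◁ ((ρ_ X).hom ≫ (λ_ X).inv) ≫ extendMul X (ρ_ A).hom =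
      (ρ_ (A ⊗ X)).hom := by
  simp only [extendMul]
  monoidal

theorem extendMul_cons {A B B' N : C} (s : X ⊗ B ⟶ B') (m : A ⊗ B' ⟶ N) :
    extendMul X ((α_ A X B).hom ≫ A ◁ s ≫ m) =
      (α_ A X (B ⊗ X)).hom ≫ A ◁ extendMul X s ≫ extendMul X m := by
  simp only [extendMul]
  monoidal

theorem extendMul_assoc {A B L M P N : C} {ab : A ⊗ B ⟶ M} {ml : M ⊗ L ⟶ N} {bl : B ⊗ L ⟶ P}
    {ap : A ⊗ P ⟶ N} (h : ab ▷ L ≫ ml = (α_ A B L).hom ≫ A ◁ bl ≫ ap) :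
    ab ▷ (L ⊗ X) ≫ extendMul X ml =
      (α_ A B (L ⊗ X)).hom ≫ A ◁ extendMul X bl ≫ extendMul X ap := by
  rw [whiskerRight_extendMul, h]
  simp only [extendMul]
  monoidal

theorem whiskerRight_cons {Y A B B' N : C} (g : Y ⟶ A) (s : X ⊗ B ⟶ B') (m : A ⊗ B' ⟶ N) :
    g ▷ X ▷ B ≫ (α_ A X B).hom ≫ A ◁ s ≫ m = (α_ Y X B).hom ≫ Y ◁ s ≫ g ▷ B' ≫ m := by
  rw [whisker_exchange_assoc]
  simp

variable (X)

/-- The isomorphism `X ⊗ X^j ≅ X^{j+1}`; as tensor powers are bracketed to the left, it is not an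
equality. -/
def tpowCons : ∀ j : ℕ, X ⊗ tpow X j ≅ tpow X (j + 1)
  | 0 => ρ_ X ≪≫ (λ_ X).symm
  | j + 1 => (α_ X (tpow X j) X).symm ≪≫ whiskerRightIso (tpowCons j) X

/-- The canonical morphism `X^i ⊗ X^j ⟶ X^n`, where `n = i + j` need only hold
propositionally. -/
def tpowMul (i j : ℕ) {n : ℕ} (h : i + j = n) : tpow X i ⊗ tpow X j ⟶ tpow X n :=
  (tpowAdd X i j).hom ≫ eqToHom (congrArg (tpow X) h)

theorem tpowMul_rfl (i j : ℕ) : tpowMul X i j rfl = (tpowAdd X i j).hom := Category.comp_id _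

theorem tpowMul_zero_right (i : ℕ) : tpowMul X i 0 (n := i) rfl = (ρ_ (tpow X i)).hom :=
  tpowMul_rfl X i 0

theorem tpowMul_succ_right (i j : ℕ) {n : ℕ} (h : i + j = n) :
    tpowMul X i (j + 1) (n := n + 1) (congrArg (· + 1) h) = extendMul X (tpowMul X i j h) := by
  subst h
  rw [tpowMul_rfl X i j]
  exact tpowMul_rfl X i (j + 1)

theorem tpowMul_zero_left (j : ℕ) : tpowMul X 0 j (zero_add j) = (λ_ (tpow X j)).hom := by
  induction j with
  | zero => exact (tpowMul_zero_right X 0).trans (unitors_equal (C := C)).symm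
  | succ j ih =>
    refine (tpowMul_succ_right X 0 j (zero_add j)).trans ?_
    rw [ih]
    exact extendMul_leftUnitor _

theorem tpowMul_succ_left (i j : ℕ) {n : ℕ} (h : i + 1 + j = n) (h' : i + (j + 1) = n) :
    tpowMul X (i + 1) j h = (α_ (tpow X i) X (tpow X j)).hom ≫ tpow X i ◁ (tpowCons X j).hom ≫
      tpowMul X i (j + 1) h' := by
  induction j generalizing n with
  | zero =>
    subst h
    rw [tpowMul_zero_right, tpowMul_succ_right X i 0 rfl, tpowMul_zero_right]
    exact (extendMul_rightUnitor _).symm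
  | succ j ih =>
    obtain _ | n := n
    · lia
    refine (tpowMul_succ_right X (i + 1) j (n := n) (by lia)).trans ?_
    rw [ih (by lia) (by lia), tpowMul_succ_right X i (j + 1) (n := n) (by lia)]
    exact extendMul_cons _ _

theorem whiskerRight_tpowMul_succ_left {i j n : ℕ} (h : i + 1 + j = n) (h' : i + (j + 1) = n)
    {Z W : C} (v : Z ⟶ tpow X i) (f : tpow X n ⟶ W) :
    v ▷ X ▷ tpow X j ≫ (tpowMul X (i + 1) j h : (tpow X i ⊗ X) ⊗ tpow X j ⟶ _) ≫ f =
      (α_ Z X (tpow X j)).hom ≫ Z ◁ (tpowCons X j).hom ≫ v ▷ tpow X (j + 1) ≫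
        tpowMul X i (j + 1) h' ≫ f := by
  rw [tpowMul_succ_left X i j h h']
  simp only [Category.assoc]
  rw [whiskerRight_cons]

theorem whiskerRight_rightUnitor {A B M : C} (f : A ⊗ B ⟶ M) :
    f ▷ 𝟙_ C ≫ (ρ_ M).hom = (α_ A B (𝟙_ C)).hom ≫ A ◁ (ρ_ B).hom ≫ f := by
  simp

theorem tpowMul_assoc (i j l : ℕ) {m p n : ℕ} (hm : i + j = m) (hp : j + l = p) (h : m + l = n)
    (h' : i + p = n) :
    tpowMul X i j hm ▷ tpow X l ≫ tpowMul X m l h =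
      (α_ _ _ _).hom ≫ tpow X i ◁ tpowMul X j l hp ≫ tpowMul X i p h' := by
  induction l generalizing p n with
  | zero =>
    obtain rfl : j = p := hp
    obtain rfl : m = n := h
    rw [tpowMul_zero_right, tpowMul_zero_right]
    exact whiskerRight_rightUnitor _
  | succ l ih =>
    obtain _ | n := n
    · lia
    obtain _ | p := p
    · lia
    rw [tpowMul_succ_right X m l (n := n) (by lia), tpowMul_succ_right X j l (n := p) (by lia),
      tpowMul_succ_right X i p (n := n) (by lia)]
    exact extendMul_assoc (ih _ _ _)

end TensorPowers

section CupsAndCaps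
variable {C : Type*} [Category C] [MonoidalCategory C] {X : C} (cup : 𝟙_ C ⟶ X ⊗ X)
  (cap : X ⊗ X ⟶ 𝟙_ C)

/-- The cup to the right of an object `T`. -/
def cupAt (T : C) : T ⟶ (T ⊗ X) ⊗ X :=
  (ρ_ T).inv ≫ T ◁ cup ≫ (α_ T X X).inv

/-- The cap to the right of an object `T`. -/
def capAt (T : C) : (T ⊗ X) ⊗ X ⟶ T :=
  (α_ T X X).hom ≫ T ◁ cap ≫ (ρ_ T).hom

/-- The partial trace over the last strand. -/
def partialTrace {S T : C} (g : S ⊗ X ⟶ T ⊗ X) : S ⟶ T :=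
  cupAt cup S ≫ g ▷ X ≫ capAt cap T

theorem cupAt_naturality {S T : C} (g : S ⟶ T) :
    g ≫ cupAt cup T = cupAt cup S ≫ g ▷ X ▷ X := by
  simp only [cupAt, Category.assoc, rightUnitor_inv_naturality_assoc, ← whisker_exchange_assoc,
    associator_inv_naturality_left]

theorem capAt_naturality {S T : C} (g : S ⟶ T) :
    g ▷ X ▷ X ≫ capAt cap T = capAt cap S ≫ g := by
  simp only [capAt, Category.assoc, ← rightUnitor_naturality, whisker_exchange_assoc,
    associator_naturality_left_assoc]

theorem capCup_eq (T : C) : capCup cup cap T = capAt cap T ≫ cupAt cup T := by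
  simp [capCup, capAt, cupAt]

theorem whiskerLeft_cupAt {A B N : C} (m : A ⊗ B ⟶ N) :
    A ◁ cupAt cup B ≫ extendMul X (extendMul X m) = m ≫ cupAt cup N := by
  rw [cupAt_naturality]
  simp only [cupAt, extendMul]
  monoidal

theorem whiskerLeft_capAt {A B N : C} (m : A ⊗ B ⟶ N) :
    extendMul X (extendMul X m) ≫ capAt cap N = A ◁ capAt cap B ≫ m := by
  simp only [extendMul, comp_whiskerRight, Category.assoc, capAt_naturality]
  simp only [capAt]
  monoidal

theorem whiskerLeft_capCup {A B N : C} (m : A ⊗ B ⟶ N) :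
    A ◁ capCup cup cap B ≫ extendMul X (extendMul X m) =
      extendMul X (extendMul X m) ≫ capCup cup cap N := by
  rw [capCup_eq, capCup_eq, reassoc_of% whiskerLeft_capAt, MonoidalCategory.whiskerLeft_comp,
    Category.assoc, whiskerLeft_cupAt]

theorem cup_cons_cons {B B' B'' : C} (s : X ⊗ B ⟶ B') (s' : X ⊗ B' ⟶ B'') :
    cup ▷ (B ⊗ X) ≫ (α_ X X (B ⊗ X)).hom ≫ X ◁ extendMul X s ≫ extendMul X s' =
      (α_ (𝟙_ C) B X).inv ≫ (cup ▷ B ≫ (α_ X X B).hom ≫ X ◁ s ≫ s') ▷ X := by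
  simp only [extendMul]
  monoidal

theorem partialTrace_whiskerRight_comp {S S' T : C} (v : S' ⟶ S) (g : S ⊗ X ⟶ T ⊗ X) :
    partialTrace cup cap (v ▷ X ≫ g) = v ≫ partialTrace cup cap g := by
  simp only [partialTrace, comp_whiskerRight, Category.assoc, ← reassoc_of% cupAt_naturality]

theorem partialTrace_comp_whiskerRight {S T T' : C} (g : S ⊗ X ⟶ T ⊗ X) (v : T ⟶ T') :
    partialTrace cup cap (g ≫ v ▷ X) = partialTrace cup cap g ≫ v := by
  simp only [partialTrace, comp_whiskerRight, Category.assoc, capAt_naturality]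

variable {cup cap}

namespace IsDuality

theorem cupAt_capAt_right (h : IsDuality cup cap) (T : C) :
    cupAt cup T ▷ X ≫ capAt cap (T ⊗ X) = 𝟙 _ := by
  calc _ = (ρ_ T).inv ▷ X ≫ (α_ T (𝟙_ C) X).hom ≫ T ◁ (cup ▷ X ≫ (α_ X X X).hom ≫ X ◁ cap) ≫
          (α_ T X (𝟙_ C)).inv ≫ (ρ_ (T ⊗ X)).hom := by simp only [cupAt, capAt]; monoidal
      _ = _ := by rw [h.ev_coev]; monoidal

theorem cupAt_capAt_left (h : IsDuality cup cap) (T : C) :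
    cupAt cup (T ⊗ X) ≫ capAt cap T ▷ X = 𝟙 _ := by
  calc _ = (ρ_ (T ⊗ X)).inv ≫ (α_ T X (𝟙_ C)).hom ≫ T ◁ (X ◁ cup ≫ (α_ X X X).inv ≫ cap ▷ X) ≫
          (α_ T (𝟙_ C) X).inv ≫ (ρ_ T).hom ▷ X := by simp only [cupAt, capAt]; monoidal
      _ = _ := by rw [h.coev_ev]; monoidal

theorem partialTrace_capCup (h : IsDuality cup cap) (T : C) :
    partialTrace cup cap (capCup cup cap T) = 𝟙 (T ⊗ X) := by
  rw [partialTrace, capCup_eq, comp_whiskerRight_assoc, reassoc_of% h.cupAt_capAt_left T,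
    h.cupAt_capAt_right]

theorem mate_capAt (h : IsDuality cup cap) {Y T : C} (g : Y ⊗ X ⟶ T) :
    (cupAt cup Y ≫ g ▷ X) ▷ X ≫ capAt cap T = g := by
  rw [comp_whiskerRight_assoc, capAt_naturality, reassoc_of% h.cupAt_capAt_right Y]

end IsDuality

section Linear
variable {R : Type*} [CommRing R] [Preadditive C] [Linear R C] [MonoidalPreadditive C]
  [MonoidalLinear R C]

theorem partialTrace_id {δ : R} (loop : cup ≫ cap = δ • 𝟙 (𝟙_ C)) (T : C) :
    partialTrace cup cap (𝟙 (T ⊗ X)) = δ • 𝟙 T := by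
  simp only [partialTrace, cupAt, capAt, id_whiskerRight, Category.id_comp, Category.assoc,
    Iso.inv_hom_id_assoc]
  rw [← MonoidalCategory.whiskerLeft_comp_assoc, loop]
  simp [MonoidalLinear.whiskerLeft_smul]

theorem partialTrace_add_smul {S T : C} (g g' : S ⊗ X ⟶ T ⊗ X) (c : R) :
    partialTrace cup cap (g + c • g') = partialTrace cup cap g + c • partialTrace cup cap g' := by
  simp only [partialTrace, MonoidalPreadditive.add_whiskerRight, MonoidalLinear.smul_whiskerRight,
    Preadditive.add_comp, Preadditive.comp_add, Linear.smul_comp, Linear.comp_smul]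

end Linear

theorem eq_zero_of_whiskerRight_comp {K : Type*} [Field K] [Preadditive C] [Linear K C]
    [MonoidalPreadditive C] {Y T : C} {e : T ⟶ T} {f : T ⊗ X ⟶ T ⊗ X} {d : K}
    (hf : partialTrace cup cap f = d • e) (hd : d ≠ 0) {g : Y ⟶ T} (hg : g ≫ e = g)
    (h : g ▷ X ≫ f = 0) : g = 0 := by
  have hdg : d • g = 0 := by
    rw [← hg, ← Linear.comp_smul, ← hf, ← partialTrace_whiskerRight_comp, h]
    simp [partialTrace]
  exact (smul_eq_zero.mp hdg).resolve_left hd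

end CupsAndCaps

/-! ### The Jones–Wenzl recursion -/

section JonesWenzlStep
variable {C : Type*} [Category C] [MonoidalCategory C] [Preadditive C] [Linear ℂ C] {X : C}
  {cup : 𝟙_ C ⟶ X ⊗ X} {cap : X ⊗ X ⟶ 𝟙_ C} {T : C} {f : T ⊗ X ⟶ T ⊗ X} {c : ℂ}

theorem whiskerRight_jwStep (hf : f ≫ f = f) (c : ℂ) :
    f ▷ X ≫ jwStep cup cap T f c = jwStep cup cap T f c := by
  have idem : f ▷ X ≫ f ▷ X = f ▷ X := by rw [← comp_whiskerRight, hf]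
  rw [jwStep, Preadditive.comp_add, Linear.comp_smul, reassoc_of% idem, idem]

theorem mate_jwStep {Y : C} {g : Y ⊗ X ⟶ T ⊗ X} (hg : g ≫ f = g) :
    cupAt cup Y ≫ g ▷ X ≫ jwStep cup cap T f c =
      cupAt cup Y ≫ g ▷ X + c • (partialTrace cup cap g ≫ cupAt cup T ≫ f ▷ X) := by
  have absorb : g ▷ X ≫ f ▷ X = g ▷ X := by rw [← comp_whiskerRight, hg]
  simp only [jwStep, capCup_eq, partialTrace, Preadditive.comp_add, Linear.comp_smul,
    Category.assoc, reassoc_of% absorb, absorb]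

theorem cupAt_jwStep (hf : f ≫ f = f) {e : T ⟶ T} {d : ℂ} (he : e ▷ X ≫ f = f)
    (hd : partialTrace cup cap f = d • e) (hcd : c * d = -1) :
    cupAt cup T ≫ jwStep cup cap T f c = 0 := by
  have absorb : e ≫ cupAt cup T ≫ f ▷ X = cupAt cup T ≫ f ▷ X := by
    rw [reassoc_of% cupAt_naturality, ← comp_whiskerRight, he]
  rw [← whiskerRight_jwStep hf, mate_jwStep hf, hd, Linear.smul_comp, absorb, smul_smul, hcd,
    neg_one_smul, add_neg_cancel]

variable [MonoidalPreadditive C] [MonoidalLinear ℂ C]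

theorem partialTrace_jwStep (dual : IsDuality cup cap) {δ : ℂ} (loop : cup ≫ cap = δ • 𝟙 (𝟙_ C))
    (hf : f ≫ f = f) (c : ℂ) :
    partialTrace cup cap (jwStep cup cap T f c) = (δ + c) • f := by
  have trace_f : partialTrace cup cap (f ▷ X) = δ • f := by
    rw [← Category.id_comp (f ▷ X), partialTrace_comp_whiskerRight, partialTrace_id loop,
      Linear.smul_comp, Category.id_comp]
  rw [jwStep, partialTrace_add_smul, trace_f, partialTrace_whiskerRight_comp,
    partialTrace_comp_whiskerRight, dual.partialTrace_capCup, Category.id_comp, hf, add_smul]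

theorem whiskerLeft_jwStep_extendMul {A N : C} {m : A ⊗ T ⟶ N} {g : N ⊗ X ⟶ N ⊗ X}
    {g' : (N ⊗ X) ⊗ X ⟶ (N ⊗ X) ⊗ X} (h : A ◁ f ≫ extendMul X m ≫ g = extendMul X m ≫ g)
    (hg : g ▷ X ≫ g' = g') (hcup : cupAt cup N ≫ g' = 0) :
    A ◁ jwStep cup cap T f c ≫ extendMul X (extendMul X m) ≫ g' =
      extendMul X (extendMul X m) ≫ g' := by
  have absorb : A ◁ (f ▷ X) ≫ extendMul X (extendMul X m) ≫ g' =
      extendMul X (extendMul X m) ≫ g' := by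
    rw [← hg, reassoc_of% whiskerLeft_extendMul, reassoc_of% extendMul_comp,
      reassoc_of% extendMul_comp, Category.assoc, h]
  simp only [jwStep, MonoidalPreadditive.whiskerLeft_add, MonoidalLinear.whiskerLeft_smul,
    MonoidalCategory.whiskerLeft_comp, Preadditive.add_comp, Linear.smul_comp, Category.assoc,
    absorb, reassoc_of% whiskerLeft_capCup]
  rw [capCup_eq, Category.assoc, hcup]
  simp

theorem eq_smul_of_mate_comp_jwStep (dual : IsDuality cup cap) {Y : C} {g : Y ⊗ X ⟶ T ⊗ X}
    (hg : g ≫ f = g) (h : cupAt cup Y ≫ g ▷ X ≫ jwStep cup cap T f c = 0) :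
    g = (-c) • (partialTrace cup cap g ▷ X ≫ f) := by
  rw [mate_jwStep hg] at h
  calc g = (cupAt cup Y ≫ g ▷ X) ▷ X ≫ capAt cap (T ⊗ X) := (dual.mate_capAt g).symm
    _ = (-c) • ((partialTrace cup cap g ≫ cupAt cup T ≫ f ▷ X) ▷ X ≫ capAt cap (T ⊗ X)) := by
      rw [eq_neg_of_add_eq_zero_left h, ← neg_smul, MonoidalLinear.smul_whiskerRight,
        Linear.smul_comp]
    _ = (-c) • (partialTrace cup cap g ▷ X ≫ f) := by
      rw [comp_whiskerRight_assoc, dual.mate_capAt]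

end JonesWenzlStep

section Absorption
variable {C : Type*} [Category C] [MonoidalCategory C] {X : C}

theorem whiskerRight_comp_absorb {Y A B M : C} (g : Y ⟶ A) {f : A ⟶ A} {m : A ⊗ B ⟶ M}
    (h : f ▷ B ≫ m = m) : (g ≫ f) ▷ B ≫ m = g ▷ B ≫ m := by
  rw [comp_whiskerRight_assoc, h]

theorem whiskerRight_extendMul_absorb {A B M : C} {f : A ⟶ A} {m : A ⊗ B ⟶ M} {g : M ⟶ M}
    {g' : M ⊗ X ⟶ M ⊗ X} (h : f ▷ B ≫ m ≫ g = m ≫ g) (hg : g ▷ X ≫ g' = g') :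
    f ▷ (B ⊗ X) ≫ extendMul X m ≫ g' = extendMul X m ≫ g' := by
  rw [← hg, reassoc_of% whiskerRight_extendMul, reassoc_of% extendMul_comp,
    reassoc_of% extendMul_comp, Category.assoc, h]

theorem whiskerRight_comp_rightUnitor_comp {Y A B : C} (g : Y ⟶ A) (f : A ⟶ B) :
    g ▷ 𝟙_ C ≫ (ρ_ A).hom ≫ f = (ρ_ Y).hom ≫ g ≫ f := by
  simp

theorem whiskerRight_rightUnitor_inv_comp {Y A : C} {w : Y ⊗ 𝟙_ C ⟶ A} {f : A ⟶ A}
    (h : w ≫ f = w) : ((ρ_ Y).inv ≫ w) ▷ 𝟙_ C ≫ (ρ_ A).hom ≫ f = w := by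
  rw [whiskerRight_comp_rightUnitor_comp, Category.assoc, h, Iso.hom_inv_id_assoc]

theorem whiskerLeft_id_comp {A B M : C} (m : A ⊗ B ⟶ M) : A ◁ 𝟙 B ≫ m = m := by
  simp

variable {cup : 𝟙_ C ⟶ X ⊗ X}

theorem cup_cons_cons_unit :
    cup ▷ 𝟙_ C ≫ (α_ X X (𝟙_ C)).hom ≫ X ◁ ((ρ_ X).hom ≫ (λ_ X).inv) ≫
      extendMul X ((ρ_ X).hom ≫ (λ_ X).inv) = (λ_ (𝟙_ C)).hom ≫ cupAt cup (𝟙_ C) := by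
  simp only [extendMul, cupAt]
  monoidal

theorem cupAt_whiskerRight_cons_cons {Y B B' B'' : C} (s : X ⊗ B ⟶ B') (s' : X ⊗ B' ⟶ B'') :
    cupAt cup Y ▷ B ≫ (α_ (Y ⊗ X) X B).hom ≫ (Y ⊗ X) ◁ s ≫ (α_ Y X B').hom ≫ Y ◁ s' =
      (ρ_ Y).inv ▷ B ≫ (α_ Y (𝟙_ C) B).hom ≫
        Y ◁ (cup ▷ B ≫ (α_ X X B).hom ≫ X ◁ s ≫ s') := by
  simp only [cupAt]
  monoidal

variable [Preadditive C]

theorem cup_cons_cons_unit_comp_eq_zero {M : C} {g : (𝟙_ C ⊗ X) ⊗ X ⟶ M}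
    (h : cupAt cup (𝟙_ C) ≫ g = 0) :
    cup ▷ 𝟙_ C ≫ (α_ X X (𝟙_ C)).hom ≫ X ◁ ((ρ_ X).hom ≫ (λ_ X).inv) ≫
      extendMul X ((ρ_ X).hom ≫ (λ_ X).inv) ≫ g = 0 := by
  rw [reassoc_of% cup_cons_cons_unit, h, comp_zero]

variable [MonoidalPreadditive C]

theorem cup_cons_cons_extendMul_comp_eq_zero {B B' B'' : C} {s : X ⊗ B ⟶ B'} {s' : X ⊗ B' ⟶ B''}
    {g : B'' ⟶ B''} {g' : B'' ⊗ X ⟶ B'' ⊗ X}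
    (h : cup ▷ B ≫ (α_ X X B).hom ≫ X ◁ s ≫ s' ≫ g = 0) (hg : g ▷ X ≫ g' = g') :
    cup ▷ (B ⊗ X) ≫ (α_ X X (B ⊗ X)).hom ≫ X ◁ extendMul X s ≫ extendMul X s' ≫ g' = 0 := by
  rw [← hg, reassoc_of% cup_cons_cons, ← comp_whiskerRight_assoc]
  simp only [Category.assoc, h, MonoidalPreadditive.zero_whiskerRight, zero_comp, comp_zero]

theorem cupAt_whiskerRight_cons_cons_comp_eq_zero {Y B B' B'' M : C} {s : X ⊗ B ⟶ B'}
    {s' : X ⊗ B' ⟶ B''} {f : B'' ⟶ B''} {w : Y ⊗ B'' ⟶ M}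
    (h : cup ▷ B ≫ (α_ X X B).hom ≫ X ◁ s ≫ s' ≫ f = 0) (hw : Y ◁ f ≫ w = w) :
    cupAt cup Y ▷ B ≫ (α_ (Y ⊗ X) X B).hom ≫ (Y ⊗ X) ◁ s ≫ (α_ Y X B').hom ≫ Y ◁ s' ≫ w = 0 := by
  rw [← hw, reassoc_of% cupAt_whiskerRight_cons_cons, ← MonoidalCategory.whiskerLeft_comp_assoc]
  simp only [Category.assoc, h, MonoidalPreadditive.whiskerLeft_zero, zero_comp, comp_zero]

end Absorption

section QuantumIntegers
variable {q : ℂ}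

theorem qInt_one (h : qInt q 1 ≠ 0) : qInt q 1 = 1 := by
  have : q - q⁻¹ ≠ 0 := fun h0 => h (by simp [qInt, h0])
  simp [qInt, this]

theorem neg_qInt_two_add_div (hq : q ≠ 0) {n : ℕ} (h : qInt q (n + 1) ≠ 0) :
    -qInt q 2 + qInt q n / qInt q (n + 1) = -(qInt q (n + 2) / qInt q (n + 1)) := by
  field_simp
  linear_combination -qInt_rec hq n

end QuantumIntegers

section JonesWenzl
variable {C : Type*} [Category C] [MonoidalCategory C] [Preadditive C] [Linear ℂ C]

/-- A self-dual object `X` whose loop has the value `-[2]`, at a parameter `q` for which the quantum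
integers `[1], …, [N + 1]` do not vanish. These are the conditions under which the Jones–Wenzl
projections `f_0, …, f_{N+1}` on the tensor powers of `X` are well behaved. -/
structure TLObject (q : ℂ) (N : ℕ) {X : C} (cup : 𝟙_ C ⟶ X ⊗ X) (cap : X ⊗ X ⟶ 𝟙_ C) : Prop
    extends IsDuality cup cap where
  q_ne_zero : q ≠ 0
  loop : cup ≫ cap = (-qInt q 2) • 𝟙 (𝟙_ C)
  qInt_ne_zero : ∀ n ≤ N, qInt q (n + 1) ≠ 0

namespace TLObject
variable [MonoidalPreadditive C] [MonoidalLinear ℂ C]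
  {q : ℂ} {N : ℕ} {X : C} {cup : 𝟙_ C ⟶ X ⊗ X} {cap : X ⊗ X ⟶ 𝟙_ C}

theorem jw_comp_jw (H : TLObject q N cup cap) (n : ℕ) :
    jw q cup cap n ≫ jw q cup cap n = jw q cup cap n :=
  jw_idem H.q_ne_zero cup cap H.coev_ev H.ev_coev H.loop n

theorem jw_whiskerRight_jw_succ (H : TLObject q N cup cap) (n : ℕ) :
    jw q cup cap n ▷ X ≫ (jw q cup cap (n + 1) : tpow X n ⊗ X ⟶ tpow X n ⊗ X) =
      jw q cup cap (n + 1) := by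
  cases n with
  | zero => exact (Category.comp_id _).trans (id_whiskerRight _ _)
  | succ n => exact whiskerRight_jwStep (H.jw_comp_jw (n + 1)) _

theorem partialTrace_jw (H : TLObject q N cup cap) (n : ℕ) (hn : n ≤ N) :
    partialTrace cup cap (jw q cup cap (n + 1) : tpow X n ⊗ X ⟶ tpow X n ⊗ X) =
      (-(qInt q (n + 2) / qInt q (n + 1))) • jw q cup cap n := by
  cases n with
  | zero =>
    have coeff : -(qInt q (0 + 2) / qInt q (0 + 1)) = -qInt q 2 := by
      rw [zero_add, zero_add, qInt_one (H.qInt_ne_zero 0 hn), div_one]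
    rw [coeff]
    exact partialTrace_id H.loop _
  | succ n =>
    rw [← neg_qInt_two_add_div H.q_ne_zero (H.qInt_ne_zero (n + 1) hn)]
    exact partialTrace_jwStep H.toIsDuality H.loop (H.jw_comp_jw (n + 1)) _

theorem cupAt_jw (H : TLObject q N cup cap) (n : ℕ) (hn : n + 1 ≤ N) :
    cupAt cup (tpow X n) ≫
      (jw q cup cap (n + 2) : (tpow X n ⊗ X) ⊗ X ⟶ (tpow X n ⊗ X) ⊗ X) = 0 := by
  have hn₁ : qInt q (n + 1) ≠ 0 := H.qInt_ne_zero n (by lia)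
  have hn₂ : qInt q (n + 2) ≠ 0 := H.qInt_ne_zero (n + 1) hn
  refine cupAt_jwStep (H.jw_comp_jw (n + 1)) (H.jw_whiskerRight_jw_succ n)
    (H.partialTrace_jw n (by lia)) ?_
  field_simp

theorem jw_whiskerRight_tpowMul_jw (H : TLObject q N cup cap) (i j : ℕ) {n : ℕ} (h : i + j = n) :
    jw q cup cap i ▷ tpow X j ≫ tpowMul X i j h ≫ jw q cup cap n =
      tpowMul X i j h ≫ jw q cup cap n := by
  induction j generalizing n with
  | zero =>
    obtain rfl : i = n := h
    rw [tpowMul_zero_right]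
    exact (whiskerRight_comp_rightUnitor_comp _ _).trans (congrArg (_ ≫ ·) (H.jw_comp_jw i))
  | succ j ih =>
    obtain _ | n := n
    · lia
    have hn : i + j = n := by lia
    rw [tpowMul_succ_right X i j hn]
    exact whiskerRight_extendMul_absorb (ih hn) (H.jw_whiskerRight_jw_succ n)

theorem whiskerLeft_jw_tpowMul_jw (H : TLObject q N cup cap) (i j : ℕ) {n : ℕ} (h : i + j = n)
    (hn : n ≤ N + 1) :
    tpow X i ◁ jw q cup cap j ≫ tpowMul X i j h ≫ jw q cup cap n =
      tpowMul X i j h ≫ jw q cup cap n := by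
  induction j using Nat.twoStepInduction generalizing n with
  | zero => exact whiskerLeft_id_comp _
  | one => exact whiskerLeft_id_comp _
  | more j _ ih =>
    obtain _ | _ | n := n
    · lia
    · lia
    have hn' : i + j = n := by lia
    have ih := ih (n := n + 1) (by lia) (by lia)
    rw [tpowMul_succ_right X i j hn'] at ih
    rw [tpowMul_succ_right X i (j + 1) (n := n + 1) (by lia), tpowMul_succ_right X i j hn']
    exact whiskerLeft_jwStep_extendMul ih (H.jw_whiskerRight_jw_succ (n + 1))
      (H.cupAt_jw n (by lia))

theorem whiskerLeft_jw_tpowCons_jw (H : TLObject q N cup cap) (j : ℕ) (hj : j ≤ N) :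
    X ◁ jw q cup cap j ≫ (tpowCons X j).hom ≫ jw q cup cap (j + 1) =
      (tpowCons X j).hom ≫ jw q cup cap (j + 1) := by
  induction j using Nat.twoStepInduction with
  | zero => exact whiskerLeft_id_comp _
  | one => exact whiskerLeft_id_comp _
  | more j _ ih =>
    exact whiskerLeft_jwStep_extendMul (ih (by lia)) (H.jw_whiskerRight_jw_succ (j + 2))
      (H.cupAt_jw (j + 1) (by lia))

theorem cup_tpowCons_tpowCons_jw (H : TLObject q N cup cap) (j : ℕ) (hj : j + 1 ≤ N) :
    cup ▷ tpow X j ≫ (α_ X X (tpow X j)).hom ≫ X ◁ (tpowCons X j).hom ≫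
      (tpowCons X (j + 1)).hom ≫ jw q cup cap (j + 2) = 0 := by
  induction j with
  | zero => exact cup_cons_cons_unit_comp_eq_zero (H.cupAt_jw 0 hj)
  | succ j ih =>
    exact cup_cons_cons_extendMul_comp_eq_zero (ih (by lia)) (H.jw_whiskerRight_jw_succ (j + 2))

theorem eq_zero_of_whiskerRight_tpowMul_jw (H : TLObject q N cup cap) (i j : ℕ) (h : i + j = N)
    {Y : C} (g : Y ⟶ tpow X i) (hg : g ≫ jw q cup cap i = g)
    (h0 : g ▷ tpow X j ≫ tpowMul X i j h ≫ jw q cup cap N = 0) : g = 0 := by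
  induction j generalizing i Y with
  | zero =>
    obtain rfl : i = N := h
    rw [tpowMul_zero_right] at h0
    have unitor_g := (whiskerRight_comp_rightUnitor_comp _ _).symm.trans h0
    rw [hg] at unitor_g
    rwa [← cancel_epi (ρ_ Y).hom, comp_zero]
  | succ j ih =>
    have hi : i + 1 + j = N := by lia
    have hd : -(qInt q (i + 2) / qInt q (i + 1)) ≠ 0 :=
      neg_ne_zero.mpr (div_ne_zero (H.qInt_ne_zero (i + 1) (by lia)) (H.qInt_ne_zero i (by lia)))
    refine eq_zero_of_whiskerRight_comp (H.partialTrace_jw i (by lia)) hd hg ?_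
    refine ih (i + 1) hi _ ?_ ?_
    · exact (Category.assoc _ _ _).trans (congrArg (g ▷ X ≫ ·) (H.jw_comp_jw (i + 1)))
    · refine (whiskerRight_comp_absorb (A := tpow X (i + 1)) _
        (H.jw_whiskerRight_tpowMul_jw (i + 1) j hi)).trans
          ((whiskerRight_tpowMul_succ_left X hi h g _).trans ?_)
      rw [h0, comp_zero, comp_zero]

theorem cupAt_whiskerRight_jw_eq_zero (H : TLObject q N cup cap) (hN : jw q cup cap (N + 1) = 0)
    {i j : ℕ} (hi : i + 1 + j = N) {Y : C} {g : Y ⊗ X ⟶ tpow X i ⊗ X}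
    {w : Y ⊗ tpow X (j + 1) ⟶ tpow X N} (hw : Y ◁ jw q cup cap (j + 1) ≫ w = w)
    (hgw : g ▷ tpow X j ≫ (tpowMul X (i + 1) j hi : (tpow X i ⊗ X) ⊗ tpow X j ⟶ _) ≫
      jw q cup cap N = (α_ Y X (tpow X j)).hom ≫ Y ◁ (tpowCons X j).hom ≫ w) :
    cupAt cup Y ≫ g ▷ X ≫
      (jw q cup cap (i + 2) : (tpow X i ⊗ X) ⊗ X ⟶ (tpow X i ⊗ X) ⊗ X) = 0 := by
  obtain _ | j := j
  · obtain rfl : i + 1 = N := hi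
    rw [hN]
    exact (congrArg (cupAt cup Y ≫ ·) comp_zero).trans comp_zero
  have hi' : i + 2 + j = N := by lia
  have absorb := H.jw_whiskerRight_tpowMul_jw (i + 2) j hi'
  refine (Category.assoc _ _ _).symm.trans (H.eq_zero_of_whiskerRight_tpowMul_jw (i + 2) j hi'
    ((cupAt cup Y ≫ g ▷ X) ≫ jw q cup cap (i + 2)) ?_ ?_)
  · exact (Category.assoc _ _ _).trans (congrArg (_ ≫ ·) (H.jw_comp_jw (i + 2)))
  · refine (whiskerRight_comp_absorb (A := tpow X (i + 2)) _ absorb).trans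
      ((comp_whiskerRight_assoc _ _ _ _).trans ((congrArg (cupAt cup Y ▷ tpow X j ≫ ·)
        ((whiskerRight_tpowMul_succ_left X hi' hi g _).trans
          (congrArg (fun t => (α_ _ _ _).hom ≫ _ ◁ (tpowCons X j).hom ≫ t) hgw))).trans ?_))
    exact cupAt_whiskerRight_cons_cons_comp_eq_zero (H.cup_tpowCons_tpowCons_jw j (by lia)) hw

theorem smul_whiskerRight_tpowMul_jw (H : TLObject q N cup cap) {i j n : ℕ} (hi : i + 1 + j = n)
    (h : i + (j + 1) = n) {Y : C} (a : ℂ) (v : Y ⟶ tpow X i) :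
    (a • (v ▷ X ≫ (jw q cup cap (i + 1) : tpow X i ⊗ X ⟶ tpow X i ⊗ X))) ▷ tpow X j ≫
        (tpowMul X (i + 1) j hi : (tpow X i ⊗ X) ⊗ tpow X j ⟶ _) ≫ jw q cup cap n =
      (α_ Y X (tpow X j)).hom ≫ Y ◁ (tpowCons X j).hom ≫
        (a • (v ≫ jw q cup cap i)) ▷ tpow X (j + 1) ≫ tpowMul X i (j + 1) h ≫ jw q cup cap n := by
  simp only [MonoidalLinear.smul_whiskerRight, Linear.smul_comp, Linear.comp_smul]
  congr 1
  rw [whiskerRight_comp_absorb v (H.jw_whiskerRight_tpowMul_jw i (j + 1) h)]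
  exact (whiskerRight_comp_absorb _ (H.jw_whiskerRight_tpowMul_jw (i + 1) j hi)).trans
    (whiskerRight_tpowMul_succ_left X hi h v _)

theorem exists_whiskerRight_tpowMul_jw_eq (H : TLObject q N cup cap)
    (hN : jw q cup cap (N + 1) = 0) (i j : ℕ) (h : i + j = N) {Y : C}
    (w : Y ⊗ tpow X j ⟶ tpow X N) (hw : Y ◁ jw q cup cap j ≫ w = w)
    (hwN : w ≫ jw q cup cap N = w) :
    ∃ g : Y ⟶ tpow X i, g ≫ jw q cup cap i = g ∧
      g ▷ tpow X j ≫ tpowMul X i j h ≫ jw q cup cap N = w := by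
  induction j generalizing i Y with
  | zero =>
    obtain rfl : i = N := h
    refine ⟨(ρ_ Y).inv ≫ w, (Category.assoc _ _ _).trans (congrArg (_ ≫ ·) hwN), ?_⟩
    rw [tpowMul_zero_right]
    exact whiskerRight_rightUnitor_inv_comp hwN
  | succ j ih =>
    have hi : i + 1 + j = N := by lia
    have hw' : (Y ⊗ X) ◁ jw q cup cap j ≫ (α_ Y X (tpow X j)).hom ≫ Y ◁ (tpowCons X j).hom ≫ w =
        (α_ Y X (tpow X j)).hom ≫ Y ◁ (tpowCons X j).hom ≫ w := by
      have absorb := congrArg (Y ◁ ·) (H.whiskerLeft_jw_tpowCons_jw j (by lia))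
      simp only [MonoidalCategory.whiskerLeft_comp] at absorb
      rw [← hw, associator_naturality_right_assoc, reassoc_of% absorb]
    obtain ⟨g, hg, hgw⟩ := ih (i + 1) hi _ hw' (by simp only [Category.assoc, hwN])
    let v : Y ⟶ tpow X i := partialTrace cup cap (g : Y ⊗ X ⟶ tpow X i ⊗ X)
    have hgv := eq_smul_of_mate_comp_jwStep H.toIsDuality (T := tpow X i) hg
      (H.cupAt_whiskerRight_jw_eq_zero hN hi hw hgw)
    refine ⟨(-(qInt q (i + 1) / qInt q (i + 2))) • (v ≫ jw q cup cap i), ?_, ?_⟩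
    · rw [Linear.smul_comp, Category.assoc, H.jw_comp_jw]
    · rw [← cancel_epi (Y ◁ (tpowCons X j).hom), ← cancel_epi (α_ Y X (tpow X j)).hom, ← hgw, hgv]
      exact (H.smul_whiskerRight_tpowMul_jw hi h _ v).symm

end TLObject
end JonesWenzl

/-! ### Images of the Jones–Wenzl projections -/

section UnitRetract
variable {C : Type*} [Category C] [MonoidalCategory C] {U A B : C} {u : 𝟙_ C ⟶ U} {z : U ⟶ 𝟙_ C}
  {ι : A ⟶ B} {π : B ⟶ A}

theorem whiskerRight_tensorHom_leftUnitor (hu : u ≫ z = 𝟙 _) (hι : ι ≫ π = 𝟙 A) :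
    u ▷ A ≫ (z ⊗ₘ ι) ≫ (λ_ B).hom ≫ π = (λ_ A).hom := by
  rw [MonoidalCategory.tensorHom_def, Category.assoc, ← comp_whiskerRight_assoc, hu]
  simp [hι]

theorem whiskerLeft_tensorHom_rightUnitor (hu : u ≫ z = 𝟙 _) (hι : ι ≫ π = 𝟙 A) :
    A ◁ u ≫ (ι ⊗ₘ z) ≫ (ρ_ B).hom ≫ π = (ρ_ A).hom := by
  rw [MonoidalCategory.tensorHom_def', Category.assoc, ← MonoidalCategory.whiskerLeft_comp_assoc,
    hu]
  simp [hι]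

end UnitRetract

section JWImages
variable {C : Type*} [Category C] [MonoidalCategory C] [Preadditive C] [Linear ℂ C]

/-- Objects `F i` exhibited as the images of the Jones–Wenzl projections `f_i`, with the unit `u`
and the multiplication `m` induced from the tensor powers of `X`. -/
structure JWImages (q : ℂ) {X : C} (cup : 𝟙_ C ⟶ X ⊗ X) (cap : X ⊗ X ⟶ 𝟙_ C) (F : ℕ → C)
    (u : 𝟙_ C ⟶ F 0) (m : ∀ i j, F i ⊗ F j ⟶ F (i + j)) where
  ι : ∀ i, F i ⟶ tpow X i
  π : ∀ i, tpow X i ⟶ F i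
  ι_π : ∀ i, ι i ≫ π i = 𝟙 _
  π_ι : ∀ i, π i ≫ ι i = jw q cup cap i
  unit_ι : u ≫ ι 0 = 𝟙 (𝟙_ C)
  mul_eq : ∀ i j, m i j = (ι i ⊗ₘ ι j) ≫ (tpowAdd X i j).hom ≫ π (i + j)

namespace JWImages
variable {q : ℂ} {X : C} {cup : 𝟙_ C ⟶ X ⊗ X} {cap : X ⊗ X ⟶ 𝟙_ C} {F : ℕ → C}
  {u : 𝟙_ C ⟶ F 0} {m : ∀ i j, F i ⊗ F j ⟶ F (i + j)}

theorem gradedMul_eq (R : JWImages q cup cap F u m) (i j : ℕ) {n : ℕ} (h : i + j = n) :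
    gradedMul m i j h = (R.ι i ⊗ₘ R.ι j) ≫ tpowMul X i j h ≫ R.π n := by
  subst h
  simp [gradedMul, tpowMul, R.mul_eq]

theorem ι_jw (R : JWImages q cup cap F u m) (i : ℕ) : R.ι i ≫ jw q cup cap i = R.ι i := by
  rw [← R.π_ι, ← Category.assoc, R.ι_π, Category.id_comp]

theorem jw_π (R : JWImages q cup cap F u m) (i : ℕ) : jw q cup cap i ≫ R.π i = R.π i := by
  rw [← R.π_ι, Category.assoc, R.ι_π, Category.comp_id]

theorem gradedMul_whiskerRight_gradedMul (R : JWImages q cup cap F u m) (i j l : ℕ) {a n : ℕ}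
    (ha : i + j = a) (h : a + l = n) :
    gradedMul m i j ha ▷ F l ≫ gradedMul m a l h =
      ((R.ι i ⊗ₘ R.ι j) ⊗ₘ R.ι l) ≫ tpowMul X i j ha ▷ tpow X l ≫
        jw q cup cap a ▷ tpow X l ≫ tpowMul X a l h ≫ jw q cup cap n ≫ R.π n := by
  simp only [R.gradedMul_eq, ← MonoidalCategory.tensorHom_id, tensorHom_comp_tensorHom_assoc,
    Category.id_comp, Category.comp_id, Category.assoc, R.π_ι, R.jw_π]

theorem whiskerLeft_gradedMul_gradedMul (R : JWImages q cup cap F u m) (i j l : ℕ) {b n : ℕ}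
    (hb : j + l = b) (h : i + b = n) :
    F i ◁ gradedMul m j l hb ≫ gradedMul m i b h =
      (R.ι i ⊗ₘ (R.ι j ⊗ₘ R.ι l)) ≫ tpow X i ◁ tpowMul X j l hb ≫
        tpow X i ◁ jw q cup cap b ≫ tpowMul X i b h ≫ jw q cup cap n ≫ R.π n := by
  simp only [R.gradedMul_eq, ← MonoidalCategory.id_tensorHom, tensorHom_comp_tensorHom_assoc,
    Category.id_comp, Category.comp_id, Category.assoc, R.π_ι, R.jw_π]

theorem whiskerLeft_ι_tpowMul_jw_π (R : JWImages q cup cap F u m) {i j n : ℕ} (h : i + j = n)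
    {Y : C} {g : Y ⟶ tpow X i} (hg : g ≫ jw q cup cap i = g) :
    Y ◁ R.ι j ≫ (g ▷ tpow X j ≫ tpowMul X i j h ≫ jw q cup cap n) ≫ R.π n =
      (g ≫ R.π i) ▷ F j ≫ gradedMul m i j h := by
  simp only [R.gradedMul_eq, ← MonoidalCategory.tensorHom_id, ← MonoidalCategory.id_tensorHom,
    tensorHom_comp_tensorHom_assoc, Category.id_comp, Category.comp_id, Category.assoc, R.π_ι,
    R.jw_π, hg]

variable [MonoidalPreadditive C] [MonoidalLinear ℂ C] {N : ℕ}

theorem whiskerLeft_π_gradedMul_ι (R : JWImages q cup cap F u m) (H : TLObject q N cup cap)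
    {i j n : ℕ} (h : i + j = n) (hn : n ≤ N + 1) {Y : C} (g : Y ⟶ F i) :
    Y ◁ R.π j ≫ (g ▷ F j ≫ gradedMul m i j h) ≫ R.ι n =
      (g ≫ R.ι i) ▷ tpow X j ≫ tpowMul X i j h ≫ jw q cup cap n := by
  rw [R.gradedMul_eq, ← H.whiskerLeft_jw_tpowMul_jw i j h hn]
  simp only [← MonoidalCategory.tensorHom_id, ← MonoidalCategory.id_tensorHom,
    tensorHom_comp_tensorHom_assoc, Category.id_comp, Category.comp_id, Category.assoc, R.π_ι]

theorem isGradedAlgebra (R : JWImages q cup cap F u m) (H : TLObject q N cup cap) :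
    IsGradedAlgebra N u m where
  one_mul j := by
    rw [R.gradedMul_eq, tpowMul_zero_left]
    exact whiskerRight_tensorHom_leftUnitor R.unit_ι (R.ι_π j)
  mul_one i := by
    rw [R.gradedMul_eq, tpowMul_zero_right]
    exact whiskerLeft_tensorHom_rightUnitor R.unit_ι (R.ι_π i)
  mul_assoc i j l a b n ha hb h h' hn := by
    rw [R.gradedMul_whiskerRight_gradedMul, R.whiskerLeft_gradedMul_gradedMul,
      reassoc_of% H.jw_whiskerRight_tpowMul_jw a l h,
      reassoc_of% H.whiskerLeft_jw_tpowMul_jw i b h' (by lia),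
      reassoc_of% tpowMul_assoc X i j l ha hb h h', associator_naturality_assoc]

theorem isLeftPerfect_gradedMul (R : JWImages q cup cap F u m) (H : TLObject q N cup cap)
    (hN : jw q cup cap (N + 1) = 0) (i j : ℕ) (h : i + j = N) :
    IsLeftPerfect (gradedMul m i j h) := by
  refine isLeftPerfect_of_preadditive (fun {Y} g hg => ?_) fun {Y} w => ?_
  · have hgι : g ≫ R.ι i = 0 := by
      refine H.eq_zero_of_whiskerRight_tpowMul_jw i j h _ (by rw [Category.assoc, R.ι_jw]) ?_
      rw [← R.whiskerLeft_π_gradedMul_ι H h N.le_succ, hg, zero_comp, comp_zero]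
    rw [← Category.comp_id g, ← R.ι_π, ← Category.assoc, hgι, zero_comp]
  · obtain ⟨g, hg, hgw⟩ := H.exists_whiskerRight_tpowMul_jw_eq hN i j h (Y ◁ R.π j ≫ w ≫ R.ι N)
      (by rw [← MonoidalCategory.whiskerLeft_comp_assoc, R.jw_π])
      (by simp only [Category.assoc, R.ι_jw])
    refine ⟨g ≫ R.π i, ?_⟩
    rw [← R.whiskerLeft_ι_tpowMul_jw_π h hg, hgw]
    simp only [Category.assoc, R.ι_π, Category.comp_id, ← MonoidalCategory.whiskerLeft_comp_assoc,
      MonoidalCategory.whiskerLeft_id, Category.id_comp]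

end JWImages
end JWImages

/-! ### Transfer along monoidal functors -/

section Transfer
open Functor.LaxMonoidal Functor.OplaxMonoidal Functor.Monoidal

variable {C D : Type*} [Category C] [MonoidalCategory C] [Category D] [MonoidalCategory D]
  (G : C ⥤ D) [G.Monoidal]

/-- The comparison isomorphism between the tensor powers of `G.obj X` and the images of those
of `X`. -/
def tpowMapIso (X : C) : ∀ n : ℕ, tpow (G.obj X) n ≅ G.obj (tpow X n)
  | 0 => εIso G
  | n + 1 => whiskerRightIso (tpowMapIso X n) (G.obj X) ≪≫ μIso G (tpow X n) X

/-- A comparison morphism `T' ⟶ G.obj T` extended by one strand; this is the inductive step of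
`tpowMapIso`. -/
def extendMap {T' : D} {T : C} (t : T' ⟶ G.obj T) (X : C) : T' ⊗ G.obj X ⟶ G.obj (T ⊗ X) :=
  t ▷ G.obj X ≫ μ G T X

theorem whiskerRight_extendMap {T' S' : D} {T S : C} {t : T' ⟶ G.obj T} {s : S' ⟶ G.obj S}
    {f' : T' ⟶ S'} {f : T ⟶ S} (h : f' ≫ s = t ≫ G.map f) (X : C) :
    f' ▷ G.obj X ≫ extendMap G s X = extendMap G t X ≫ G.map (f ▷ X) := by
  rw [extendMap, ← comp_whiskerRight_assoc, h]
  simp [extendMap]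

theorem associator_inv_extendMap {A' B' : D} {A B : C} (a : A' ⟶ G.obj A) (b : B' ⟶ G.obj B)
    (X : C) :
    (α_ A' B' (G.obj X)).inv ≫ extendMap G ((a ⊗ₘ b) ≫ μ G A B) X =
      (a ⊗ₘ extendMap G b X) ≫ μ G A (B ⊗ X) ≫ G.map (α_ A B X).inv := by
  have naturality := associator_inv_naturality a b (𝟙 (G.obj X))
  simp only [extendMap, comp_whiskerRight, Category.assoc]
  rw [← MonoidalCategory.tensorHom_id (a ⊗ₘ b), ← reassoc_of% naturality]
  simp only [MonoidalCategory.tensorHom_id]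
  rw [MonoidalCategory.tensorHom_def a, MonoidalCategory.tensorHom_def a]
  simp

theorem extendMap_extendMap {T' : D} {T : C} (t : T' ⟶ G.obj T) (X : C) :
    extendMap G (extendMap G t X) X =
      (α_ T' (G.obj X) (G.obj X)).hom ≫ (t ⊗ₘ μ G X X) ≫ μ G T (X ⊗ X) ≫
        G.map (α_ T X X).inv := by
  have extend_id : extendMap G (𝟙 (G.obj X)) X = μ G X X := by simp [extendMap]
  rw [← extend_id, ← associator_inv_extendMap, Iso.hom_inv_id_assoc,
    MonoidalCategory.tensorHom_id]
  rfl

theorem capCup_map {X : C} (cup : 𝟙_ C ⟶ X ⊗ X) (cap : X ⊗ X ⟶ 𝟙_ C) {T' : D} {T : C}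
    (t : T' ⟶ G.obj T) :
    capCup (mapCoev G cup) (mapEv G cap) T' ≫ extendMap G (extendMap G t X) X =
      extendMap G (extendMap G t X) X ≫ G.map (capCup cup cap T) := by
  have cap_cup : (mapEv G cap ≫ mapCoev G cup) ≫ μ G X X = μ G X X ≫ G.map (cap ≫ cup) := by
    simp [mapEv, mapCoev]
  have slide : T' ◁ (mapEv G cap ≫ mapCoev G cup) ≫ (t ⊗ₘ μ G X X) =
      (t ⊗ₘ μ G X X) ≫ G.obj T ◁ G.map (cap ≫ cup) := by
    rw [← MonoidalCategory.id_tensorHom, ← MonoidalCategory.id_tensorHom,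
      tensorHom_comp_tensorHom, tensorHom_comp_tensorHom, cap_cup, Category.id_comp,
      Category.comp_id]
  simp only [extendMap_extendMap, capCup, Category.assoc, Iso.inv_hom_id_assoc, Functor.map_comp,
    reassoc_of% slide, Iso.map_inv_hom_id_assoc]
  simp

theorem extendMul_map {A' B' E' : D} {A B E : C} {a : A' ⟶ G.obj A} {b : B' ⟶ G.obj B}
    {e : E' ⟶ G.obj E} {r' : A' ⊗ B' ⟶ E'} {r : A ⊗ B ⟶ E}
    (h : (a ⊗ₘ b) ≫ μ G _ _ ≫ G.map r = r' ≫ e) (X : C) :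
    (a ⊗ₘ extendMap G b X) ≫ μ G _ _ ≫ G.map (extendMul X r) =
      extendMul (G.obj X) r' ≫ extendMap G e X := by
  have extend := whiskerRight_extendMap G (t := (a ⊗ₘ b) ≫ μ G A B) (s := e)
    (h.symm.trans (Category.assoc _ _ _).symm) X
  rw [extendMul, extendMul, Category.assoc, extend, Functor.map_comp,
    ← reassoc_of% associator_inv_extendMap G a b X]

theorem tensorHom_ε_rightUnitor {A' : D} {A : C} (a : A' ⟶ G.obj A) :
    (a ⊗ₘ ε G) ≫ μ G _ _ ≫ G.map (ρ_ A).hom = (ρ_ A').hom ≫ a := by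
  rw [MonoidalCategory.tensorHom_def]
  simp

theorem tpowAdd_map (X : C) (i : ℕ) : ∀ j : ℕ,
    ((tpowMapIso G X i).hom ⊗ₘ (tpowMapIso G X j).hom) ≫ μ G _ _ ≫ G.map (tpowAdd X i j).hom =
      (tpowAdd (G.obj X) i j).hom ≫ (tpowMapIso G X (i + j)).hom
  | 0 => tensorHom_ε_rightUnitor G _
  | j + 1 => extendMul_map G (tpowAdd_map X i j) X

theorem comp_comp_η {U : D} {u : 𝟙_ D ⟶ U} {z : U ⟶ G.obj (𝟙_ C)} (h : u ≫ z = ε G) :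
    u ≫ z ≫ η G = 𝟙 _ := by
  rw [reassoc_of% h, ε_η]

variable [Preadditive C] [Linear ℂ C] [Preadditive D] [Linear ℂ D] [G.Linear ℂ]

theorem TLObject.map {q : ℂ} {N : ℕ} {X : C} {cup : 𝟙_ C ⟶ X ⊗ X} {cap : X ⊗ X ⟶ 𝟙_ C}
    (H : TLObject q N cup cap) : TLObject q N (mapCoev G cup) (mapEv G cap) where
  toIsDuality := H.toIsDuality.map G
  q_ne_zero := H.q_ne_zero
  loop := by
    simp only [mapCoev, mapEv, Category.assoc, δ_μ_assoc]
    rw [← Functor.map_comp_assoc, H.loop, Functor.map_smul, CategoryTheory.Functor.map_id,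
      Linear.smul_comp, Category.id_comp, Linear.comp_smul, ε_η]
  qInt_ne_zero := H.qInt_ne_zero

variable [G.Additive]

theorem jwStep_map {X : C} (cup : 𝟙_ C ⟶ X ⊗ X) (cap : X ⊗ X ⟶ 𝟙_ C) {T' : D} {T : C}
    (t : T' ⟶ G.obj T) {f' : T' ⊗ G.obj X ⟶ T' ⊗ G.obj X} {f : T ⊗ X ⟶ T ⊗ X}
    (h : f' ≫ extendMap G t X = extendMap G t X ≫ G.map f) (c : ℂ) :
    jwStep (mapCoev G cup) (mapEv G cap) T' f' c ≫ extendMap G (extendMap G t X) X =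
      extendMap G (extendMap G t X) X ≫ G.map (jwStep cup cap T f c) := by
  have slide_f := whiskerRight_extendMap G h X
  have slide_capCup := capCup_map G cup cap t
  simp only [jwStep, Functor.map_add, Functor.map_smul, Functor.map_comp, Preadditive.add_comp,
    Preadditive.comp_add, Linear.smul_comp, Linear.comp_smul, Category.assoc]
  rw [slide_f, reassoc_of% slide_capCup, reassoc_of% slide_f]

theorem jw_map (q : ℂ) {X : C} (cup : 𝟙_ C ⟶ X ⊗ X) (cap : X ⊗ X ⟶ 𝟙_ C) : ∀ n : ℕ,
    jw q (mapCoev G cup) (mapEv G cap) n ≫ (tpowMapIso G X n).hom =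
      (tpowMapIso G X n).hom ≫ G.map (jw q cup cap n)
  | 0 => by simp [jw]
  | 1 => by simp [jw]
  | n + 2 => jwStep_map G cup cap (tpowMapIso G X n).hom (jw_map q cup cap (n + 1)) _

/-- Splittings of the images under `G` of the Jones–Wenzl projections of `X` are images of the
Jones–Wenzl projections of `G.obj X`. -/
def JWImages.ofMap (q : ℂ) {X : C} (cup : 𝟙_ C ⟶ X ⊗ X) (cap : X ⊗ X ⟶ 𝟙_ C) {F : ℕ → D}
    {u : 𝟙_ D ⟶ F 0} {m : ∀ i j, F i ⊗ F j ⟶ F (i + j)}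
    (ι : ∀ i, F i ⟶ G.obj (tpow X i)) (π : ∀ i, G.obj (tpow X i) ⟶ F i)
    (ι_π : ∀ i, ι i ≫ π i = 𝟙 _) (π_ι : ∀ i, π i ≫ ι i = G.map (jw q cup cap i))
    (unit_ι : u ≫ ι 0 = ε G)
    (mul_eq : ∀ i j, m i j = (ι i ⊗ₘ ι j) ≫ μ G _ _ ≫ G.map (tpowAdd X i j).hom ≫ π (i + j)) :
    JWImages q (mapCoev G cup) (mapEv G cap) F u m where
  ι i := ι i ≫ (tpowMapIso G X i).inv
  π i := (tpowMapIso G X i).hom ≫ π i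
  ι_π i := by simp [ι_π]
  π_ι i := by
    rw [Category.assoc, reassoc_of% π_ι i, ← reassoc_of% jw_map G q cup cap i, Iso.hom_inv_id,
      Category.comp_id]
  unit_ι := comp_comp_η G unit_ι
  mul_eq i j := by
    rw [← reassoc_of% tpowAdd_map G X i j, tensorHom_comp_tensorHom_assoc]
    simp [mul_eq]

end Transfer

/-! ### The Temperley–Lieb category at level `k` -/

section Level
open CategoryTheory.Idempotents Functor.LaxMonoidal Functor.OplaxMonoidal Functor.Monoidal

variable (k : ℕ)

theorem isPrimitiveRoot_qRoot : IsPrimitiveRoot (qRoot k) (2 * (k + 2)) := by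
  convert Complex.isPrimitiveRoot_exp (2 * (k + 2)) (by lia) using 1
  rw [qRoot]
  congr 1
  push_cast
  field_simp

theorem qRoot_pow_sub_inv_ne_zero {n : ℕ} (hn : 0 < n) (hnk : n < k + 2) :
    qRoot k ^ n - (qRoot k ^ n)⁻¹ ≠ 0 := by
  intro h
  have pow_eq_one : qRoot k ^ (2 * n) = 1 := by
    have pow_ne_zero : qRoot k ^ n ≠ 0 := pow_ne_zero _ (Complex.exp_ne_zero _)
    rw [two_mul, pow_add]
    nth_rewrite 2 [sub_eq_zero.mp h]
    exact mul_inv_cancel₀ pow_ne_zero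
  exact (isPrimitiveRoot_qRoot k).pow_ne_one_of_pos_of_lt (by lia) (by lia) pow_eq_one

theorem qInt_qRoot_ne_zero {n : ℕ} (hn : n ≤ k) : qInt (qRoot k) (n + 1) ≠ 0 := by
  have denom_ne_zero := qRoot_pow_sub_inv_ne_zero k one_pos (by lia)
  rw [pow_one] at denom_ne_zero
  exact div_ne_zero (qRoot_pow_sub_inv_ne_zero k n.succ_pos (by lia)) denom_ne_zero

theorem TLPre.tlObject : TLObject (qRoot k) k (TLPre.cup k) (TLPre.cap k) where
  coev_ev := TLPre.zigzag₁ k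
  ev_coev := TLPre.zigzag₂ k
  q_ne_zero := Complex.exp_ne_zero _
  loop := TLPre.loop k
  qInt_ne_zero _ := qInt_qRoot_ne_zero k

/-- The embedding of the category of diagrams in its additive and idempotent completion. -/
abbrev TL.ofPre : TLPre k ⥤ TL k := Mat_.embedding (TLPre k) ⋙ toKaroubi (Mat_ (TLPre k))

theorem TL.embMul_eq (X Y : TLPre k) : TL.embMul k X Y = (matEmbeddingMul X Y).hom :=
  Mat_.hom_ext _ _ fun _ _ => ((matEmbeddingMul_isMonomial X Y).diag _).symm

theorem tensorHom_comp_eq_insert_id {C : Type*} [Category C] [MonoidalCategory C] {A B P S : C}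
    (a : A ⟶ A) (b : B ⟶ B) (r : A ⊗ B ⟶ P) (s : P ⟶ S) (t : S ⟶ S) :
    (a ⊗ₘ b) ≫ (r ≫ s) ≫ t =
      (a ⊗ₘ b) ≫ (((𝟙 A ⊗ₘ 𝟙 B) ≫ 𝟙 (A ⊗ B)) ≫ r) ≫ s ≫ t := by
  simp

theorem TL.mulF_eq (i j : ℕ) : TL.mulF k i j =
    ((F k i).decompId_i ⊗ₘ (F k j).decompId_i) ≫ μ (TL.ofPre k) _ _ ≫
      (TL.ofPre k).map (tpowAdd (TLPre.pt k) i j).hom ≫ (F k (i + j)).decompId_p := by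
  refine Karoubi.hom_ext _ _ ?_
  rw [TL.mulF, TL.embMul_eq]
  exact tensorHom_comp_eq_insert_id _ _ _ _ _

theorem TL.unitF_decompId_i : TL.unitF k ≫ (F k 0).decompId_i = ε (TL.ofPre k) := by
  have comp_of_eq_id {A : Mat_ (TLPre k)} {e : A ⟶ A} (he : e = 𝟙 A) :
      (𝟙 A ≫ e ≫ e) ≫ e = 𝟙 A ≫ 𝟙 A := by
    simp only [he, Category.comp_id]
  exact Karoubi.hom_ext _ _
    (comp_of_eq_id ((Mat_.embedding (TLPre k)).map_id (𝟙_ (TLPre k))))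

/-- The functor from the category of diagrams to the reduced Temperley–Lieb category. -/
abbrev RedTL.ofPre : TLPre k ⥤ RedTL k := TL.ofPre k ⋙ toIdealQuotient (TL.KillRel k)

theorem map_tensorHom_μ {C D E : Type*} [Category C] [MonoidalCategory C] [Category D]
    [MonoidalCategory D] [Category E] [MonoidalCategory E] (K : C ⥤ D) (Q : D ⥤ E) [K.Monoidal]
    [Q.Monoidal] {A B P : C} {A' B' P' : D} (a : A' ⟶ K.obj A) (b : B' ⟶ K.obj B) (r : A ⊗ B ⟶ P)
    (p : K.obj P ⟶ P') :
    μ Q A' B' ≫ Q.map ((a ⊗ₘ b) ≫ μ K A B ≫ K.map r ≫ p) =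
      (Q.map a ⊗ₘ Q.map b) ≫ μ (K ⋙ Q) A B ≫ (K ⋙ Q).map r ≫ Q.map p := by
  simp

theorem TL.decompId_p_decompId_i (i : ℕ) : (F k i).decompId_p ≫ (F k i).decompId_i =
    (TL.ofPre k).map (TLPre.proj k i) :=
  Karoubi.hom_ext _ _ (F k i).idem

/-- The objects `F_i` of the reduced Temperley–Lieb category as images of the Jones–Wenzl
projections. -/
def RedTL.jwImages : JWImages (qRoot k) (mapCoev (RedTL.ofPre k) (TLPre.cup k))
    (mapEv (RedTL.ofPre k) (TLPre.cap k)) (RedTL.F k) (RedTL.unitF k) (RedTL.mulF k) :=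
  let Q := toIdealQuotient (TL.KillRel k)
  JWImages.ofMap (RedTL.ofPre k) (qRoot k) (TLPre.cup k) (TLPre.cap k)
    (ι := fun i => Q.map (TL.F k i).decompId_i)
    (π := fun i => Q.map (TL.F k i).decompId_p)
    (ι_π := fun i => (Q.map_comp _ _).symm.trans (congrArg Q.map (TL.F k i).decompId.symm))
    (π_ι := fun i => (Q.map_comp _ _).symm.trans (congrArg Q.map (TL.decompId_p_decompId_i k i)))
    (unit_ι := (Q.map_comp _ _).symm.trans ((congrArg Q.map (TL.unitF_decompId_i k)).trans
      (Category.id_comp _).symm))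
    (mul_eq := fun i j => ((congrArg Q.map (TL.mulF_eq k i j)).trans
      (Category.id_comp _).symm).trans (map_tensorHom_μ (TL.ofPre k) Q _ _ _ _))

theorem RedTL.id_F_eq_zero : 𝟙 (RedTL.F k (k + 1)) = 0 := by
  have mem_ideal : TensorIdeal (TL.KillRel k) (𝟙 (TL.F k (k + 1)) - 0) := by
    rw [sub_zero]
    exact .of _ .mk
  exact CategoryTheory.Quotient.sound (idealRel (TL.KillRel k)) mem_ideal

theorem RedTL.jw_eq_zero : jw (qRoot k) (mapCoev (RedTL.ofPre k) (TLPre.cup k))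
    (mapEv (RedTL.ofPre k) (TLPre.cap k)) (k + 1) = 0 := by
  have R := RedTL.jwImages k
  rw [← R.π_ι, ← Category.comp_id (R.π (k + 1)), RedTL.id_F_eq_zero, comp_zero, zero_comp]

theorem RedTL.isGradedAlgebra : IsGradedAlgebra k (RedTL.unitF k) (RedTL.mulF k) :=
  (RedTL.jwImages k).isGradedAlgebra ((TLPre.tlObject k).map (RedTL.ofPre k))

theorem RedTL.isLeftPerfect_gradedMul (i j : ℕ) (h : i + j = k) :
    IsLeftPerfect (gradedMul (RedTL.mulF k) i j h) :=
  (RedTL.jwImages k).isLeftPerfect_gradedMul ((TLPre.tlObject k).map (RedTL.ofPre k))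
    (RedTL.jw_eq_zero k) i j h

theorem TL.nonempty_hasRightDual_F (i : ℕ) : Nonempty (HasRightDual (TL.F k i)) := by
  obtain ⟨_⟩ := (TLPre.tlObject k).toIsDuality.nonempty_hasRightDual
  obtain ⟨_⟩ := nonempty_hasRightDual_tpow (TLPre.pt k) i
  obtain ⟨_⟩ := nonempty_hasRightDual_map (TL.ofPre k) (tpow (TLPre.pt k) i)
  exact nonempty_hasRightDual_of_retract (A := (TL.ofPre k).obj (tpow (TLPre.pt k) i))
    ⟨(TL.F k i).decompId_i, (TL.F k i).decompId_p, (TL.F k i).decompId.symm⟩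

theorem RedTL.nonempty_hasRightDual_F (i : ℕ) : Nonempty (HasRightDual (RedTL.F k i)) := by
  obtain ⟨_⟩ := TL.nonempty_hasRightDual_F k i
  exact nonempty_hasRightDual_map (toIdealQuotient (TL.KillRel k)) (TL.F k i)

theorem RedTL.nonempty_hasRightDual_Sig : Nonempty (HasRightDual (RedTL.Sig k)) := by
  have : ∀ i : Fin (k + 1), HasRightDual (RedTL.F k i) := fun i =>
    (RedTL.nonempty_hasRightDual_F k i).some
  exact nonempty_hasRightDual_biproduct fun i : Fin (k + 1) => RedTL.F k i

end Level

end

end TLJ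

theorem lemma3p21 (k : ℕ) (hk : 1 ≤ k) :
    ∃ _ : MonObj (TLJ.RedTL.Sig k),
      MonObj.one (X := TLJ.RedTL.Sig k) = TLJ.RedTL.sigUnit k ∧
      MonObj.mul (X := TLJ.RedTL.Sig k) = TLJ.RedTL.sigMul k ∧
      Nonempty (HasRightDual (TLJ.RedTL.Sig k)) ∧
      ∀ _ : HasRightDual (TLJ.RedTL.Sig k),
        TLJ.IsFrobeniusStructure (TLJ.RedTL.Sig k) (TLJ.RedTL.F k k) (TLJ.RedTL.sigProj k) := by
  have algebra := TLJ.RedTL.isGradedAlgebra k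
  have perfect := TLJ.RedTL.isLeftPerfect_gradedMul k
  refine ⟨algebra.truncMonObj, rfl, rfl, TLJ.RedTL.nonempty_hasRightDual_Sig k, fun dual => ?_⟩
  let _ : HasRightDual (TLJ.truncSum (TLJ.RedTL.F k) k) := dual
  exact algebra.isFrobeniusStructure_truncProj perfect
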